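/- Let $A\in\mathbb R^{m\times m}$, $B\in\mathbb R^{n\times n}$, $C\in\mathbb R^{\ell\times\ell}$, let $\mathbb T\subseteq\mathbb R$ be a time interval with more than one point, and let $d\subseteq\mathbb R^{m+n+\ell}$ be a domain containing the origin. Consider the non-autonomous system in rational function form $$\dot x=\frac{Ax+\mathbf f(t,x,y,z)}{1+f(t,x,y,z)},\qquad \dot y=\frac{By+\mathbf g(t,x,y,z)}{1+g(t,x,y,z)},\qquad \dot z=\frac{Cz+\mathbf h(t,x,y,z)}{1+h(t,x,y,z)},$$ with $x\in\mathbb R^m$, $y\in\mathbb R^n$, $z\in\mathbb R^\ell$, vector functions $\mathbf f,\mathbf g,\mathbf h$ and scalar functions $f,g,h$. A time dependent quantity is $\mathcal O_c(p)$ if it is $O(|X|^p+|Y|^p+|Z|^p)$ as $(X,Y,Z)\to0$. Let $\mathfrak p\ge2$ be an integer, $\alpha\ge0$ and $\beta>0$, and assume: - every eigenvalue $a$ of $A$ has $|\Re a|\le\alpha$, every eigenvalue $b$ of $B$ has $\Re b\le-\beta$, every eigenvalue $c$ of $C$ has $\Re c\ge\beta$, and $\beta>(2\mathfrak p-1)\alpha$;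 - for $t\in\mathbb T$ all six functions are $C^{\mathfrak p}$ in $(x,y,z)\in d$, with derivatives in $(x,y,z)$ up to order $\mathfrak p$ continuous in $(t,x,y,z)\in\mathbb T\times d$; - for each $t\in\mathbb T$, $\mathbf f,\mathbf g,\mathbf h$ are $\mathcal O_c(2)$ and $f,g,h$ are $\mathcal O_c(1)$. Let $\tilde\mu$ be a threshold rate with $\mathfrak p\alpha\le\tilde\mu<\beta-(\mathfrak p-1)\alpha$. Fix any autonomous ($t$-independent) functions on $d$ of class $C^{\mathfrak p}$ to be regarded as the autonomous parts of the six given functions, and, for an order $p$, call *non-autonomous terms* the Taylor coefficients at the origin (functions of $t$), of order less than $p$, of the six differences between the given functions and their autonomous parts. Then for every order $p$ with $2\le p\le\mathfrak p$ there exist a coordinate transformation $x=x(t,X,Y,Z)$, $y=y(t,X,Y,Z)$, $z=z(t,X,Y,Z)$, multinomial in $(X,Y,Z)$ with coefficients that are $C^1$ functions of $t\in\mathbb T$, and a normal form system $$\dot X=AX+F(t,X,Y,Z)=AX+F_c(t,X)+\mathcal F(t,X,Y,Z)YZ,\qquad \dot Y=[B+G(t,X,Y,Z)]Y,\qquad \dot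 Z=[C+H(t,X,Y,Z)]Z,$$ where $F_c$, the rank three tensor $\mathcal F$ and the matrices $G,H$ are multinomial with coefficients continuous in $t\in\mathbb T$, such that the following hold. 1. Uniformly for $t$ in each compact subset of $\mathbb T$: the transformation is near identity, that is, $(x,y,z)-(X,Y,Z)=\mathcal O_c(2)$; the terms $F$, $GY$ and $HZ$ are $\mathcal O_c(2)$; and the difference between the system formed by the transformation with the normal form and the given rational system is $\mathcal O_c(p)$. Here, with $u=(x,y,z)$ and $U=(X,Y,Z)$, the difference is the vector field $\partial_tu+(\partial_Uu)\dot U$ induced by the normal form through the transformation, minus the right-hand side of the given system at $u=u(t,U)$. 2. If, in addition, the derivatives in $(x,y,z)$ up to order $\mathfrak p$ of the six functions are bounded in some neighbourhood of the origin uniformly over $t\in\mathbb T$, then all coefficients of the transformation and of the normal form are bounded on $\mathbb T$, and the order statements of item 1 hold uniformly for $t\in\mathbb T$. 3. $F$, $G$ and $H$ contain memory or anticipation integrals only in terms that are quadratic, or of higher power, in the non-autonomous terms: every coefficient of $F_c$, $\mathcal F$, $G$ and $H$ is, on $\mathbb T$, the sum of a real linear combination of the constant $1$ and of the non-autonomous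 terms themselves, and of a function built by sums, products and fast convolutions from constants and non-autonomous terms in which each term has at least two non-autonomous factors. Fast convolutions are, for complex $\mu$, $a\mapsto\int_{\mathbb T\cap(-\infty,t]}e^{\mu(t-\tau)}a(\tau)\,d\tau$ with $\Re\mu<-\tilde\mu$ and $a\mapsto\int_{\mathbb T\cap[t,\infty)}e^{\mu(t-\tau)}a(\tau)\,d\tau$ with $\Re\mu>\tilde\mu$, applied only to functions each of whose terms has at least one non-autonomous factor. -/

import Mathlib

open Set Filter Topology Asymptotics

noncomputable section

namespace RatNF

/-- The state space `ℝ^m × ℝ^n × ℝ^l` of triples `(x, y, z)` (or `(X, Y, Z)`). -/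
abbrev State (m n l : ℕ) : Type := (Fin m → ℝ) × (Fin n → ℝ) × (Fin l → ℝ)

/-- The names of the scalar coordinates of a state. -/
abbrev Idx (m n l : ℕ) : Type := Fin m ⊕ Fin n ⊕ Fin l

/-- The scalar coordinates of a state. -/
def coord {m n l : ℕ} (U : State m n l) : Idx m n l → ℝ :=
  Sum.elim U.1 (Sum.elim U.2.1 U.2.2)

/-- The gauge `|X|^p + |Y|^p + |Z|^p` of the order symbol. -/
def gauge {m n l : ℕ} (p : ℕ) (U : State m n l) : ℝ :=
  ‖U.1‖ ^ p + ‖U.2.1‖ ^ p + ‖U.2.2‖ ^ p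

/-- The order symbol for time dependent quantities: `φ(t,U) = O(|X|^p + |Y|^p + |Z|^p)` as `U → 0`,
uniformly for times `t ∈ J`. -/
def IsOrc {m n l : ℕ} {E : Type*} [NormedAddCommGroup E] (J : Set ℝ) (p : ℕ)
    (φ : ℝ → State m n l → E) : Prop :=
  ∃ M δ : ℝ, 0 < δ ∧ ∀ t ∈ J, ∀ U : State m n l, ‖U‖ < δ → ‖φ t U‖ ≤ M * gauge p U

/-! ### The given system -/

/-- The nonlinear functions on the right-hand side of a system in rational form, at one instant:
vector functions `f, g, h` (numerators) and scalar functions `fs, gs, hs` (denominators). -/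
structure Nonlin (m n l : ℕ) where
  f : State m n l → (Fin m → ℝ)
  g : State m n l → (Fin n → ℝ)
  h : State m n l → (Fin l → ℝ)
  fs : State m n l → ℝ
  gs : State m n l → ℝ
  hs : State m n l → ℝ

/-- All the nonlinear functions collected into one vector-valued function. -/
def Nonlin.all {m n l : ℕ} (N : Nonlin m n l) (u : State m n l) : State m n l × (ℝ × ℝ × ℝ) :=
  ((N.f u, N.g u, N.h u), (N.fs u, N.gs u, N.hs u))

/-- The right-hand side of the system in rational form
`x' = (A x + f) / (1 + fs)`, `y' = (B y + g) / (1 + gs)`, `z' = (C z + h) / (1 + hs)`. -/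
def ratRHS {m n l : ℕ} (A : Matrix (Fin m) (Fin m) ℝ) (B : Matrix (Fin n) (Fin n) ℝ)
    (C : Matrix (Fin l) (Fin l) ℝ) (N : ℝ → Nonlin m n l) (t : ℝ) (u : State m n l) :
    State m n l :=
  ((1 + (N t).fs u)⁻¹ • (A.mulVec u.1 + (N t).f u),
   (1 + (N t).gs u)⁻¹ • (B.mulVec u.2.1 + (N t).g u),
   (1 + (N t).hs u)⁻¹ • (C.mulVec u.2.2 + (N t).h u))

/-- The standing assumptions on the system: bounds on the real parts of the (complex) eigenvalues,
the spectral gap, smoothness of order `P` in the state, with derivatives depending continuously on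
time, and the orders of vanishing at the origin. -/
structure GivenSystem {m n l : ℕ} (A : Matrix (Fin m) (Fin m) ℝ) (B : Matrix (Fin n) (Fin n) ℝ)
    (C : Matrix (Fin l) (Fin l) ℝ) (N : ℝ → Nonlin m n l) (T : Set ℝ) (d : Set (State m n l))
    (α β : ℝ) (P : ℕ) : Prop where
  alpha_nonneg : 0 ≤ α
  beta_pos : 0 < β
  center : ∀ a ∈ spectrum ℂ (A.map (algebraMap ℝ ℂ)), |a.re| ≤ α
  stable : ∀ b ∈ spectrum ℂ (B.map (algebraMap ℝ ℂ)), b.re ≤ -β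
  unstable : ∀ c ∈ spectrum ℂ (C.map (algebraMap ℝ ℂ)), β ≤ c.re
  two_le : 2 ≤ P
  gap : (2 * (P : ℝ) - 1) * α < β
  isOpen : IsOpen d
  zero_mem : (0 : State m n l) ∈ d
  contDiff : ∀ t ∈ T, ContDiffOn ℝ P (N t).all d
  continuous : ∀ k ≤ P, ContinuousOn
    (fun q : ℝ × State m n l => iteratedFDeriv ℝ k (N q.1).all q.2) (T ×ˢ d)
  f_order : ∀ t ∈ T, (N t).f =O[𝓝 0] (gauge 2 : State m n l → ℝ)
  g_order : ∀ t ∈ T, (N t).g =O[𝓝 0] (gauge 2 : State m n l → ℝ)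
  h_order : ∀ t ∈ T, (N t).h =O[𝓝 0] (gauge 2 : State m n l → ℝ)
  fs_order : ∀ t ∈ T, (N t).fs =O[𝓝 0] (gauge 1 : State m n l → ℝ)
  gs_order : ∀ t ∈ T, (N t).gs =O[𝓝 0] (gauge 1 : State m n l → ℝ)
  hs_order : ∀ t ∈ T, (N t).hs =O[𝓝 0] (gauge 1 : State m n l → ℝ)

/-- Near the origin, the state derivatives up to order `P` of the nonlinear functions are bounded
uniformly over the times in `T`. -/
def UniformlyBounded {m n l : ℕ} (N : ℝ → Nonlin m n l) (T : Set ℝ) (P : ℕ) : Prop :=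
  ∃ M r : ℝ, 0 < r ∧ ∀ t ∈ T, ∀ u : State m n l, ‖u‖ < r → ∀ k ≤ P,
    ‖iteratedFDeriv ℝ k (N t).all u‖ ≤ M

/-! ### Multinomials with time dependent coefficients -/

/-- Multinomials whose coefficients are functions of time. -/
abbrev TPoly (σ : Type) : Type := MvPolynomial σ (ℝ → ℝ)

/-- The value of a time dependent multinomial at time `t` and point `v`. -/
def TPoly.val {σ : Type} (Q : TPoly σ) (t : ℝ) (v : σ → ℝ) : ℝ :=
  MvPolynomial.eval₂ (Pi.evalRingHom (fun _ : ℝ => ℝ) t) v Q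

/-- A multinomial, time dependent, coordinate transformation
`x = x(t,X,Y,Z)`, `y = y(t,X,Y,Z)`, `z = z(t,X,Y,Z)`. -/
structure CoordTransform (m n l : ℕ) where
  x : Fin m → TPoly (Idx m n l)
  y : Fin n → TPoly (Idx m n l)
  z : Fin l → TPoly (Idx m n l)

namespace CoordTransform

variable {m n l : ℕ}

/-- The map `U ↦ u` of the coordinate transformation at time `t`. -/
def map (ξ : CoordTransform m n l) (t : ℝ) (U : State m n l) : State m n l :=
  (fun i => (ξ.x i).val t (coord U), fun i => (ξ.y i).val t (coord U),
   fun i => (ξ.z i).val t (coord U))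

/-- Every coefficient function of the transformation has the property `R`. -/
def CoeffsSatisfy (ξ : CoordTransform m n l) (R : (ℝ → ℝ) → Prop) : Prop :=
  (∀ i s, R ((ξ.x i).coeff s)) ∧ (∀ i s, R ((ξ.y i).coeff s)) ∧ (∀ i s, R ((ξ.z i).coeff s))

end CoordTransform

/-- The data of a multinomial normal form system: `Fc(t,X)`, the rank three tensor
`FT(t,X,Y,Z)`, and the matrices `G(t,X,Y,Z)` and `H(t,X,Y,Z)`. -/
structure NormalForm (m n l : ℕ) where
  Fc : Fin m → TPoly (Fin m)
  FT : Fin m → Fin n → Fin l → TPoly (Idx m n l)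
  G : Fin n → Fin n → TPoly (Idx m n l)
  H : Fin l → Fin l → TPoly (Idx m n l)

namespace NormalForm

variable {m n l : ℕ}

/-- `F(t,U) = Fc(t,X) + FT(t,U) Y Z`. -/
def F (S : NormalForm m n l) (t : ℝ) (U : State m n l) : Fin m → ℝ := fun i =>
  (S.Fc i).val t U.1 + ∑ j, ∑ k, (S.FT i j k).val t (coord U) * U.2.1 j * U.2.2 k

/-- The matrix `G(t,U)`. -/
def matG (S : NormalForm m n l) (t : ℝ) (U : State m n l) : Matrix (Fin n) (Fin n) ℝ :=
  Matrix.of fun i j => (S.G i j).val t (coord U)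

/-- The matrix `H(t,U)`. -/
def matH (S : NormalForm m n l) (t : ℝ) (U : State m n l) : Matrix (Fin l) (Fin l) ℝ :=
  Matrix.of fun i j => (S.H i j).val t (coord U)

/-- The right-hand side of the normal form system
`X' = A X + F(t,U)`, `Y' = [B + G(t,U)] Y`, `Z' = [C + H(t,U)] Z`. -/
def rhs (S : NormalForm m n l) (A : Matrix (Fin m) (Fin m) ℝ) (B : Matrix (Fin n) (Fin n) ℝ)
    (C : Matrix (Fin l) (Fin l) ℝ) (t : ℝ) (U : State m n l) : State m n l :=
  (A.mulVec U.1 + S.F t U, (B + S.matG t U).mulVec U.2.1, (C + S.matH t U).mulVec U.2.2)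

/-- Every coefficient function of the normal form has the property `R`. -/
def CoeffsSatisfy (S : NormalForm m n l) (R : (ℝ → ℝ) → Prop) : Prop :=
  (∀ i s, R ((S.Fc i).coeff s)) ∧ (∀ i j k s, R ((S.FT i j k).coeff s)) ∧
    (∀ i j s, R ((S.G i j).coeff s)) ∧ (∀ i j s, R ((S.H i j).coeff s))

end NormalForm

/-- The difference, at time `t` and at the point with coordinates `U`, between the vector field
that the transformation and the normal form system induce on the original variables, namely
`∂u/∂t + (∂u/∂U) U'`, and the vector field of the given system in rational form. -/
def difference {m n l : ℕ} (A : Matrix (Fin m) (Fin m) ℝ) (B : Matrix (Fin n) (Fin n) ℝ)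
    (C : Matrix (Fin l) (Fin l) ℝ) (N : ℝ → Nonlin m n l) (T : Set ℝ)
    (ξ : CoordTransform m n l) (S : NormalForm m n l) (t : ℝ) (U : State m n l) : State m n l :=
  derivWithin (fun s => ξ.map s U) T t + fderiv ℝ (ξ.map t) U (S.rhs A B C t U)
    - ratRHS A B C N t (ξ.map t U)

/-- The order claims, uniformly for times in `J`: the transformation is near identity,
`F`, `G Y` and `H Z` are strictly nonlinear, and the difference between the systems is of order `p`. -/
def OrderClaims {m n l : ℕ} (A : Matrix (Fin m) (Fin m) ℝ) (B : Matrix (Fin n) (Fin n) ℝ)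
    (C : Matrix (Fin l) (Fin l) ℝ) (N : ℝ → Nonlin m n l) (T : Set ℝ) (p : ℕ)
    (ξ : CoordTransform m n l) (S : NormalForm m n l) (J : Set ℝ) : Prop :=
  IsOrc J 2 (fun t U => ξ.map t U - U) ∧
  IsOrc J 2 S.F ∧
  IsOrc J 2 (fun t U => (S.matG t U).mulVec U.2.1) ∧
  IsOrc J 2 (fun t U => (S.matH t U).mulVec U.2.2) ∧
  IsOrc J p (difference A B C N T ξ S)

/-! ### Memory and anticipation integrals -/

/-- The convolution with rate `μ` over the time interval `T`: over the past (memory) when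
`Re μ < 0`, over the future (anticipation) otherwise. -/
def conv (T : Set ℝ) (μ : ℂ) (a : ℝ → ℂ) (t : ℝ) : ℂ :=
  if μ.re < 0 then ∫ τ in T ∩ Iic t, Complex.exp (μ * ((t : ℂ) - (τ : ℂ))) * a τ
  else ∫ τ in T ∩ Ici t, Complex.exp (μ * ((t : ℂ) - (τ : ℂ))) * a τ

/-- The non-autonomous terms: the time dependent Taylor coefficients at the origin, of order
less than `p`, of the difference between the nonlinear functions and an autonomous part `N₀`. -/
def nonautTerms {m n l : ℕ} (N : ℝ → Nonlin m n l) (N₀ : Nonlin m n l) (p : ℕ) : Set (ℝ → ℝ) :=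
  {a | ∃ k < p, ∃ v : Fin k → State m n l, ∃ L : (State m n l × (ℝ × ℝ × ℝ)) →L[ℝ] ℝ,
    a = fun t => L (iteratedFDeriv ℝ k (fun u => (N t).all u - N₀.all u) 0 v)}

/-- `Memory T ν 𝒮 k a`: the function `a` is built by sums, products and fast convolutions
(rates with `|Re μ| > ν`) from constants and the functions in `𝒮`, each of its terms containing at
least `k` factors from `𝒮`. Convolutions are applied only to terms with at least one factor. -/
inductive Memory (T : Set ℝ) (ν : ℝ) (𝒮 : Set (ℝ → ℝ)) : ℕ → (ℝ → ℂ) → Prop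
  | const (c : ℂ) : Memory T ν 𝒮 0 (fun _ => c)
  | term {a : ℝ → ℝ} (ha : a ∈ 𝒮) : Memory T ν 𝒮 1 (fun t => (a t : ℂ))
  | sum {k : ℕ} {a b : ℝ → ℂ} (ha : Memory T ν 𝒮 k a) (hb : Memory T ν 𝒮 k b) :
      Memory T ν 𝒮 k (fun t => a t + b t)
  | prod {j k : ℕ} {a b : ℝ → ℂ} (ha : Memory T ν 𝒮 j a) (hb : Memory T ν 𝒮 k b) :
      Memory T ν 𝒮 (j + k) (fun t => a t * b t)
  | integral {k : ℕ} {a : ℝ → ℂ} {μ : ℂ} (hμ : ν < |μ.re|) (ha : Memory T ν 𝒮 (k + 1) a) :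
      Memory T ν 𝒮 (k + 1) (conv T μ a)
  | weaken {k : ℕ} {a : ℝ → ℂ} (ha : Memory T ν 𝒮 (k + 1) a) : Memory T ν 𝒮 k a

/-- On `T`, the coefficient `c` is the sum of a memoryless part, a real linear combination of the
constant `1` and of functions in `𝒮`, and of a part that is quadratic, or of higher power, in `𝒮`;
only the latter may contain memory or anticipation integrals. -/
def NoLinearMemory (T : Set ℝ) (ν : ℝ) (𝒮 : Set (ℝ → ℝ)) (c : ℝ → ℝ) : Prop :=
  ∃ a ∈ Submodule.span ℝ (insert (fun _ => (1 : ℝ)) 𝒮), ∃ q : ℝ → ℂ,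
    Memory T ν 𝒮 2 q ∧ ∀ t ∈ T, (c t : ℂ) = (a t : ℂ) + q t

end RatNF

end

noncomputable section

namespace RatNF
open MeasureTheory

/-! ### Convolutions over an interval -/

theorem hasDerivWithinAt_intervalIntegral {T : Set ℝ} (hT : T.OrdConnected) {g : ℝ → ℂ}
    (hg : ContinuousOn g T) {t₀ t : ℝ} (h₀ : t₀ ∈ T) (ht : t ∈ T) :
    HasDerivWithinAt (fun s => ∫ τ in t₀..s, g τ) (g t) T t := by
  have hint : ∀ a ∈ T, ∀ b ∈ T, IntervalIntegrable g volume a b := fun a ha b hb =>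
    (hg.mono (hT.uIcc_subset ha hb)).intervalIntegrable
  rw [hasDerivWithinAt_iff_isLittleO, Asymptotics.isLittleO_iff]
  intro ε hε
  have hc := Metric.continuousWithinAt_iff.1 (hg t ht) ε hε
  obtain ⟨δ, hδ, hc⟩ := hc
  filter_upwards [self_mem_nhdsWithin, mem_nhdsWithin_of_mem_nhds (Metric.ball_mem_nhds t hδ)]
    with s hs hsδ
  have h1 : (∫ τ in t₀..s, g τ) - (∫ τ in t₀..t, g τ) - (s - t) • g t
      = ∫ τ in t..s, (g τ - g t) := by
    rw [intervalIntegral.integral_sub (hint t ht s hs) (by simp),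
      intervalIntegral.integral_interval_sub_left (hint _ h₀ _ hs) (hint _ h₀ _ ht),
      intervalIntegral.integral_const]
  rw [h1, Real.norm_eq_abs]
  refine intervalIntegral.norm_integral_le_of_norm_le_const fun x hx => ?_
  have hx' : x ∈ uIcc t s := uIoc_subset_uIcc hx
  rw [← dist_eq_norm]
  refine (hc (hT.uIcc_subset ht hs hx') ?_).le
  have h2 : |x - t| ≤ |s - t| := abs_sub_left_of_mem_uIcc hx'
  rw [Real.dist_eq]
  exact h2.trans_lt (by simpa [Real.dist_eq] using hsδ)

/-- Continuity and boundedness on a set of times. -/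
def BddContOn (T : Set ℝ) (a : ℝ → ℂ) : Prop :=
  ContinuousOn a T ∧ ∃ M, ∀ t ∈ T, ‖a t‖ ≤ M

section conv

variable {T : Set ℝ} {a : ℝ → ℂ} {μ : ℂ}

theorem aestronglyMeasurable_indicator_exp_mul (hT : T.OrdConnected) (ha : ContinuousOn a T) :
    AEStronglyMeasurable (T.indicator fun τ => Complex.exp (-μ * τ) * a τ) volume := by
  rw [aestronglyMeasurable_indicator_iff hT.measurableSet]
  refine ContinuousOn.aestronglyMeasurable (ContinuousOn.mul ?_ ha) hT.measurableSet
  fun_prop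

theorem norm_indicator_exp_mul_le {M : ℝ} (hM : ∀ t ∈ T, ‖a t‖ ≤ M) (hM0 : 0 ≤ M) (τ : ℝ) :
    ‖T.indicator (fun τ : ℝ => Complex.exp (-μ * τ) * a τ) τ‖ ≤ M * Real.exp (-μ.re * τ) := by
  by_cases hτ : τ ∈ T
  · rw [indicator_of_mem hτ, norm_mul, Complex.norm_exp, mul_comm]
    have : (-μ * (τ : ℂ)).re = -μ.re * τ := by simp
    rw [this]
    gcongr
    exact hM τ hτ
  · rw [indicator_of_notMem hτ, norm_zero]
    positivity

/-- Once the factor depending on `t` is taken out and the rest is extended by zero outside `T`, `t`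
enters the integral only through the domain `s`. The fundamental theorem of calculus and
integrability on half lines then apply to one fixed integrand. -/
theorem setIntegral_exp_mul_eq (hT : T.OrdConnected) (s : Set ℝ) (t : ℝ) :
    ∫ τ in T ∩ s, Complex.exp (μ * ((t : ℂ) - (τ : ℂ))) * a τ
      = Complex.exp (μ * t) *
        ∫ τ in s, T.indicator (fun τ : ℝ => Complex.exp (-μ * τ) * a τ) τ := by
  rw [setIntegral_indicator hT.measurableSet, inter_comm, ← integral_const_mul]
  refine integral_congr_ae (Eventually.of_forall fun τ => ?_)
  simp only
  rw [← mul_assoc, ← Complex.exp_add]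
  congr 2
  ring

/-- The growth of the prefactor cancels the value of the exponential integral, which leaves a bound
independent of `t`. The hypothesis `hv` holds for both half lines, so one estimate serves memory and
anticipation. -/
theorem norm_exp_mul_setIntegral_le {s : Set ℝ} {t M : ℝ}
    (hM : ∀ t ∈ T, ‖a t‖ ≤ M) (hM0 : 0 ≤ M)
    (hi : IntegrableOn (fun τ => Real.exp (-μ.re * τ)) s)
    (hv : ∫ τ in s, Real.exp (-μ.re * τ) = Real.exp (-μ.re * t) / |μ.re|) :
    ‖Complex.exp (μ * t) *
        ∫ τ in s, T.indicator (fun τ : ℝ => Complex.exp (-μ * τ) * a τ) τ‖ ≤ M / |μ.re| := by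
  have h1 := norm_integral_le_of_norm_le (hi.const_mul M)
    (Eventually.of_forall fun τ => norm_indicator_exp_mul_le (μ := μ) hM hM0 τ)
  rw [integral_const_mul, hv] at h1
  rw [norm_mul, Complex.norm_exp]
  have h2 : (μ * (t : ℂ)).re = μ.re * t := by simp
  rw [h2]
  calc _ ≤ Real.exp (μ.re * t) * (M * (Real.exp (-μ.re * t) / |μ.re|)) := by gcongr
    _ = (Real.exp (μ.re * t) * Real.exp (-μ.re * t)) * (M / |μ.re|) := by ring
    _ = _ := by rw [← Real.exp_add]; simp

/-- Variation of constants. Only the increments of `I` matter: `c = 1` covers memory integrals and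
initial value problems, `c = -1` anticipation integrals, whose domain shrinks as time grows. -/
theorem hasDerivWithinAt_exp_mul_integral (hT : T.OrdConnected) (ha : ContinuousOn a T)
    {I : ℝ → ℂ} {c : ℂ} {t : ℝ} (ht : t ∈ T)
    (hI : ∀ s ∈ T, I s = I t + c * ∫ τ in t..s,
      T.indicator (fun τ : ℝ => Complex.exp (-μ * τ) * a τ) τ) :
    HasDerivWithinAt (fun s : ℝ => Complex.exp (μ * s) * I s)
      (μ * (Complex.exp (μ * t) * I t) + c * a t) T t := by
  have h1 : HasDerivWithinAt I (c * (Complex.exp (-μ * t) * a t)) T t := by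
    have h2 : ContinuousOn (fun τ : ℝ => Complex.exp (-μ * τ) * a τ) T :=
      ContinuousOn.mul (by fun_prop) ha
    have h3 := ((hasDerivWithinAt_intervalIntegral hT h2 ht ht).const_mul c).const_add (I t)
    refine h3.congr (fun s hs => ?_) (by simp)
    rw [hI s hs]
    congr 2
    refine intervalIntegral.integral_congr fun τ hτ => ?_
    simp [indicator_of_mem (hT.uIcc_subset ht hs hτ)]
  have h2 : HasDerivWithinAt (fun s : ℝ => Complex.exp (μ * s)) (Complex.exp (μ * t) * μ) T t := by
    have h4 : HasDerivAt (fun s : ℝ => μ * (s : ℂ)) μ t := by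
      simpa using (Complex.ofRealCLM.hasDerivAt (x := t)).const_mul μ
    exact h4.cexp.hasDerivWithinAt
  refine (h2.mul h1).congr_deriv ?_
  have h5 : Complex.exp (μ * t) * Complex.exp (-μ * t) = 1 := by rw [← Complex.exp_add]; simp
  linear_combination c * a t * h5

theorem integrableOn_indicator_exp_mul (hT : T.OrdConnected) (ha : BddContOn T a) {s : Set ℝ}
    (hi : IntegrableOn (fun τ => Real.exp (-μ.re * τ)) s) :
    IntegrableOn (T.indicator fun τ : ℝ => Complex.exp (-μ * τ) * a τ) s := by
  obtain ⟨hc, M, hM⟩ := ha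
  refine (hi.const_mul (max M 0)).mono'
    (aestronglyMeasurable_indicator_exp_mul hT hc).restrict (Eventually.of_forall fun τ => ?_)
  exact norm_indicator_exp_mul_le (fun t ht => (hM t ht).trans (le_max_left _ _))
    (le_max_right _ _) τ

theorem integrableOn_exp_Iic (h : μ.re < 0) (t : ℝ) :
    IntegrableOn (fun τ => Real.exp (-μ.re * τ)) (Iic t) :=
  integrableOn_exp_mul_Iic (by linarith) t

theorem integrableOn_exp_Ici (h : 0 < μ.re) (t : ℝ) :
    IntegrableOn (fun τ => Real.exp (-μ.re * τ)) (Ici t) := by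
  rw [integrableOn_Ici_iff_integrableOn_Ioi]
  exact integrableOn_exp_mul_Ioi (by linarith) t

theorem hasDerivWithinAt_conv_of_neg (hT : T.OrdConnected) (ha : BddContOn T a) (h : μ.re < 0)
    {t : ℝ} (ht : t ∈ T) : HasDerivWithinAt (conv T μ a) (μ * conv T μ a t + a t) T t := by
  have he : conv T μ a = fun s : ℝ => Complex.exp (μ * s) *
      ∫ τ in Iic s, T.indicator (fun τ : ℝ => Complex.exp (-μ * τ) * a τ) τ := by
    funext s
    rw [conv, if_pos h, setIntegral_exp_mul_eq hT]
  have h1 := hasDerivWithinAt_exp_mul_integral (μ := μ) hT ha.1 (c := 1) (I := fun s =>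
    ∫ τ in Iic s, T.indicator (fun τ : ℝ => Complex.exp (-μ * τ) * a τ) τ) ht (fun s _ => by
      rw [← intervalIntegral.integral_Iic_sub_Iic
        (integrableOn_indicator_exp_mul hT ha (integrableOn_exp_Iic h _))
        (integrableOn_indicator_exp_mul hT ha (integrableOn_exp_Iic h _))]
      ring)
  rw [he]
  simpa using h1

theorem hasDerivWithinAt_conv_of_pos (hT : T.OrdConnected) (ha : BddContOn T a) (h : 0 < μ.re)
    {t : ℝ} (ht : t ∈ T) : HasDerivWithinAt (conv T μ a) (μ * conv T μ a t - a t) T t := by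
  have he : conv T μ a = fun s : ℝ => Complex.exp (μ * s) *
      ∫ τ in Ici s, T.indicator (fun τ : ℝ => Complex.exp (-μ * τ) * a τ) τ := by
    funext s
    rw [conv, if_neg h.le.not_gt, setIntegral_exp_mul_eq hT]
  have hi : ∀ s, IntegrableOn (T.indicator fun τ : ℝ => Complex.exp (-μ * τ) * a τ) (Ioi s) :=
    fun s => (integrableOn_indicator_exp_mul hT ha (integrableOn_exp_Ici h s)).mono_set
      Ioi_subset_Ici_self
  have hsub : ∀ s u : ℝ, (∫ τ in Ioi s, T.indicator (fun τ : ℝ => Complex.exp (-μ * τ) * a τ) τ)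
      - (∫ τ in Ioi u, T.indicator (fun τ : ℝ => Complex.exp (-μ * τ) * a τ) τ)
      = ∫ τ in s..u, T.indicator (fun τ : ℝ => Complex.exp (-μ * τ) * a τ) τ := by
    intro s u
    rcases le_total s u with hsu | hsu
    · exact intervalIntegral.integral_Ioi_sub_Ioi (hi s) hsu
    · rw [intervalIntegral.integral_symm, ← intervalIntegral.integral_Ioi_sub_Ioi (hi u) hsu]
      ring
  have h1 := hasDerivWithinAt_exp_mul_integral (μ := μ) hT ha.1 (c := -1) (I := fun s =>
    ∫ τ in Ici s, T.indicator (fun τ : ℝ => Complex.exp (-μ * τ) * a τ) τ) ht (fun s _ => by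
      simp only [integral_Ici_eq_integral_Ioi]
      rw [← hsub]
      ring)
  rw [he]
  simpa [sub_eq_add_neg] using h1

/-- The sign of the source term in the differential equation of a convolution. -/
def convSign (μ : ℂ) : ℂ := if μ.re < 0 then 1 else -1

theorem convSign_ne_zero (μ : ℂ) : convSign μ ≠ 0 := by
  unfold convSign; split_ifs <;> simp

theorem hasDerivWithinAt_conv (hT : T.OrdConnected) (ha : BddContOn T a) (h : μ.re ≠ 0)
    {t : ℝ} (ht : t ∈ T) :
    HasDerivWithinAt (conv T μ a) (μ * conv T μ a t + convSign μ * a t) T t := by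
  rcases lt_or_gt_of_ne h with h | h
  · simpa [convSign, h] using hasDerivWithinAt_conv_of_neg hT ha h ht
  · simpa [convSign, h.le.not_gt, sub_eq_add_neg] using hasDerivWithinAt_conv_of_pos hT ha h ht

theorem BddContOn.conv (hT : T.OrdConnected) (ha : BddContOn T a) (h : μ.re ≠ 0) :
    BddContOn T (conv T μ a) := by
  refine ⟨fun t ht => (hasDerivWithinAt_conv hT ha h ht).continuousWithinAt, ?_⟩
  obtain ⟨-, M, hM⟩ := ha
  refine ⟨max M 0 / |μ.re|, fun t _ => ?_⟩
  have hM' : ∀ t ∈ T, ‖a t‖ ≤ max M 0 := fun t ht => (hM t ht).trans (le_max_left _ _)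
  rcases lt_or_gt_of_ne h with h | h
  · rw [RatNF.conv, if_pos h, setIntegral_exp_mul_eq hT]
    refine norm_exp_mul_setIntegral_le hM' (le_max_right _ _) (integrableOn_exp_Iic h t) ?_
    rw [integral_exp_mul_Iic (by linarith), abs_of_neg h]
  · rw [RatNF.conv, if_neg h.le.not_gt, setIntegral_exp_mul_eq hT]
    refine norm_exp_mul_setIntegral_le hM' (le_max_right _ _) (integrableOn_exp_Ici h t) ?_
    rw [integral_Ici_eq_integral_Ioi, integral_exp_mul_Ioi (by linarith), abs_of_pos h,
      neg_div_neg_eq]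

/-- Conjugation keeps the real part of the rate, hence the choice between past and future. It makes
the coefficient classes closed under conjugation, so that real solutions can be extracted. -/
theorem conj_conv (t : ℝ) :
    (starRingEnd ℂ) (conv T μ a t)
      = conv T ((starRingEnd ℂ) μ) (fun τ => (starRingEnd ℂ) (a τ)) t := by
  simp only [conv, Complex.conj_re]
  split_ifs <;> rw [← integral_conj] <;> simp [← Complex.exp_conj]

end conv

namespace BddContOn

variable {T : Set ℝ} {a b : ℝ → ℂ}

theorem const (c : ℂ) : BddContOn T fun _ => c := ⟨continuousOn_const, ‖c‖, fun _ _ => le_rfl⟩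

theorem add (ha : BddContOn T a) (hb : BddContOn T b) : BddContOn T fun t => a t + b t := by
  obtain ⟨hac, M, hM⟩ := ha
  obtain ⟨hbc, M', hM'⟩ := hb
  exact ⟨hac.add hbc, M + M', fun t ht =>
    (norm_add_le _ _).trans (add_le_add (hM t ht) (hM' t ht))⟩

theorem mul (ha : BddContOn T a) (hb : BddContOn T b) : BddContOn T fun t => a t * b t := by
  obtain ⟨hac, M, hM⟩ := ha
  obtain ⟨hbc, M', hM'⟩ := hb
  refine ⟨hac.mul hbc, M * M', fun t ht => (norm_mul_le _ _).trans ?_⟩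
  exact mul_le_mul (hM t ht) (hM' t ht) (norm_nonneg _) ((norm_nonneg _).trans (hM t ht))

end BddContOn

/-- Every convolution in `Memory` has a rate with nonzero real part because `0 ≤ ν`, so convergence
and boundedness propagate through the construction. -/
theorem Memory.bddContOn {T : Set ℝ} (hT : T.OrdConnected) {ν : ℝ} (hν : 0 ≤ ν)
    {𝒮 : Set (ℝ → ℝ)} (h𝒮 : ∀ a ∈ 𝒮, BddContOn T fun t => (a t : ℂ)) {k : ℕ} {a : ℝ → ℂ}
    (ha : Memory T ν 𝒮 k a) : BddContOn T a := by
  induction ha with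
  | const c => exact .const c
  | term ha => exact h𝒮 _ ha
  | sum _ _ iha ihb => exact iha.add ihb
  | prod _ _ iha ihb => exact iha.mul ihb
  | integral hμ _ ih =>
    refine ih.conv hT fun h0 => ?_
    rw [h0, abs_zero] at hμ
    exact absurd hμ hν.not_gt
  | weaken _ ih => exact ih

end RatNF
end

noncomputable section

namespace RatNF
open MeasureTheory

/-! ### Classes of coefficient functions -/

/-- A class `L` of complex functions of time, closed under the algebraic operations, and a
subspace `K`, such that scalar linear differential equations with source in `L` are solvable in `L`
up to a correction in `K`, and without correction if the rate is faster than `ν`. -/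
structure CoeffClass (T : Set ℝ) (ν : ℝ) where
  L : Subalgebra ℂ (ℝ → ℂ)
  K : Submodule ℂ (ℝ → ℂ)
  le : ∀ f ∈ K, f ∈ L
  conj_mem_L : ∀ f ∈ L, (fun t => (starRingEnd ℂ) (f t)) ∈ L
  conj_mem_K : ∀ f ∈ K, (fun t => (starRingEnd ℂ) (f t)) ∈ K
  continuousOn : ∀ f ∈ L, ContinuousOn f T
  solve : ∀ μ : ℂ, ∀ R ∈ L, ∃ ξ ∈ L, ∃ s ∈ K,
    (∀ t ∈ T, HasDerivWithinAt ξ (μ * ξ t + R t - s t) T t) ∧ (ν < |μ.re| → s = 0)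

/-- All functions that are continuous on `T`: linear equations are solved as initial value
problems, and no correction is needed. -/
def CoeffClass.ofContinuous {T : Set ℝ} (ν : ℝ) (hT : T.OrdConnected) (hT' : T.Nonempty) :
    CoeffClass T ν where
  L :=
    { carrier := {f | ContinuousOn f T}
      mul_mem' := fun ha hb => ha.mul hb
      add_mem' := fun ha hb => ha.add hb
      algebraMap_mem' := fun _ => continuousOn_const }
  K := ⊥
  le := by
    rintro f hf
    rw [(Submodule.mem_bot ℂ).1 hf]
    exact continuousOn_const
  conj_mem_L := fun _ hf => Complex.continuous_conj.comp_continuousOn hf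
  conj_mem_K := by
    rintro f hf
    rw [(Submodule.mem_bot ℂ).1 hf]
    simp only [Pi.zero_apply, map_zero]
    exact Submodule.zero_mem _
  continuousOn := fun _ hf => hf
  solve := by
    intro μ R hR
    obtain ⟨t₀, h₀⟩ := hT'
    have hR : ContinuousOn R T := hR
    have hd : ∀ t ∈ T, HasDerivWithinAt (fun s : ℝ => Complex.exp (μ * s) *
        ∫ τ in t₀..s, T.indicator (fun τ : ℝ => Complex.exp (-μ * τ) * R τ) τ)
        (μ * (Complex.exp (μ * t) * ∫ τ in t₀..t,
          T.indicator (fun τ : ℝ => Complex.exp (-μ * τ) * R τ) τ) + R t - (0 : ℝ → ℂ) t) T t := by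
      intro t ht
      have hg : ∀ s ∈ T, ∀ u ∈ T, IntervalIntegrable
          (T.indicator (fun τ : ℝ => Complex.exp (-μ * τ) * R τ)) volume s u := by
        intro s hs u hu
        have h1 : ContinuousOn (fun τ : ℝ => Complex.exp (-μ * τ) * R τ) T :=
          ContinuousOn.mul (by fun_prop) hR
        refine ContinuousOn.intervalIntegrable ((h1.mono (hT.uIcc_subset hs hu)).congr ?_)
        exact fun x hx => indicator_of_mem (hT.uIcc_subset hs hu hx) _
      have := hasDerivWithinAt_exp_mul_integral (μ := μ) hT hR (c := 1) (I := fun s =>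
        ∫ τ in t₀..s, T.indicator (fun τ : ℝ => Complex.exp (-μ * τ) * R τ) τ) ht (fun s hs => by
          rw [one_mul, intervalIntegral.integral_add_adjacent_intervals (hg _ h₀ _ ht)
            (hg _ ht _ hs)])
      simpa using this
    exact ⟨_, fun t ht => (hd t ht).continuousWithinAt, 0, Submodule.zero_mem _, hd, fun _ => rfl⟩

/-- `FastLinear T ν 𝒮 a`: the function `a` is linear in the functions in `𝒮` and their iterated
fast convolutions. -/
inductive FastLinear (T : Set ℝ) (ν : ℝ) (𝒮 : Set (ℝ → ℝ)) : (ℝ → ℂ) → Prop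
  | term {a : ℝ → ℝ} (ha : a ∈ 𝒮) : FastLinear T ν 𝒮 (fun t => (a t : ℂ))
  | add {a b : ℝ → ℂ} (ha : FastLinear T ν 𝒮 a) (hb : FastLinear T ν 𝒮 b) :
      FastLinear T ν 𝒮 (a + b)
  | smul (c : ℂ) {a : ℝ → ℂ} (ha : FastLinear T ν 𝒮 a) : FastLinear T ν 𝒮 (c • a)
  | integral {a : ℝ → ℂ} {μ : ℂ} (hμ : ν < |μ.re|) (ha : FastLinear T ν 𝒮 a) :
      FastLinear T ν 𝒮 (conv T μ a)

/-! ### Functions built from fast convolutions, and the elimination of linear memory -/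

section memory

variable {T : Set ℝ} {ν : ℝ} {𝒮 : Set (ℝ → ℝ)}

theorem Memory.smul (c : ℂ) {k : ℕ} {a : ℝ → ℂ} (ha : Memory T ν 𝒮 k a) :
    Memory T ν 𝒮 k (c • a) := by
  have := (Memory.const (T := T) (ν := ν) (𝒮 := 𝒮) c).prod ha
  rwa [zero_add] at this

theorem Memory.toZero {k : ℕ} {a : ℝ → ℂ} (ha : Memory T ν 𝒮 k a) : Memory T ν 𝒮 0 a := by
  induction k with
  | zero => exact ha
  | succ k ih => exact ih ha.weaken

theorem Memory.conj {k : ℕ} {a : ℝ → ℂ} (ha : Memory T ν 𝒮 k a) :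
    Memory T ν 𝒮 k (fun t => (starRingEnd ℂ) (a t)) := by
  induction ha with
  | const c => exact .const _
  | term ha => simpa only [Complex.conj_ofReal] using Memory.term ha
  | sum _ _ iha ihb => simpa only [map_add] using iha.sum ihb
  | prod _ _ iha ihb => simpa only [map_mul] using iha.prod ihb
  | integral hμ _ ih =>
    simp only [conj_conv]
    exact .integral (by simpa using hμ) ih
  | weaken _ ih => exact ih.weaken

theorem FastLinear.memory {a : ℝ → ℂ} (ha : FastLinear T ν 𝒮 a) : Memory T ν 𝒮 1 a := by
  induction ha with
  | term ha => exact .term ha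
  | add _ _ iha ihb => exact iha.sum ihb
  | smul c _ ih => exact ih.smul c
  | integral hμ _ ih => exact ih.integral hμ

theorem FastLinear.conj {a : ℝ → ℂ} (ha : FastLinear T ν 𝒮 a) :
    FastLinear T ν 𝒮 (fun t => (starRingEnd ℂ) (a t)) := by
  induction ha with
  | term ha => simpa only [Complex.conj_ofReal] using FastLinear.term ha
  | add _ _ iha ihb =>
    simp only [Pi.add_apply, map_add]
    exact iha.add ihb
  | smul c _ ih =>
    simp only [Pi.smul_apply, smul_eq_mul, map_mul]
    exact ih.smul _
  | integral hμ _ ih =>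
    simp only [conj_conv]
    exact .integral (by simpa using hμ) ih

/-- The complex span of a set of real functions. -/
def complexSpan (𝒮 : Set (ℝ → ℝ)) : Submodule ℂ (ℝ → ℂ) :=
  Submodule.span ℂ ((fun a t => ((a t : ℝ) : ℂ)) '' 𝒮)

theorem complexSpan.conj {a : ℝ → ℂ} (ha : a ∈ complexSpan 𝒮) :
    (fun t => (starRingEnd ℂ) (a t)) ∈ complexSpan 𝒮 := by
  induction ha using Submodule.span_induction with
  | mem x hx =>
    obtain ⟨b, hb, rfl⟩ := hx
    simp only [Complex.conj_ofReal]
    exact Submodule.subset_span ⟨b, hb, rfl⟩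
  | zero =>
    simp only [Pi.zero_apply, map_zero]
    exact Submodule.zero_mem _
  | add x y _ _ hx hy =>
    simp only [Pi.add_apply, map_add]
    exact Submodule.add_mem _ hx hy
  | smul c x _ hx =>
    simp only [Pi.smul_apply, smul_eq_mul, map_mul]
    exact Submodule.smul_mem _ _ hx

/-- `FastLinear` has no constructor for the zero function; `h0` supplies it as a term. -/
theorem complexSpan.fastLinear (h0 : (fun _ => (0 : ℝ)) ∈ 𝒮) {a : ℝ → ℂ}
    (ha : a ∈ complexSpan 𝒮) : FastLinear T ν 𝒮 a := by
  induction ha using Submodule.span_induction with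
  | mem x hx =>
    obtain ⟨b, hb, rfl⟩ := hx
    exact .term hb
  | zero => simpa using! FastLinear.term (T := T) (ν := ν) h0
  | add x y _ _ hx hy => exact hx.add hy
  | smul c x _ hx => exact hx.smul c

/-- Real parts of complex linear combinations of real functions are real linear combinations. -/
theorem complexSpan.re_mem {a : ℝ → ℂ} (ha : a ∈ complexSpan 𝒮) :
    (fun t => (a t).re) ∈ Submodule.span ℝ 𝒮 := by
  suffices h : ∀ c : ℂ, (fun t => (c * a t).re) ∈ Submodule.span ℝ 𝒮 by simpa using h 1
  induction ha using Submodule.span_induction with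
  | mem x hx =>
    obtain ⟨b, hb, rfl⟩ := hx
    intro c
    have : (fun t => (c * (b t : ℂ)).re) = c.re • b := by funext t; simp
    rw [this]
    exact Submodule.smul_mem _ _ (Submodule.subset_span hb)
  | zero =>
    intro c
    simp only [Pi.zero_apply, mul_zero, Complex.zero_re]
    exact Submodule.zero_mem _
  | add x y _ _ hx hy =>
    intro c
    simp only [Pi.add_apply, mul_add, Complex.add_re]
    exact Submodule.add_mem _ (hx c) (hy c)
  | smul c x _ hx =>
    intro c'
    simp only [Pi.smul_apply, smul_eq_mul, ← mul_assoc]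
    exact hx _

/-- Linear memory integrals can be absorbed: a linear equation with a slow rate and with a source
that is linear in fast convolutions is solvable up to a memoryless correction. -/
theorem FastLinear.solve_of_slow (hT : T.OrdConnected) (hν : 0 ≤ ν)
    (h𝒮 : ∀ a ∈ 𝒮, BddContOn T fun t => (a t : ℂ)) (h0 : (fun _ => (0 : ℝ)) ∈ 𝒮) {μ : ℂ}
    (hμ : |μ.re| ≤ ν) {a : ℝ → ℂ} (ha : FastLinear T ν 𝒮 a) :
    ∃ ξ s, FastLinear T ν 𝒮 ξ ∧ s ∈ complexSpan 𝒮 ∧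
      ∀ t ∈ T, HasDerivWithinAt ξ (μ * ξ t + a t - s t) T t := by
  induction ha with
  | @term a ha =>
    refine ⟨_, _, .term h0, Submodule.subset_span ⟨a, ha, rfl⟩, fun t _ => ?_⟩
    simpa using hasDerivWithinAt_const t T (0 : ℂ)
  | @add a b _ _ iha ihb =>
    obtain ⟨ξ, s, h1, h2, h3⟩ := iha
    obtain ⟨ξ', s', h1', h2', h3'⟩ := ihb
    refine ⟨_, _, h1.add h1', Submodule.add_mem _ h2 h2', fun t ht => ?_⟩
    refine ((h3 t ht).add (h3' t ht)).congr_deriv ?_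
    simp only [Pi.add_apply]
    ring
  | @smul c a _ ih =>
    obtain ⟨ξ, s, h1, h2, h3⟩ := ih
    refine ⟨_, _, h1.smul c, Submodule.smul_mem _ c h2, fun t ht => ?_⟩
    refine ((h3 t ht).const_mul c).congr_deriv ?_
    simp only [Pi.smul_apply, smul_eq_mul]
    ring
  | @integral a l hl ha ih =>
    obtain ⟨ξ, s, h1, h2, h3⟩ := ih
    -- A fast rate and a slow rate cannot coincide; this is the only nonresonance that the
    -- elimination needs.
    have hne : l - μ ≠ 0 := by
      intro h
      rw [sub_eq_zero.1 h] at hl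
      exact absurd hl hμ.not_gt
    have hre : l.re ≠ 0 := by
      intro h
      rw [h, abs_zero] at hl
      exact absurd hl hν.not_gt
    -- The first summand reproduces the source `conv T l a` and leaves `(l - μ)⁻¹ * convSign l * a`.
    -- The second summand, a multiple of the solution for `a` from the induction hypothesis, cancels
    -- this up to a memoryless correction.
    refine ⟨_, _, ((ha.integral hl).smul (l - μ)⁻¹).add (h1.smul (-(l - μ)⁻¹ * convSign l)),
      Submodule.smul_mem _ (-(l - μ)⁻¹ * convSign l) h2, fun t ht => ?_⟩
    refine (((hasDerivWithinAt_conv hT (ha.memory.bddContOn hT hν h𝒮) hre ht).const_mul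
      (l - μ)⁻¹).add ((h3 t ht).const_mul (-(l - μ)⁻¹ * convSign l))).congr_deriv ?_
    simp only [Pi.add_apply, Pi.smul_apply, smul_eq_mul]
    linear_combination conv T l a t * inv_mul_cancel₀ hne

/-- An anticipation integral satisfies its equation with source `-a`; division by `convSign μ`
normalizes the source to `a` in both cases. -/
theorem Memory.solve_of_fast (hT : T.OrdConnected) (hν : 0 ≤ ν)
    (h𝒮 : ∀ a ∈ 𝒮, BddContOn T fun t => (a t : ℂ)) {μ : ℂ} (hμ : ν < |μ.re|) {k : ℕ} {a : ℝ → ℂ}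
    (ha : Memory T ν 𝒮 k a) : ∀ t ∈ T, HasDerivWithinAt ((convSign μ)⁻¹ • conv T μ a)
      (μ * ((convSign μ)⁻¹ • conv T μ a) t + a t) T t := by
  intro t ht
  have hre : μ.re ≠ 0 := by
    intro h
    rw [h, abs_zero] at hμ
    exact absurd hμ hν.not_gt
  refine ((hasDerivWithinAt_conv hT (ha.bddContOn hT hν h𝒮) hre ht).const_mul
    (convSign μ)⁻¹).congr_deriv ?_
  simp only [Pi.smul_apply, smul_eq_mul]
  linear_combination a t * inv_mul_cancel₀ (convSign_ne_zero μ)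

theorem Memory.zero (h0 : (fun _ => (0 : ℝ)) ∈ 𝒮) : Memory T ν 𝒮 2 0 := by
  have := (Memory.term (T := T) (ν := ν) h0).prod (Memory.term h0)
  simpa using! this

/-- The functions that, on `T`, are sums of a constant, of a function that is linear in `𝒮` with
fast convolutions, and of a function that is at least quadratic in `𝒮`. -/
def memorySubalgebra (T : Set ℝ) (ν : ℝ) (𝒮 : Set (ℝ → ℝ)) (h0 : (fun _ => (0 : ℝ)) ∈ 𝒮) :
    Subalgebra ℂ (ℝ → ℂ) where
  carrier := {f | ∃ (c : ℂ) (e q : ℝ → ℂ), FastLinear T ν 𝒮 e ∧ Memory T ν 𝒮 2 q ∧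
    ∀ t ∈ T, f t = c + e t + q t}
  mul_mem' := by
    rintro f f' ⟨c, e, q, he, hq, hf⟩ ⟨c', e', q', he', hq', hf'⟩
    -- The product is regrouped as `c c' + (c e' + c' e) + (e e' + q (c' + e' + q') + (c + e) q')`;
    -- the last bracket has at least two factors from `𝒮` in each term.
    refine ⟨c * c', _, _, (he'.smul c).add (he.smul c'),
      ((he.memory.prod he'.memory).sum
        (hq.prod (((Memory.const c').sum he'.memory.toZero).sum hq'.toZero))).sum
        (((Memory.const c).sum he.memory.toZero).prod hq'), fun t ht => ?_⟩
    simp only [Pi.mul_apply, Pi.add_apply, Pi.smul_apply, smul_eq_mul, hf t ht, hf' t ht]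
    ring
  add_mem' := by
    rintro f f' ⟨c, e, q, he, hq, hf⟩ ⟨c', e', q', he', hq', hf'⟩
    refine ⟨c + c', _, _, he.add he', hq.sum hq', fun t ht => ?_⟩
    simp only [Pi.add_apply, hf t ht, hf' t ht]
    ring
  algebraMap_mem' := fun c => ⟨c, _, _, .term h0, .zero h0, fun t _ => by simp⟩

/-- The functions that, on `T`, are sums of a constant, of a complex linear combination of functions
in `𝒮`, and of a function that is at least quadratic in `𝒮`. -/
def memorylessSubmodule (T : Set ℝ) (ν : ℝ) (𝒮 : Set (ℝ → ℝ)) (h0 : (fun _ => (0 : ℝ)) ∈ 𝒮) :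
    Submodule ℂ (ℝ → ℂ) where
  carrier := {f | ∃ (c : ℂ) (e q : ℝ → ℂ), e ∈ complexSpan 𝒮 ∧ Memory T ν 𝒮 2 q ∧
    ∀ t ∈ T, f t = c + e t + q t}
  zero_mem' := ⟨0, _, _, Submodule.zero_mem _, .zero h0, fun t _ => by simp⟩
  add_mem' := by
    rintro f f' ⟨c, e, q, he, hq, hf⟩ ⟨c', e', q', he', hq', hf'⟩
    refine ⟨c + c', _, _, Submodule.add_mem _ he he', hq.sum hq', fun t ht => ?_⟩
    simp only [Pi.add_apply, hf t ht, hf' t ht]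
    ring
  smul_mem' := by
    rintro k f ⟨c, e, q, he, hq, hf⟩
    refine ⟨k * c, _, _, Submodule.smul_mem _ k he, hq.smul k, fun t ht => ?_⟩
    simp only [Pi.smul_apply, smul_eq_mul, hf t ht]
    ring

/-- The class of functions built with memory and anticipation integrals from bounded functions;
corrections contain such integrals only in terms that are at least quadratic. -/
def CoeffClass.ofMemory (hT : T.OrdConnected) (hν : 0 ≤ ν)
    (h𝒮 : ∀ a ∈ 𝒮, BddContOn T fun t => (a t : ℂ)) (h0 : (fun _ => (0 : ℝ)) ∈ 𝒮) :
    CoeffClass T ν where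
  L := memorySubalgebra T ν 𝒮 h0
  K := memorylessSubmodule T ν 𝒮 h0
  le := by
    rintro f ⟨c, e, q, he, hq, hf⟩
    exact ⟨c, e, q, complexSpan.fastLinear h0 he, hq, hf⟩
  conj_mem_L := by
    rintro f ⟨c, e, q, he, hq, hf⟩
    exact ⟨(starRingEnd ℂ) c, _, _, he.conj, hq.conj, fun t ht => by simp only [hf t ht, map_add]⟩
  conj_mem_K := by
    rintro f ⟨c, e, q, he, hq, hf⟩
    exact ⟨(starRingEnd ℂ) c, _, _, complexSpan.conj he, hq.conj, fun t ht => by simp only [hf t ht, map_add]⟩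
  continuousOn := by
    rintro f ⟨c, e, q, he, hq, hf⟩
    exact (((BddContOn.const c).add (he.memory.bddContOn hT hν h𝒮)).add
      (hq.bddContOn hT hν h𝒮)).1.congr hf
  solve := by
    rintro μ R ⟨c, e, q, he, hq, hR⟩
    by_cases hμ : ν < |μ.re|
    · have hne : μ ≠ 0 := by
        rintro rfl
        simp only [Complex.zero_re, abs_zero] at hμ
        exact absurd hμ hν.not_gt
      -- Convolutions of constants are not admitted, so the constant source is balanced by the
      -- stationary solution `-c / μ`; the other two parts are convolved.
      refine ⟨_, ⟨-(c * μ⁻¹), _, _, (he.integral hμ).smul (convSign μ)⁻¹,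
        (hq.integral hμ).smul (convSign μ)⁻¹, fun t _ => rfl⟩, 0, Submodule.zero_mem _,
        fun t ht => ?_, fun _ => rfl⟩
      refine (((hasDerivWithinAt_const t T (-(c * μ⁻¹))).add
        (he.memory.solve_of_fast hT hν h𝒮 hμ t ht)).add
        (hq.solve_of_fast hT hν h𝒮 hμ t ht)).congr_deriv ?_
      rw [hR t ht]
      simp only [Pi.zero_apply]
      linear_combination c * inv_mul_cancel₀ hne
    -- At a slow rate only the linear part is processed; the constant and the quadratic part are
    -- already allowed in the correction.
    · obtain ⟨ξ, s, h1, h2, h3⟩ := he.solve_of_slow hT hν h𝒮 h0 (not_lt.1 hμ)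
      refine ⟨ξ, ⟨0, ξ, 0, h1, .zero h0, fun t _ => by simp⟩, fun t => c + s t + q t,
        ⟨c, s, q, h2, hq, fun t _ => rfl⟩, fun t ht => ?_, fun h => absurd h hμ⟩
      refine (h3 t ht).congr_deriv ?_
      rw [hR t ht]
      ring

theorem BddContOn.of_mem_ofMemory (hT : T.OrdConnected) (hν : 0 ≤ ν)
    (h𝒮 : ∀ a ∈ 𝒮, BddContOn T fun t => (a t : ℂ)) (h0 : (fun _ => (0 : ℝ)) ∈ 𝒮) {f : ℝ → ℂ}
    (hf : f ∈ (CoeffClass.ofMemory hT hν h𝒮 h0).L) : BddContOn T f := by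
  refine ⟨(CoeffClass.ofMemory hT hν h𝒮 h0).continuousOn f hf, ?_⟩
  obtain ⟨c, e, q, he, hq, hf⟩ := hf
  obtain ⟨-, M, hM⟩ := ((BddContOn.const c).add (he.memory.bddContOn hT hν h𝒮)).add
    (hq.bddContOn hT hν h𝒮)
  exact ⟨M, fun t ht => by rw [hf t ht]; exact hM t ht⟩

/-- Since `f` is real, taking real parts of its decomposition changes nothing. The real part of the
quadratic term is `(q + conj q) / 2`, which is again quadratic. -/
theorem noLinearMemory_of_mem (h0 : (fun _ => (0 : ℝ)) ∈ 𝒮) {f : ℝ → ℝ}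
    (hf : (fun t => (f t : ℂ)) ∈ memorylessSubmodule T ν 𝒮 h0) : NoLinearMemory T ν 𝒮 f := by
  obtain ⟨c, e, q, he, hq, hf⟩ := hf
  refine ⟨fun t => c.re * 1 + (e t).re, Submodule.add_mem _
    (Submodule.smul_mem _ c.re (Submodule.subset_span (mem_insert _ _)))
    (Submodule.span_mono (subset_insert _ _) (complexSpan.re_mem he)),
    _, (hq.sum hq.conj).smul (1 / 2), fun t ht => ?_⟩
  have h1 : f t = c.re + (e t).re + (q t).re := by
    simpa using congrArg Complex.re (hf t ht)
  simp only [Pi.smul_apply, smul_eq_mul]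
  rw [h1, Complex.add_conj]
  push_cast
  ring

end memory

end RatNF
end

noncomputable section

namespace RatNF

/-! ### Linear systems with sources in a class of coefficient functions -/

/-- An eigenvector `φ` of the transpose vanishes on the range of `M - μ`. If `μ` were not an
eigenvalue of `M`, this map would be injective, hence surjective in finite dimension, and `φ` would
be zero. -/
theorem exists_dual_eigenvector {V : Type*} [AddCommGroup V] [Module ℂ V] [FiniteDimensional ℂ V]
    [Nontrivial V] (M : Module.End ℂ V) :
    ∃ (φ : Module.Dual ℂ V) (μ : ℂ), φ ≠ 0 ∧ (∀ v, φ (M v) = μ * φ v) ∧ M.HasEigenvalue μ := by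
  have : Nontrivial (Module.Dual ℂ V) := inferInstance
  obtain ⟨μ, hμ⟩ := Module.End.exists_eigenvalue (K := ℂ) (Module.Dual.transpose (R := ℂ) M)
  obtain ⟨φ, hφ⟩ := hμ.exists_hasEigenvector
  have h1 : ∀ v, φ (M v) = μ * φ v := fun v => by
    simpa using! LinearMap.congr_fun hφ.apply_eq_smul v
  refine ⟨φ, μ, hφ.2, h1, ?_⟩
  by_contra hne
  have hinj : Function.Injective (M - algebraMap ℂ (Module.End ℂ V) μ) := by
    rw [← LinearMap.ker_eq_bot]
    rw [Module.End.hasEigenvalue_iff, not_not, Module.End.eigenspace_def] at hne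
    exact hne
  refine hφ.2 (LinearMap.ext fun v => ?_)
  obtain ⟨w, rfl⟩ := LinearMap.injective_iff_surjective.1 hinj v
  simp [Module.algebraMap_end_apply, h1]

/-- A vector-valued function belongs to a space of scalar functions through all functionals. -/
def VecMem {V : Type*} [AddCommGroup V] [Module ℂ V] (p : Submodule ℂ (ℝ → ℂ)) (w : ℝ → V) : Prop :=
  ∀ φ : Module.Dual ℂ V, (fun t => φ (w t)) ∈ p

/-- Triangularization, one dimension at a time: a dual eigenvector `φ` gives a decoupled scalar
equation for `φ ξ`, and its kernel is an invariant hyperplane to which the induction hypothesis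
applies. Neither diagonalizability nor a matrix exponential is needed. Eigenvalues of the
restriction are eigenvalues of `M`, so the claim about fast rates is inherited. -/
theorem CoeffClass.solve_vector {T : Set ℝ} {ν : ℝ} (𝒞 : CoeffClass T ν) {V : Type*}
    [AddCommGroup V] [Module ℂ V] [FiniteDimensional ℂ V] (M : Module.End ℂ V) {R : ℝ → V}
    (hR : VecMem (Subalgebra.toSubmodule 𝒞.L) R) :
    ∃ ξ s : ℝ → V, VecMem (Subalgebra.toSubmodule 𝒞.L) ξ ∧ VecMem 𝒞.K s ∧
      (∀ φ : Module.Dual ℂ V, ∀ t ∈ T,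
        HasDerivWithinAt (fun t => φ (ξ t)) (φ (M (ξ t) + R t - s t)) T t) ∧
      ((∀ μ, M.HasEigenvalue μ → ν < |μ.re|) → s = 0) := by
  obtain ⟨n, hn⟩ : ∃ n, Module.finrank ℂ V = n := ⟨_, rfl⟩
  induction n generalizing V with
  | zero =>
    have : Subsingleton V := Module.finrank_zero_iff.1 hn
    refine ⟨0, 0, fun φ => ?_, fun φ => ?_, fun φ t _ => ?_, fun _ => rfl⟩
    · simp only [Pi.zero_apply, map_zero]
      exact Submodule.zero_mem _
    · simp only [Pi.zero_apply, map_zero]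
      exact Submodule.zero_mem _
    · rw [Subsingleton.elim (M _ + _ - _) (0 : V)]
      simpa using! hasDerivWithinAt_const t T (0 : ℂ)
  | succ n ih =>
    have : Nontrivial V := Module.nontrivial_of_finrank_pos (R := ℂ) (by omega)
    obtain ⟨φ, μ, hφ, hM, hμ⟩ := exists_dual_eigenvector M
    obtain ⟨v, hv⟩ : ∃ v, φ v = 1 := by
      obtain ⟨w, hw⟩ : ∃ w, φ w ≠ 0 := by
        by_contra! h
        exact hφ (LinearMap.ext h)
      exact ⟨(φ w)⁻¹ • w, by simp [hw]⟩
    let V₀ : Submodule ℂ V := LinearMap.ker φ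
    have hinv : ∀ x ∈ V₀, M x ∈ V₀ := fun x hx => by
      rw [LinearMap.mem_ker] at hx ⊢
      rw [hM, hx, mul_zero]
    let M₀ : Module.End ℂ V₀ := M.restrict hinv
    let π : V →ₗ[ℂ] V₀ := (LinearMap.id - φ.smulRight v).codRestrict V₀ fun x => by
      simp [V₀, hv]
    have hπ : ∀ x, ((π x : V₀) : V) = x - φ x • v := fun x => rfl
    have hdim : Module.finrank ℂ V₀ = n := by
      have := Module.Dual.finrank_ker_add_one_of_ne_zero hφ
      exact Nat.add_right_cancel (this.trans hn)
    obtain ⟨x, hx, s₁, hs₁, hx', hs₁'⟩ := 𝒞.solve μ _ (hR φ)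
    have hx : x ∈ Subalgebra.toSubmodule 𝒞.L := hx
    -- With `x` known along `v`, the term `x • M v` acts as a further source in the hyperplane.
    -- Projection along `v` removes exactly the part accounted for by the scalar equation.
    have hR₀ : VecMem (Subalgebra.toSubmodule 𝒞.L) fun t => π (x t • M v + R t) := fun ψ => by
      have := Submodule.add_mem _ (Submodule.smul_mem _ (ψ (π (M v))) hx) (hR (ψ ∘ₗ π))
      refine (congrArg (· ∈ Subalgebra.toSubmodule 𝒞.L) (funext fun t => ?_)).mp this
      simp [mul_comm]
    obtain ⟨ξ₀, s₀, hξ₀, hs₀, hd, hs₀'⟩ := ih M₀ hR₀ hdim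
    refine ⟨fun t => x t • v + ξ₀ t, fun t => s₁ t • v + s₀ t, fun ψ => ?_, fun ψ => ?_,
      fun ψ t ht => ?_, fun h => ?_⟩
    · have := Submodule.add_mem _ (Submodule.smul_mem _ (ψ v) hx) (hξ₀ (ψ ∘ₗ V₀.subtype))
      refine (congrArg (· ∈ Subalgebra.toSubmodule 𝒞.L) (funext fun t => ?_)).mp this
      simp [mul_comm]
    · have := Submodule.add_mem _ (Submodule.smul_mem _ (ψ v) hs₁) (hs₀ (ψ ∘ₗ V₀.subtype))
      refine (congrArg (· ∈ 𝒞.K) (funext fun t => ?_)).mp this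
      simp [mul_comm]
    · have h1 := ((hx' t ht).mul_const (ψ v)).add (hd (ψ ∘ₗ V₀.subtype) t ht)
      have h2 : ∀ t, ψ (x t • v + ξ₀ t) = x t * ψ v + (ψ ∘ₗ V₀.subtype) (ξ₀ t) := by simp
      simp only [h2]
      refine h1.congr_deriv ?_
      have h3 : ((M₀ (ξ₀ t) : V₀) : V) = M (ξ₀ t) := rfl
      simp only [LinearMap.comp_apply, Submodule.subtype_apply, h3, hπ, map_add, map_sub, map_smul, smul_eq_mul, hM, hv]
      ring
    · have h4 : s₁ = 0 := hs₁' (h μ hμ)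
      have h5 : s₀ = 0 := hs₀' fun l hl => h l ?_
      · funext t
        simp [h4, h5]
      · obtain ⟨w, hw⟩ := hl.exists_hasEigenvector
        refine Module.End.hasEigenvalue_of_hasEigenvector (x := (w : V)) ⟨?_, ?_⟩
        · rw [Module.End.mem_eigenspace_iff]
          exact congrArg Subtype.val hw.apply_eq_smul
        · simpa using hw.2

/-! ### Linear systems for tensors -/

/-- Eigenspaces of one operator are invariant under the operators commuting with it, so one can pass
to smaller and smaller invariant subspaces. The subspace `W` is kept general for this induction and
to prescribe where the eigenvector lies. -/
theorem exists_joint_eigenvector {V ι : Type*} [AddCommGroup V] [Module ℂ V]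
    [FiniteDimensional ℂ V] (f : ι → Module.End ℂ V) (hc : ∀ k l, Commute (f k) (f l))
    (s : Finset ι) (W : Submodule ℂ V) (hW : W ≠ ⊥) (hinv : ∀ k, ∀ w ∈ W, f k w ∈ W) :
    ∃ w ∈ W, w ≠ 0 ∧ ∃ c : ι → ℂ, ∀ k ∈ s, f k w = c k • w := by
  classical
  induction s using Finset.induction_on generalizing W with
  | empty =>
    obtain ⟨w, hw, h0⟩ := Submodule.exists_mem_ne_zero_of_ne_bot hW
    exact ⟨w, hw, h0, 0, by simp⟩
  | insert k s hk ih =>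
    have : Nontrivial W := Submodule.nontrivial_iff_ne_bot.2 hW
    obtain ⟨μ, hμ⟩ := Module.End.exists_eigenvalue (K := ℂ) ((f k).restrict (hinv k))
    obtain ⟨w, hw⟩ := hμ.exists_hasEigenvector
    have hw1 : f k w = μ • (w : V) := congrArg Subtype.val hw.apply_eq_smul
    obtain ⟨v, hv, hv0, c, hvc⟩ := ih (W ⊓ Module.End.eigenspace (f k) μ)
      (Submodule.ne_bot_iff _ |>.2 ⟨w, ⟨w.2, Module.End.mem_eigenspace_iff.2 hw1⟩, by
        simpa using hw.2⟩)
      (fun l v hv => ⟨hinv l v hv.1, by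
        rw [SetLike.mem_coe]
        rw [Module.End.mem_eigenspace_iff, ← Module.End.mul_apply, (hc k l).eq,
          Module.End.mul_apply, Module.End.mem_eigenspace_iff.1 hv.2, map_smul]⟩)
    refine ⟨v, hv.1, hv0, Function.update c k μ, fun l hl => ?_⟩
    rcases eq_or_ne l k with rfl | hlk
    · simpa using Module.End.mem_eigenspace_iff.1 hv.2
    · simpa [hlk] using hvc l (Finset.mem_of_mem_insert_of_ne hl hlk)

section tensor

variable {ι I : Type*}

/-- The tensors whose nonzero entries have indices that satisfy a predicate. -/
def supportedTensors (κ : (ι → I) → Prop) : Submodule ℂ ((ι → I) → ℂ) where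
  carrier := {c | ∀ j, ¬κ j → c j = 0}
  zero_mem' := fun _ _ => rfl
  add_mem' := fun ha hb j hj => by simp [ha j hj, hb j hj]
  smul_mem' := fun r c hc j hj => by simp [hc j hj]

/-- The projection of tensors onto those supported on a set of indices. -/
def supportProj (κ : (ι → I) → Prop) : ((ι → I) → ℂ) →ₗ[ℂ] supportedTensors κ :=
  open scoped Classical in
  LinearMap.codRestrict (supportedTensors κ)
    { toFun := fun c j => if κ j then c j else 0
      map_add' := fun c c' => by
        funext j
        by_cases h : κ j <;> simp [h]
      map_smul' := fun r c => by
        funext j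
        by_cases h : κ j <;> simp [h] }
    (fun c j hj => by simp [hj])

theorem supportProj_add_not (κ : (ι → I) → Prop) (c : (ι → I) → ℂ) (j : ι → I) :
    (supportProj κ c : (ι → I) → ℂ) j + (supportProj (fun j => ¬κ j) c : (ι → I) → ℂ) j = c j := by
  classical
  have h1 : ∀ κ : (ι → I) → Prop, (supportProj κ c : (ι → I) → ℂ) j = if κ j then c j else 0 := by
    intro κ
    rfl
  by_cases h : κ j <;> simp [h1, h]

variable [DecidableEq ι] [Fintype I]

/-- The operator that applies a matrix to one slot of a tensor. -/
def slotOp (k : ι) (Q : Matrix I I ℂ) : Module.End ℂ ((ι → I) → ℂ) where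
  toFun c j := ∑ a, Q (j k) a * c (Function.update j k a)
  map_add' c c' := by
    funext j
    simp [mul_add, Finset.sum_add_distrib]
  map_smul' r c := by
    funext j
    simp only [Pi.smul_apply, smul_eq_mul, RingHom.id_apply, Finset.mul_sum]
    exact Finset.sum_congr rfl fun _ _ => by ring

theorem slotOp_apply (k : ι) (Q : Matrix I I ℂ) (c : (ι → I) → ℂ) (j : ι → I) :
    slotOp k Q c j = ∑ a, Q (j k) a * c (Function.update j k a) := rfl

theorem slotOp_commute {k l : ι} (h : k ≠ l) (Q Q' : Matrix I I ℂ) :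
    Commute (slotOp k Q) (slotOp l Q') := by
  refine LinearMap.ext fun c => funext fun j => ?_
  simp only [Module.End.mul_apply, slotOp_apply, Finset.mul_sum]
  rw [Finset.sum_comm]
  refine Finset.sum_congr rfl fun a _ => Finset.sum_congr rfl fun b _ => ?_
  rw [Function.update_of_ne h, Function.update_of_ne h.symm, Function.update_comm h]
  ring

/-- The operator that applies one matrix to each slot of a tensor and sums up. -/
def tensorOp [Fintype ι] (Q : ι → Matrix I I ℂ) : Module.End ℂ ((ι → I) → ℂ) := ∑ k, slotOp k (Q k)

theorem slotOp_mem_supportedTensors {κ : (ι → I) → Prop} {k : ι} {Q : Matrix I I ℂ}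
    (hκ : ∀ j a, Q (j k) a ≠ 0 → κ (Function.update j k a) → κ j) {c : (ι → I) → ℂ}
    (hc : c ∈ supportedTensors κ) : slotOp k Q c ∈ supportedTensors κ := by
  intro j hj
  rw [slotOp_apply]
  refine Finset.sum_eq_zero fun a _ => ?_
  by_cases hQ : Q (j k) a = 0
  · rw [hQ, zero_mul]
  · rw [hc _ fun h => hj (hκ j a hQ h), mul_zero]

variable [Fintype ι]

theorem tensorOp_mem_supportedTensors {κ : (ι → I) → Prop} {Q : ι → Matrix I I ℂ}
    (hκ : ∀ j k a, Q k (j k) a ≠ 0 → κ (Function.update j k a) → κ j) :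
    ∀ c ∈ supportedTensors κ, tensorOp Q c ∈ supportedTensors κ := by
  intro c hc
  rw [tensorOp, LinearMap.sum_apply]
  exact Submodule.sum_mem _ fun k _ => slotOp_mem_supportedTensors (fun j a => hκ j k a) hc

/-- Eigenvalues of a sum of slot operators are sums of eigenvalues of the slots. -/
theorem exists_slot_eigenvalues {κ : (ι → I) → Prop} {Q : ι → Matrix I I ℂ}
    (hκ : ∀ j k a, Q k (j k) a ≠ 0 → κ (Function.update j k a) → κ j) {μ : ℂ}
    (hμ : Module.End.HasEigenvalue
      ((tensorOp Q).restrict (tensorOp_mem_supportedTensors hκ)) μ) :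
    ∃ j, κ j ∧ ∃ c : ι → ℂ, μ = ∑ k, c k ∧
      ∀ k, ∃ v : I → ℂ, v (j k) ≠ 0 ∧ (Q k).mulVec v = c k • v := by
  obtain ⟨v, hv⟩ := hμ.exists_hasEigenvector
  have hv1 : tensorOp Q v = μ • (v : (ι → I) → ℂ) := congrArg Subtype.val hv.apply_eq_smul
  have hcomm : ∀ k l, Commute (slotOp k (Q k)) (slotOp l (Q l)) := by
    intro k l
    rcases eq_or_ne k l with rfl | h
    · exact Commute.refl _
    · exact slotOp_commute h _ _
  -- The joint eigenvector is sought inside the `μ`-eigenspace and among tensors of the given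
  -- support, so that its slot eigenvalues add up to `μ` and a nonzero entry has an index in `κ`.
  obtain ⟨w, hw, hw0, c, hc⟩ := exists_joint_eigenvector (fun k => slotOp k (Q k)) hcomm
    Finset.univ (supportedTensors κ ⊓ Module.End.eigenspace (tensorOp Q) μ)
    (Submodule.ne_bot_iff _ |>.2 ⟨v, ⟨v.2, Module.End.mem_eigenspace_iff.2 hv1⟩, by
      simpa using hv.2⟩)
    (fun k w hw => ⟨slotOp_mem_supportedTensors (fun j a => hκ j k a) hw.1, by
      rw [SetLike.mem_coe]
      have : Commute (tensorOp Q) (slotOp k (Q k)) :=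
        Commute.sum_left _ _ _ fun l _ => hcomm l k
      rw [Module.End.mem_eigenspace_iff, ← Module.End.mul_apply, this.eq,
        Module.End.mul_apply, Module.End.mem_eigenspace_iff.1 hw.2, map_smul]⟩)
  obtain ⟨j, hj⟩ : ∃ j, w j ≠ 0 := by
    by_contra! h
    exact hw0 (funext h)
  refine ⟨j, by_contra fun h => hj (hw.1 j h), c, ?_, fun k => ?_⟩
  · have h1 : tensorOp Q w = μ • w := Module.End.mem_eigenspace_iff.1 hw.2
    have h2 : tensorOp Q w = (∑ k, c k) • w := by
      rw [tensorOp, LinearMap.sum_apply, Finset.sum_smul]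
      exact Finset.sum_congr rfl fun k hk => hc k hk
    have h3 := congrFun (h1.symm.trans h2) j
    exact mul_right_cancel₀ hj h3
  -- Freezing all slots except `k` at the index `j` of a nonzero entry turns the tensor eigenvector
  -- into an eigenvector of the matrix `Q k`.
  · refine ⟨fun a => w (Function.update j k a), by simpa using hj, funext fun b => ?_⟩
    have h1 := congrFun (hc k (Finset.mem_univ k)) (Function.update j k b)
    simpa [slotOp_apply, Matrix.mulVec, dotProduct] using! h1

theorem vecMem_of_forall_mem {J V : Type*} [Finite J] [AddCommGroup V] [Module ℂ V]
    {p : Submodule ℂ (ℝ → ℂ)} {R : J → ℝ → ℂ} (hR : ∀ j, R j ∈ p) (π : (J → ℂ) →ₗ[ℂ] V) :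
    VecMem p fun t => π fun j => R j t := by
  classical
  have := Fintype.ofFinite J
  intro φ
  have h := Submodule.sum_mem p fun j (_ : j ∈ Finset.univ) =>
    p.smul_mem ((φ ∘ₗ π) (Pi.single j 1)) (hR j)
  refine (congrArg (· ∈ p) (funext fun t => ?_)).mp h
  rw [show φ (π fun j => R j t) = (φ ∘ₗ π) (fun j => R j t) from rfl,
    LinearMap.pi_apply_eq_sum_univ (φ ∘ₗ π), Finset.sum_apply]
  refine Finset.sum_congr rfl fun j _ => ?_
  rw [Pi.smul_apply, smul_eq_mul, smul_eq_mul, mul_comm]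
  congr 2
  funext i
  simp [Pi.single_apply, eq_comm]

/-- Linear systems for tensors are solvable up to corrections, and these vanish at indices where all
rates are fast. -/
theorem CoeffClass.solve_tensor {T : Set ℝ} {ν : ℝ} (𝒞 : CoeffClass T ν) (κ : (ι → I) → Prop)
    (Q : ι → Matrix I I ℂ)
    (hκ : ∀ j k a, Q k (j k) a ≠ 0 → (κ (Function.update j k a) ↔ κ j))
    (hfast : ∀ j, κ j → ∀ c : ι → ℂ,
      (∀ k, ∃ v : I → ℂ, v (j k) ≠ 0 ∧ (Q k).mulVec v = c k • v) → ν < |(∑ k, c k).re|)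
    {R : (ι → I) → ℝ → ℂ} (hR : ∀ j, R j ∈ 𝒞.L) :
    ∃ ξ s : (ι → I) → ℝ → ℂ, (∀ j, ξ j ∈ 𝒞.L) ∧ (∀ j, s j ∈ 𝒞.K) ∧ (∀ j, κ j → s j = 0) ∧
      ∀ j, ∀ t ∈ T, HasDerivWithinAt (ξ j)
        (∑ k, ∑ a, Q k (j k) a * ξ (Function.update j k a) t + R j t - s j t) T t := by
  have h1 : ∀ j k a, Q k (j k) a ≠ 0 → κ (Function.update j k a) → κ j :=
    fun j k a h => (hκ j k a h).1
  have h2 : ∀ j k a, Q k (j k) a ≠ 0 → ¬κ (Function.update j k a) → ¬κ j :=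
    fun j k a h h' => fun hj => h' ((hκ j k a h).2 hj)
  -- By `hκ` the tensors supported on `κ` and those supported off `κ` are both invariant, and the
  -- system splits into two. On the first part all rates are fast and the correction is zero; only
  -- the second part contributes to the final correction.
  obtain ⟨ξ, s, hξ, hs, hd, hs'⟩ := 𝒞.solve_vector
    ((tensorOp Q).restrict (tensorOp_mem_supportedTensors h1))
    (vecMem_of_forall_mem (p := Subalgebra.toSubmodule 𝒞.L) hR (supportProj κ))
  obtain ⟨ξ', s', hξ', hs₁', hd', -⟩ := 𝒞.solve_vector
    ((tensorOp Q).restrict (tensorOp_mem_supportedTensors h2))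
    (vecMem_of_forall_mem (p := Subalgebra.toSubmodule 𝒞.L) hR (supportProj fun j => ¬κ j))
  have hs0 : s = 0 := hs' fun μ hμ => by
    obtain ⟨j, hj, c, rfl, hc⟩ := exists_slot_eigenvalues h1 hμ
    exact hfast j hj c hc
  let ev : ∀ (κ : (ι → I) → Prop), (ι → I) → Module.Dual ℂ (supportedTensors κ) :=
    fun κ j => LinearMap.proj j ∘ₗ (supportedTensors κ).subtype
  refine ⟨fun j t => (ξ t : (ι → I) → ℂ) j + (ξ' t : (ι → I) → ℂ) j,
    fun j t => (s' t : (ι → I) → ℂ) j, fun j => ?_, fun j => ?_, fun j hj => ?_, fun j t ht => ?_⟩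
  · exact 𝒞.L.add_mem (hξ (ev _ j)) (hξ' (ev _ j))
  · exact hs₁' (ev _ j)
  · funext t
    exact (s' t).2 j (by simpa using hj)
  · refine ((hd (ev _ j) t ht).add (hd' (ev _ j) t ht)).congr_deriv ?_
    have h3 := supportProj_add_not κ (fun j => R j t) j
    have h4 : ∀ c : (ι → I) → ℂ, tensorOp Q c j
        = ∑ k, ∑ a, Q k (j k) a * c (Function.update j k a) := fun c => by
      rw [tensorOp, LinearMap.sum_apply, Finset.sum_apply]
      rfl
    simp only [mul_add, Finset.sum_add_distrib, ← h4, ← h3, hs0]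
    simp [ev, LinearMap.restrict_apply]
    ring

end tensor

/-! ### The rates of the homological equations -/

theorem mem_spectrum_of_mulVec {k : ℕ} {M : Matrix (Fin k) (Fin k) ℂ} {c : ℂ} {v : Fin k → ℂ}
    (hv : v ≠ 0) (h : M.mulVec v = c • v) : c ∈ spectrum ℂ M := by
  rw [spectrum.mem_iff]
  intro hu
  refine hv (Matrix.mulVec_injective_of_isUnit hu ?_)
  simp [Matrix.sub_mulVec, h, Matrix.algebraMap_eq_diagonal]
  funext i
  simp [Matrix.mulVec_diagonal]

theorem mem_spectrum_of_vecMul {k : ℕ} {M : Matrix (Fin k) (Fin k) ℂ} {c : ℂ} {v : Fin k → ℂ}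
    (hv : v ≠ 0) (h : Matrix.vecMul v M = c • v) : c ∈ spectrum ℂ M := by
  rw [spectrum.mem_iff]
  intro hu
  refine hv (Matrix.vecMul_injective_of_isUnit hu ?_)
  simp [Matrix.vecMul_sub, h, Matrix.algebraMap_eq_diagonal]
  funext i
  simp [Matrix.vecMul_diagonal, mul_comm]

section rates

variable {m n l : ℕ}

/-- The linear part of the system. -/
def linMat (A : Matrix (Fin m) (Fin m) ℝ) (B : Matrix (Fin n) (Fin n) ℝ)
    (C : Matrix (Fin l) (Fin l) ℝ) : Matrix (Idx m n l) (Idx m n l) ℝ :=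
  Matrix.fromBlocks A 0 0 (Matrix.fromBlocks B 0 0 C)

/-- The block of a coordinate: centre, stable, unstable. -/
def block : Idx m n l → Fin 3 := Sum.elim (fun _ => 0) (Sum.elim (fun _ => 1) fun _ => 2)

theorem linMat_eq_zero {A : Matrix (Fin m) (Fin m) ℝ} {B : Matrix (Fin n) (Fin n) ℝ}
    {C : Matrix (Fin l) (Fin l) ℝ} {i j : Idx m n l} (h : block i ≠ block j) :
    linMat A B C i j = 0 := by
  rcases i with i | i | i <;> rcases j with j | j | j <;> simp [block, linMat] at h ⊢

/-- The bounds on the real part of a rate that belongs to a block. -/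
def RateBound (α β : ℝ) (b : Fin 3) (r : ℝ) : Prop :=
  (b = 0 → |r| ≤ α) ∧ (b = 1 → r ≤ -β) ∧ (b = 2 → β ≤ r)

variable {A : Matrix (Fin m) (Fin m) ℝ} {B : Matrix (Fin n) (Fin n) ℝ}
  {C : Matrix (Fin l) (Fin l) ℝ} {α β : ℝ}

/-- `linMat` is block diagonal, so the restriction of `v` to the block of `i` is an eigenvector of
that block alone, and it is nonzero because `v i ≠ 0`. -/
theorem rateBound_of_mulVec (hA : ∀ a ∈ spectrum ℂ (A.map (algebraMap ℝ ℂ)), |a.re| ≤ α)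
    (hB : ∀ b ∈ spectrum ℂ (B.map (algebraMap ℝ ℂ)), b.re ≤ -β)
    (hC : ∀ c ∈ spectrum ℂ (C.map (algebraMap ℝ ℂ)), β ≤ c.re)
    {i : Idx m n l} {v : Idx m n l → ℂ} {c : ℂ} (hi : v i ≠ 0)
    (hv : ((linMat A B C).map (algebraMap ℝ ℂ)).mulVec v = c • v) :
    RateBound α β (block i) c.re := by
  rcases i with i | i | i
  · refine ⟨fun _ => hA c (mem_spectrum_of_mulVec (v := fun a => v (.inl a)) ?_ ?_), ?_, ?_⟩
    · exact fun h => hi (congrFun h i)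
    · funext a
      simpa [Matrix.mulVec, dotProduct, linMat, Fintype.sum_sum_type] using congrFun hv (.inl a)
    all_goals simp [block]
  · refine ⟨by simp [block], fun _ => hB c
      (mem_spectrum_of_mulVec (v := fun a => v (.inr (.inl a))) ?_ ?_), by simp [block]⟩
    · exact fun h => hi (congrFun h i)
    · funext a
      simpa [Matrix.mulVec, dotProduct, linMat, Fintype.sum_sum_type]
        using congrFun hv (.inr (.inl a))
  · refine ⟨by simp [block], by simp [block], fun _ => hC c
      (mem_spectrum_of_mulVec (v := fun a => v (.inr (.inr a))) ?_ ?_)⟩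
    · exact fun h => hi (congrFun h i)
    · funext a
      simpa [Matrix.mulVec, dotProduct, linMat, Fintype.sum_sum_type]
        using congrFun hv (.inr (.inr a))

theorem rateBound_of_vecMul (hA : ∀ a ∈ spectrum ℂ (A.map (algebraMap ℝ ℂ)), |a.re| ≤ α)
    (hB : ∀ b ∈ spectrum ℂ (B.map (algebraMap ℝ ℂ)), b.re ≤ -β)
    (hC : ∀ c ∈ spectrum ℂ (C.map (algebraMap ℝ ℂ)), β ≤ c.re)
    {i : Idx m n l} {v : Idx m n l → ℂ} {c : ℂ} (hi : v i ≠ 0)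
    (hv : Matrix.vecMul v ((linMat A B C).map (algebraMap ℝ ℂ)) = c • v) :
    RateBound α β (block i) c.re := by
  rcases i with i | i | i
  · refine ⟨fun _ => hA c (mem_spectrum_of_vecMul (v := fun a => v (.inl a)) ?_ ?_), ?_, ?_⟩
    · exact fun h => hi (congrFun h i)
    · funext a
      simpa [Matrix.vecMul, dotProduct, linMat, Fintype.sum_sum_type] using congrFun hv (.inl a)
    all_goals simp [block]
  · refine ⟨by simp [block], fun _ => hB c
      (mem_spectrum_of_vecMul (v := fun a => v (.inr (.inl a))) ?_ ?_), by simp [block]⟩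
    · exact fun h => hi (congrFun h i)
    · funext a
      simpa [Matrix.vecMul, dotProduct, linMat, Fintype.sum_sum_type]
        using congrFun hv (.inr (.inl a))
  · refine ⟨by simp [block], by simp [block], fun _ => hC c
      (mem_spectrum_of_vecMul (v := fun a => v (.inr (.inr a))) ?_ ?_)⟩
    · exact fun h => hi (congrFun h i)
    · funext a
      simpa [Matrix.vecMul, dotProduct, linMat, Fintype.sum_sum_type]
        using congrFun hv (.inr (.inr a))

/-- The terms, in the equation of a block and with factors from given blocks, that do not occur
in the normal form. -/
def Nonresonant {q : ℕ} (b : Fin 3) (c : Fin q → Fin 3) : Prop :=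
  (b = 0 ∧ (∃ k, c k ≠ 0) ∧ ¬((∃ k, c k = 1) ∧ ∃ k, c k = 2)) ∨
    (b = 1 ∧ ∀ k, c k ≠ 1) ∨ (b = 2 ∧ ∀ k, c k ≠ 2)

/-- After adding `α` all summands are nonnegative, so the sum dominates the single summand at `k₀`;
the shift costs `q * α`. -/
theorem add_sum_ge {q : ℕ} {r : Fin q → ℝ} (hr : ∀ k, -α ≤ r k) {k₀ : Fin q} (h₀ : β ≤ r k₀) :
    β + α - q * α ≤ ∑ k, r k := by
  have h1 : r k₀ + α ≤ ∑ k, (r k + α) :=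
    Finset.single_le_sum (f := fun k => r k + α) (fun k _ => by linarith [hr k])
      (Finset.mem_univ k₀)
  rw [Finset.sum_add_distrib] at h1
  simp only [Finset.sum_const, Finset.card_univ, Fintype.card_fin, nsmul_eq_mul] at h1
  linarith

theorem sum_ge {q : ℕ} {r : Fin q → ℝ} (hr : ∀ k, -α ≤ r k) : -(q * α) ≤ ∑ k, r k := by
  have h1 := Finset.card_nsmul_le_sum Finset.univ r (-α) fun k _ => hr k
  simp only [Finset.card_univ, Fintype.card_fin, nsmul_eq_mul] at h1
  linarith

/-- The rates of nonresonant terms are fast. -/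
theorem Nonresonant.lt_abs {q : ℕ} {ν : ℝ} (hα : 0 ≤ α) (hβ : 0 < β) (hν : ν < β - q * α)
    {b : Fin 3} {c : Fin q → Fin 3} (h : Nonresonant b c) {r₀ : ℝ} {r : Fin q → ℝ}
    (h₀ : RateBound α β b r₀) (hr : ∀ k, RateBound α β (c k) (r k)) : ν < |r₀ - ∑ k, r k| := by
  have hcases : ∀ x : Fin 3, x = 0 ∨ x = 1 ∨ x = 2 := by decide
  have hup : (∀ k, c k ≠ 1) → ∀ k, -α ≤ r k := fun h k => by
    rcases hcases (c k) with hk | hk | hk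
    · exact (abs_le.1 ((hr k).1 hk)).1
    · exact absurd hk (h k)
    · linarith [(hr k).2.2 hk]
  have hdown : (∀ k, c k ≠ 2) → ∀ k, -α ≤ -r k := fun h k => by
    rcases hcases (c k) with hk | hk | hk
    · linarith [(abs_le.1 ((hr k).1 hk)).2]
    · linarith [(hr k).2.1 hk]
    · exact absurd hk (h k)
  -- In a centre equation one hyperbolic factor contributes `β`, while the other `q - 1` factors and
  -- the centre rate itself can each take back `α`. In a stable or unstable equation the left side
  -- contributes `β` and the `q` factors take back at most `α` each. Every case ends with the bound
  -- `β - q * α`.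
  rcases h with ⟨rfl, ⟨k, hk⟩, hn⟩ | ⟨rfl, h⟩ | ⟨rfl, h⟩
  · have h1 := abs_le.1 (h₀.1 rfl)
    rcases hcases (c k) with h2 | h2 | h2
    · exact absurd h2 hk
    · have h3 : ∀ k, c k ≠ 2 := fun k' hk' => hn ⟨⟨k, h2⟩, ⟨k', hk'⟩⟩
      have h4 := add_sum_ge (hdown h3) (k₀ := k) (β := β) (by linarith [(hr k).2.1 h2])
      rw [Finset.sum_neg_distrib] at h4
      exact lt_of_lt_of_le (by linarith) (le_abs_self _)
    · have h3 : ∀ k, c k ≠ 1 := fun k' hk' => hn ⟨⟨k', hk'⟩, ⟨k, h2⟩⟩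
      have h4 := add_sum_ge (hup h3) (k₀ := k) ((hr k).2.2 h2)
      exact lt_of_lt_of_le (by linarith) (neg_le_abs _)
  · have h4 := sum_ge (hup h)
    have h5 := h₀.2.1 rfl
    exact lt_of_lt_of_le (by linarith) (neg_le_abs _)
  · have h4 := sum_ge (hdown h)
    rw [Finset.sum_neg_distrib] at h4
    have h5 := h₀.2.2 rfl
    exact lt_of_lt_of_le (by linarith) (le_abs_self _)

end rates

/-! ### Real coefficient functions -/

namespace CoeffClass

variable {T : Set ℝ} {ν : ℝ} (𝒞 : CoeffClass T ν)

/-- The real functions in a class of coefficient functions. -/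
def realL : Subalgebra ℝ (ℝ → ℝ) where
  carrier := {f | (fun t => (f t : ℂ)) ∈ 𝒞.L}
  mul_mem' := fun {a b} ha hb => by
    simpa using! 𝒞.L.mul_mem ha hb
  add_mem' := fun {a b} ha hb => by
    simpa using! 𝒞.L.add_mem ha hb
  algebraMap_mem' := fun r => 𝒞.L.algebraMap_mem (r : ℂ)

/-- The real corrections in a class of coefficient functions. -/
def realK : Submodule ℝ 𝒞.realL where
  carrier := {f | (fun t => ((f : ℝ → ℝ) t : ℂ)) ∈ 𝒞.K}
  zero_mem' := 𝒞.K.zero_mem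
  add_mem' := fun {a b} ha hb => by
    simpa using! 𝒞.K.add_mem ha hb
  smul_mem' := fun r a ha => by
    simpa using! 𝒞.K.smul_mem (r : ℂ) ha

theorem re_eq (f : ℝ → ℂ) :
    (fun t => ((f t).re : ℂ)) = (1 / 2 : ℂ) • (f + fun t => (starRingEnd ℂ) (f t)) := by
  funext t
  simp [Complex.add_conj]

theorem re_mem_realL {f : ℝ → ℂ} (hf : f ∈ 𝒞.L) : (fun t => (f t).re) ∈ 𝒞.realL := by
  change (fun t => ((f t).re : ℂ)) ∈ 𝒞.L
  rw [re_eq]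
  exact 𝒞.L.smul_mem (𝒞.L.add_mem hf (𝒞.conj_mem_L f hf)) _

theorem re_mem_K {f : ℝ → ℂ} (hf : f ∈ 𝒞.K) : (fun t => ((f t).re : ℂ)) ∈ 𝒞.K := by
  rw [re_eq]
  exact 𝒞.K.smul_mem _ (𝒞.K.add_mem hf (𝒞.conj_mem_K f hf))

theorem continuousOn_realL (f : 𝒞.realL) : ContinuousOn (f : ℝ → ℝ) T := by
  have := Complex.continuous_re.comp_continuousOn (𝒞.continuousOn _ f.2)
  exact this

/-- Slot `0` of the tensor is the equation index, acted on by `L`; the other `q` slots are the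
factors of the monomial, acted on by `-Lᵀ`. A complex solution is found first; as `linMat` and `R`
are real, its real part solves the same equation. -/
theorem solve_homological {m n l : ℕ} {A : Matrix (Fin m) (Fin m) ℝ}
    {B : Matrix (Fin n) (Fin n) ℝ} {C : Matrix (Fin l) (Fin l) ℝ} {α β : ℝ}
    (hA : ∀ a ∈ spectrum ℂ (A.map (algebraMap ℝ ℂ)), |a.re| ≤ α)
    (hB : ∀ b ∈ spectrum ℂ (B.map (algebraMap ℝ ℂ)), b.re ≤ -β)
    (hC : ∀ c ∈ spectrum ℂ (C.map (algebraMap ℝ ℂ)), β ≤ c.re)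
    (hα : 0 ≤ α) (hβ : 0 < β) {q : ℕ} (hν : ν < β - q * α)
    (R : Idx m n l → (Fin q → Idx m n l) → 𝒞.realL) :
    ∃ ζ σ : Idx m n l → (Fin q → Idx m n l) → 𝒞.realL, (∀ i j, σ i j ∈ 𝒞.realK) ∧
      (∀ i j, Nonresonant (block i) (fun k => block (j k)) → σ i j = 0) ∧
      ∀ i j, ∀ t ∈ T, HasDerivWithinAt (ζ i j : ℝ → ℝ)
        (((∑ a, linMat A B C i a • ζ a j
          - ∑ k, ∑ a, linMat A B C a (j k) • ζ i (Function.update j k a)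
          + R i j - σ i j : 𝒞.realL) : ℝ → ℝ) t) T t := by
  let L := (linMat A B C).map (algebraMap ℝ ℂ)
  let Q : Fin (q + 1) → Matrix (Idx m n l) (Idx m n l) ℂ := Fin.cons L fun _ => -L.transpose
  let κ : (Fin (q + 1) → Idx m n l) → Prop :=
    fun j => Nonresonant (block (j 0)) fun k : Fin q => block (j k.succ)
  have hLz : ∀ i a : Idx m n l, L i a ≠ 0 → block i = block a := fun i a h => by
    by_contra hb
    exact h (by simp [L, linMat_eq_zero hb])
  have hκ : ∀ j k a, Q k (j k) a ≠ 0 → (κ (Function.update j k a) ↔ κ j) := by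
    intro j k a h
    have hb : block (j k) = block a := by
      refine Fin.cases (motive := fun k => Q k (j k) a ≠ 0 → block (j k) = block a)
        (fun h => hLz _ _ h) (fun k h => (hLz _ _ ?_).symm) k h
      simpa [Q] using h
    have h1 : ∀ k', block (Function.update j k a k') = block (j k') := fun k' => by
      rcases eq_or_ne k' k with rfl | hk
      · simp [hb]
      · simp [hk]
    simp only [κ, h1]
  have hfast : ∀ j, κ j → ∀ c : Fin (q + 1) → ℂ,
      (∀ k, ∃ v : Idx m n l → ℂ, v (j k) ≠ 0 ∧ (Q k).mulVec v = c k • v) →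
      ν < |(∑ k, c k).re| := by
    intro j hj c hc
    obtain ⟨v, hv, hvc⟩ := hc 0
    have h0 := rateBound_of_mulVec hA hB hC hv (c := c 0) hvc
    -- An eigenvector of `-Lᵀ` is a left eigenvector of `L` for the opposite eigenvalue; the sum of
    -- the slot eigenvalues thus becomes the difference treated in `Nonresonant.lt_abs`.
    have h1 : ∀ k : Fin q, RateBound α β (block (j k.succ)) (-(c k.succ).re) := fun k => by
      obtain ⟨v, hv, hvc⟩ := hc k.succ
      rw [← Complex.neg_re]
      refine rateBound_of_vecMul hA hB hC hv ?_
      have h2 : -(Matrix.vecMul v L) = c k.succ • v := by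
        rw [← hvc]
        simp [Q, Matrix.neg_mulVec, Matrix.mulVec_transpose]
      rw [neg_smul, ← h2, neg_neg]
    have := Nonresonant.lt_abs hα hβ hν hj h0 h1
    rw [Fin.sum_univ_succ]
    simpa using this
  obtain ⟨ξ, s, hξ, hs, hs0, hd⟩ := 𝒞.solve_tensor κ Q hκ hfast
    (R := fun j t => ((R (j 0) (fun k => j k.succ) : ℝ → ℝ) t : ℂ)) (fun j => (R _ _).2)
  refine ⟨fun i j => ⟨_, 𝒞.re_mem_realL (hξ (Fin.cons i j : Fin (q + 1) → Idx m n l))⟩,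
    fun i j => ⟨_, 𝒞.re_mem_realL (𝒞.le _ (hs (Fin.cons i j : Fin (q + 1) → Idx m n l)))⟩,
    fun i j => 𝒞.re_mem_K (hs _), fun i j h => ?_, fun i j t ht => ?_⟩
  · have h1 := hs0 (Fin.cons i j : Fin (q + 1) → Idx m n l) h
    ext t
    simp [h1]
  · refine (Complex.reCLM.hasFDerivAt.comp_hasDerivWithinAt t
      (hd (Fin.cons i j : Fin (q + 1) → Idx m n l) t ht)).congr_deriv ?_
    rw [Fin.sum_univ_succ]
    simp only [Q, Fin.cons_zero, Fin.cons_succ, Fin.update_cons_zero, ← Fin.cons_update]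
    simp [L, -Fintype.sum_sum_type, -Fin.cons_update]
    ring

end CoeffClass

end RatNF
end

noncomputable section

namespace RatNF

open MvPolynomial
open scoped Pointwise

/-! ### Formal orders of multinomials -/

section order

variable {I 𝓡 : Type*} [CommRing 𝓡]

theorem pderiv_mem_pow (a : I) {k : ℕ} {f : MvPolynomial I 𝓡}
    (hf : f ∈ idealOfVars I 𝓡 ^ (k + 1)) : pderiv a f ∈ idealOfVars I 𝓡 ^ k := by
  induction k generalizing f with
  | zero => simp
  | succ k ih =>
    rw [pow_succ'] at hf
    refine Submodule.mul_induction_on hf (fun x hx y hy => ?_) fun x y hx hy => ?_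
    · rw [Derivation.leibniz, smul_eq_mul, smul_eq_mul]
      refine Ideal.add_mem _ ?_ (Ideal.mul_mem_right _ _ hy)
      rw [pow_succ']
      exact Ideal.mul_mem_mul hx (ih hy)
    · rw [map_add]
      exact Ideal.add_mem _ hx hy

theorem aeval_sub_aeval_mem (J : Ideal (MvPolynomial I 𝓡)) {ξ ξ' : I → MvPolynomial I 𝓡}
    (h : ∀ i, ξ' i - ξ i ∈ J) (f : MvPolynomial I 𝓡) : aeval ξ' f - aeval ξ f ∈ J := by
  induction f using MvPolynomial.induction_on with
  | C r => simp
  | add f g hf hg =>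
    rw [map_add, map_add, add_sub_add_comm]
    exact Ideal.add_mem _ hf hg
  | mul_X f i hf =>
    have : aeval ξ' (f * X i) - aeval ξ (f * X i)
        = (aeval ξ' f - aeval ξ f) * ξ' i + aeval ξ f * (ξ' i - ξ i) := by
      simp only [map_mul, aeval_X]
      ring
    rw [this]
    exact Ideal.add_mem _ (Ideal.mul_mem_right _ _ hf) (Ideal.mul_mem_left _ _ (h i))

theorem aeval_mem_idealOfVars {ξ : I → MvPolynomial I 𝓡} (h : ∀ i, ξ i ∈ idealOfVars I 𝓡)
    {f : MvPolynomial I 𝓡} (hf : f ∈ idealOfVars I 𝓡) : aeval ξ f ∈ idealOfVars I 𝓡 := by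
  have h1 : idealOfVars I 𝓡 ≤ (idealOfVars I 𝓡).comap (aeval ξ).toRingHom := by
    rw [idealOfVars, Ideal.span_le]
    rintro _ ⟨i, rfl⟩
    simpa using! h i
  exact h1 hf

/-- A perturbation of the substituted variables changes a strictly nonlinear multinomial at a higher
order. -/
theorem aeval_sub_aeval_mem_pow {q : ℕ} {ξ ξ' : I → MvPolynomial I 𝓡}
    (hξ : ∀ i, ξ i ∈ idealOfVars I 𝓡) (hξ' : ∀ i, ξ' i ∈ idealOfVars I 𝓡)
    (h : ∀ i, ξ' i - ξ i ∈ idealOfVars I 𝓡 ^ q) {f : MvPolynomial I 𝓡}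
    (hf : f ∈ idealOfVars I 𝓡 ^ 2) : aeval ξ' f - aeval ξ f ∈ idealOfVars I 𝓡 ^ (q + 1) := by
  rw [pow_two] at hf
  refine Submodule.mul_induction_on hf (fun x hx y hy => ?_) fun x y hx hy => ?_
  · have : aeval ξ' (x * y) - aeval ξ (x * y)
        = aeval ξ' x * (aeval ξ' y - aeval ξ y) + (aeval ξ' x - aeval ξ x) * aeval ξ y := by
      simp only [map_mul]
      ring
    rw [this]
    refine Ideal.add_mem _ ?_ ?_
    · rw [pow_succ']
      exact Ideal.mul_mem_mul (aeval_mem_idealOfVars hξ' hx) (aeval_sub_aeval_mem _ h y)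
    · rw [pow_succ]
      exact Ideal.mul_mem_mul (aeval_sub_aeval_mem _ h x) (aeval_mem_idealOfVars hξ hy)
  · rw [map_add, map_add, add_sub_add_comm]
    exact Ideal.add_mem _ hx hy

theorem prod_X_mem_pow {q : ℕ} (j : Fin q → I) :
    (∏ k, X (j k) : MvPolynomial I 𝓡) ∈ idealOfVars I 𝓡 ^ q := by
  have := Ideal.prod_mem_prod (ι := Fin q) (s := Finset.univ) (I := fun _ => idealOfVars I 𝓡)
    (x := fun k => X (j k)) fun k _ => Ideal.subset_span ⟨j k, rfl⟩
  simpa using this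

theorem derivation_prod {κ : Type*} [DecidableEq κ]
    (D : Derivation 𝓡 (MvPolynomial I 𝓡) (MvPolynomial I 𝓡))
    (s : Finset κ) (f : κ → MvPolynomial I 𝓡) :
    D (∏ k ∈ s, f k) = ∑ k ∈ s, (∏ k' ∈ s.erase k, f k') * D (f k) := by
  induction s using Finset.induction_on with
  | empty => simp
  | insert k s hk ih =>
    rw [Finset.prod_insert hk, Derivation.leibniz, ih, Finset.sum_insert hk,
      Finset.erase_insert hk, smul_eq_mul, smul_eq_mul, Finset.mul_sum, add_comm]
    congr 1
    refine Finset.sum_congr rfl fun k' hk' => ?_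
    have hne : k ≠ k' := fun h => hk (h ▸ hk')
    rw [Finset.erase_insert_of_ne hne, Finset.prod_insert fun h => hk (Finset.mem_of_mem_erase h),
      mul_assoc]

theorem mul_prod_erase_update {q : ℕ} (j : Fin q → I) (k : Fin q) (b : I) :
    (∏ k' ∈ Finset.univ.erase k, X (j k') : MvPolynomial I 𝓡) * X b
      = ∏ k', X (Function.update j k b k') := by
  rw [← Finset.mul_prod_erase Finset.univ _ (Finset.mem_univ k), mul_comm]
  congr 1
  · simp
  · refine Finset.prod_congr rfl fun k' hk' => ?_
    rw [Function.update_of_ne (Finset.ne_of_mem_erase hk')]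

/-- The homogeneous multinomial with given coefficients. -/
def tensorPoly [Fintype I] {q : ℕ} (c : (Fin q → I) → 𝓡) : MvPolynomial I 𝓡 :=
  ∑ j, C (c j) * ∏ k, X (j k)

variable [Fintype I] {q : ℕ}

theorem tensorPoly_mem_pow (c : (Fin q → I) → 𝓡) : tensorPoly c ∈ idealOfVars I 𝓡 ^ q :=
  Ideal.sum_mem _ fun j _ => Ideal.mul_mem_left _ _ (prod_X_mem_pow j)

theorem tensorPoly_add (c c' : (Fin q → I) → 𝓡) :
    tensorPoly (fun j => c j + c' j) = tensorPoly c + tensorPoly c' := by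
  simp [tensorPoly, add_mul, Finset.sum_add_distrib]

theorem tensorPoly_sub (c c' : (Fin q → I) → 𝓡) :
    tensorPoly (fun j => c j - c' j) = tensorPoly c - tensorPoly c' := by
  simp [tensorPoly, sub_mul, Finset.sum_sub_distrib]

theorem tensorPoly_neg (c : (Fin q → I) → 𝓡) :
    tensorPoly (fun j => -c j) = -tensorPoly c := by
  simp [tensorPoly]

theorem tensorPoly_mul (r : 𝓡) (c : (Fin q → I) → 𝓡) :
    tensorPoly (fun j => r * c j) = C r * tensorPoly c := by
  simp [tensorPoly, Finset.mul_sum, mul_assoc]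

theorem tensorPoly_sum {κ : Type*} (s : Finset κ) (c : κ → (Fin q → I) → 𝓡) :
    tensorPoly (fun j => ∑ a ∈ s, c a j) = ∑ a ∈ s, tensorPoly (c a) := by
  simp only [tensorPoly, map_sum, Finset.sum_mul]
  exact Finset.sum_comm

/-- The ideal power is spanned by products of `q` variables, and modulo the next power each
multiplier may be replaced by its constant term. The tensor is not unique, as permuted indices give
the same monomial, but existence suffices. -/
theorem exists_tensorPoly_sub_mem {e : MvPolynomial I 𝓡} (he : e ∈ idealOfVars I 𝓡 ^ q) :
    ∃ c : (Fin q → I) → 𝓡, e - tensorPoly c ∈ idealOfVars I 𝓡 ^ (q + 1) := by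
  classical
  have he' : e ∈ Ideal.span ((Set.range X : Set (MvPolynomial I 𝓡)) ^ q) := by
    rw [idealOfVars, Ideal.span, Submodule.span_pow] at he
    exact he
  have hle : ∀ x ∈ Ideal.span ((Set.range X : Set (MvPolynomial I 𝓡)) ^ q),
      x ∈ idealOfVars I 𝓡 ^ q := by
    intro x hx
    rw [idealOfVars, Ideal.span, Submodule.span_pow]
    exact hx
  induction he' using Submodule.span_induction with
  | mem x hx =>
    obtain ⟨f, rfl⟩ := Set.mem_pow.1 hx
    choose j hj using fun k => (f k).2
    refine ⟨Pi.single j 1, ?_⟩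
    have h1 : tensorPoly (Pi.single j (1 : 𝓡)) = ∏ k, X (j k) := by
      rw [tensorPoly, Finset.sum_eq_single j]
      · simp
      · intro b _ hb
        simp [hb]
      · simp
    rw [h1, List.prod_ofFn]
    simp [hj]
  | zero => exact ⟨0, by simp [tensorPoly]⟩
  | add x y hx hy hcx hcy =>
    obtain ⟨c, hc⟩ := hcx (hle x hx)
    obtain ⟨c', hc'⟩ := hcy (hle y hy)
    refine ⟨fun j => c j + c' j, ?_⟩
    rw [tensorPoly_add, add_sub_add_comm]
    exact Ideal.add_mem _ hc hc'
  | smul a x hx hcx =>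
    obtain ⟨c, hc⟩ := hcx (hle x hx)
    refine ⟨fun j => constantCoeff a * c j, ?_⟩
    have h1 : a - C (constantCoeff a) ∈ idealOfVars I 𝓡 := by
      rw [← pow_one (idealOfVars I 𝓡), mem_pow_idealOfVars_iff']
      intro d hd
      have : d = 0 := by
        rw [Nat.lt_one_iff] at hd
        exact (Finsupp.degree_eq_zero_iff d).1 hd
      subst this
      simp [constantCoeff_eq]
    have h2 : a • x - tensorPoly (fun j => constantCoeff a * c j)
        = (a - C (constantCoeff a)) * x + C (constantCoeff a) * (x - tensorPoly c) := by
      rw [tensorPoly_mul, smul_eq_mul]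
      ring
    rw [h2]
    refine Ideal.add_mem _ ?_ (Ideal.mul_mem_left _ _ hc)
    rw [pow_succ']
    exact Ideal.mul_mem_mul h1 (hle x hx)

/-- The linear forms with coefficients in the rows of a matrix. -/
def linForm [Algebra ℝ 𝓡] (L : Matrix I I ℝ) (a : I) : MvPolynomial I 𝓡 :=
  ∑ b, C (algebraMap ℝ 𝓡 (L a b)) * X b

/-- Both sides describe the derivation that sends each variable to its linear form. By Leibniz it
replaces one factor of a monomial at a time, which on coefficients is the transposed matrix acting
on one slot at a time. -/
theorem sum_pderiv_tensorPoly [Algebra ℝ 𝓡] (L : Matrix I I ℝ) (c : (Fin q → I) → 𝓡) :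
    ∑ a, pderiv a (tensorPoly c) * linForm L a
      = tensorPoly fun j => ∑ k, ∑ a, L a (j k) • c (Function.update j k a) := by
  have h1 : ∑ a, pderiv a (tensorPoly c) * linForm L a
      = mkDerivation 𝓡 (linForm L) (tensorPoly c) := by
    induction tensorPoly c using MvPolynomial.induction_on with
    | C r => simp [derivation_C]
    | add f g hf hg => simp only [map_add, add_mul, Finset.sum_add_distrib, hf, hg]
    | mul_X f i hf =>
      rw [Derivation.leibniz, mkDerivation_X, ← hf, Finset.smul_sum]
      simp only [Derivation.leibniz, add_mul, Finset.sum_add_distrib, smul_eq_mul]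
      congr 1
      · rw [Finset.sum_eq_single i]
        · simp
        · intro b _ hb
          simp [pderiv_X_of_ne hb.symm]
        · simp
      · exact Finset.sum_congr rfl fun _ _ => by ring
  rw [h1]
  have h3 : ∀ j : Fin q → I, mkDerivation 𝓡 (linForm L) (C (c j) * ∏ k, X (j k))
      = ∑ k, ∑ b, C (L (j k) b • c j) * ∏ k', X (Function.update j k b k') := by
    intro j
    rw [Derivation.leibniz, derivation_prod, derivation_C, smul_zero, add_zero]
    simp only [mkDerivation_X, smul_eq_mul, Finset.mul_sum, linForm]
    refine Finset.sum_congr rfl fun k _ => Finset.sum_congr rfl fun b _ => ?_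
    rw [← mul_prod_erase_update, Algebra.smul_def, C_mul]
    ring
  rw [tensorPoly, map_sum, Finset.sum_congr rfl fun j _ => h3 j, Finset.sum_comm, tensorPoly_sum]
  refine Finset.sum_congr rfl fun k _ => ?_
  simp only [tensorPoly, map_sum, Finset.sum_mul]
  rw [← Finset.sum_product', ← Finset.sum_product']
  -- Exchanging the new variable with the entry of `j` that it replaces is an involution on pairs;
  -- it moves the substitution from the monomial to the coefficient.
  refine Finset.sum_bij' (fun x _ => (Function.update x.1 k x.2, x.1 k))
    (fun x _ => (Function.update x.1 k x.2, x.1 k)) (fun _ _ => by simp) (fun _ _ => by simp)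
    (fun x _ => by simp) (fun x _ => by simp) fun x _ => by simp

end order

end RatNF
end

noncomputable section

namespace RatNF

open MvPolynomial

/-! ### The formal normal form -/

/-- A monomial with the factor `X i`, as a product of a multinomial and `X i`. -/
theorem C_mul_prod_X_eq {I 𝓡 : Type*} [CommRing 𝓡] {q : ℕ} (r : 𝓡) (j : Fin q → I) (k : Fin q) :
    C r * ∏ k, X (j k) = (C r * ∏ k' ∈ Finset.univ.erase k, X (j k')) * X (j k) := by
  rw [← Finset.prod_erase_mul Finset.univ _ (Finset.mem_univ k), mul_assoc]

section formal

variable {𝓡 : Type*} [CommRing 𝓡] [Algebra ℝ 𝓡]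

/-- All coefficients of a multinomial belong to a subspace. -/
def CoeffsMem {I : Type*} (K : Submodule ℝ 𝓡) (f : MvPolynomial I 𝓡) : Prop :=
  ∀ d, coeff d f ∈ K

namespace CoeffsMem

variable {I : Type*} {K : Submodule ℝ 𝓡}

theorem zero : CoeffsMem K (0 : MvPolynomial I 𝓡) := fun d => by simp

theorem add {f g : MvPolynomial I 𝓡} (hf : CoeffsMem K f) (hg : CoeffsMem K g) :
    CoeffsMem K (f + g) := fun d => by
  rw [coeff_add]
  exact K.add_mem (hf d) (hg d)

theorem C_mul_prod_X {r : 𝓡} (hr : r ∈ K) {κ : Type*} (s : Finset κ) (j : κ → I) :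
    CoeffsMem K (C r * ∏ k ∈ s, X (j k)) := fun d => by
  classical
  have : (∏ k ∈ s, X (j k) : MvPolynomial I 𝓡) = monomial (∑ k ∈ s, Finsupp.single (j k) 1) 1 := by
    rw [monomial_sum_one]
    rfl
  rw [this, C_mul_monomial, mul_one, coeff_monomial]
  split_ifs
  · exact hr
  · exact K.zero_mem

end CoeffsMem

variable {m n l : ℕ} (K : Submodule ℝ 𝓡)

/-- The nonlinear terms of the components of a normal form system, with coefficients in `K`. -/
def IsNormal : Idx m n l → MvPolynomial (Idx m n l) 𝓡 → Prop
  | .inl _, w => ∃ (Fc : MvPolynomial (Fin m) 𝓡) (FT : Fin n → Fin l → MvPolynomial (Idx m n l) 𝓡),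
      CoeffsMem K Fc ∧ (∀ j k, CoeffsMem K (FT j k)) ∧
      w = rename .inl Fc + ∑ j, ∑ k, FT j k * X (.inr (.inl j)) * X (.inr (.inr k))
  | .inr (.inl _), w => ∃ G : Fin n → MvPolynomial (Idx m n l) 𝓡,
      (∀ j, CoeffsMem K (G j)) ∧ w = ∑ j, G j * X (.inr (.inl j))
  | .inr (.inr _), w => ∃ H : Fin l → MvPolynomial (Idx m n l) 𝓡,
      (∀ k, CoeffsMem K (H k)) ∧ w = ∑ k, H k * X (.inr (.inr k))

variable {K}

theorem IsNormal.zero (i : Idx m n l) : IsNormal K i 0 := by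
  rcases i with i | i | i
  · exact ⟨0, fun _ _ => 0, .zero, fun _ _ => .zero, by simp⟩
  · exact ⟨fun _ => 0, fun _ => .zero, by simp⟩
  · exact ⟨fun _ => 0, fun _ => .zero, by simp⟩

theorem IsNormal.add {i : Idx m n l} {w w' : MvPolynomial (Idx m n l) 𝓡} (h : IsNormal K i w)
    (h' : IsNormal K i w') : IsNormal K i (w + w') := by
  rcases i with i | i | i
  · obtain ⟨Fc, FT, h1, h2, rfl⟩ := h
    obtain ⟨Fc', FT', h1', h2', rfl⟩ := h'
    refine ⟨Fc + Fc', fun j k => FT j k + FT' j k, h1.add h1', fun j k => (h2 j k).add (h2' j k), ?_⟩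
    simp only [map_add, add_mul, Finset.sum_add_distrib]
    ring
  · obtain ⟨G, h1, rfl⟩ := h
    obtain ⟨G', h1', rfl⟩ := h'
    exact ⟨fun j => G j + G' j, fun j => (h1 j).add (h1' j), by
      simp only [add_mul, Finset.sum_add_distrib]⟩
  · obtain ⟨G, h1, rfl⟩ := h
    obtain ⟨G', h1', rfl⟩ := h'
    exact ⟨fun j => G j + G' j, fun j => (h1 j).add (h1' j), by
      simp only [add_mul, Finset.sum_add_distrib]⟩

theorem block_eq_zero_iff {i : Idx m n l} : block i = 0 ↔ ∃ a, i = .inl a := by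
  rcases i with i | i | i <;> simp [block]

theorem block_eq_one_iff {i : Idx m n l} : block i = 1 ↔ ∃ a, i = .inr (.inl a) := by
  rcases i with i | i | i <;> simp [block]

theorem block_eq_two_iff {i : Idx m n l} : block i = 2 ↔ ∃ a, i = .inr (.inr a) := by
  rcases i with i | i | i <;> simp [block]

/-- An admitted monomial of a stable or unstable equation contains a variable of its own block,
which can be factored out. One of a centre equation is either a monomial in centre variables alone
or contains both a stable and an unstable variable. -/
theorem isNormal_C_mul_prod_X {q : ℕ} {r : 𝓡} (hr : r ∈ K) {i : Idx m n l}
    {j : Fin q → Idx m n l} (h : ¬Nonresonant (block i) fun k => block (j k)) :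
    IsNormal K i (C r * ∏ k, X (j k)) := by
  simp only [Nonresonant, not_or] at h
  rcases i with i | i | i
  · have h1 : (∃ k, block (j k) ≠ 0) → (∃ k, block (j k) = 1) ∧ ∃ k, block (j k) = 2 :=
      fun h2 => by_contra fun h3 => h.1 ⟨rfl, h2, h3⟩
    by_cases h2 : ∃ k, block (j k) ≠ 0
    · obtain ⟨⟨k₁, hk₁⟩, ⟨k₂, hk₂⟩⟩ := h1 h2
      have hne : k₂ ≠ k₁ := by
        rintro rfl
        exact absurd (hk₁.symm.trans hk₂) (by decide)
      obtain ⟨y, hy⟩ := block_eq_one_iff.1 hk₁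
      obtain ⟨z, hz⟩ := block_eq_two_iff.1 hk₂
      refine ⟨0, fun y' z' => if y' = y ∧ z' = z then
        C r * ∏ k ∈ (Finset.univ.erase k₁).erase k₂, X (j k) else 0, .zero, fun y' z' => ?_, ?_⟩
      · dsimp only
        split_ifs
        · exact .C_mul_prod_X hr _ _
        · exact .zero
      · rw [C_mul_prod_X_eq r j k₁, ← Finset.prod_erase_mul (Finset.univ.erase k₁) _
          (Finset.mem_erase.2 ⟨hne, Finset.mem_univ k₂⟩), Finset.sum_eq_single y,
          Finset.sum_eq_single z]
        · simp only [and_self, if_true, map_zero, hy, hz]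
          ring
        · intro b _ hb
          simp [hb]
        · simp
        · intro b _ hb
          simp [hb]
        · simp
    · push Not at h2
      choose j' hj' using fun k => block_eq_zero_iff.1 (h2 k)
      refine ⟨C r * ∏ k, X (j' k), fun _ _ => 0, .C_mul_prod_X hr _ _, fun _ _ => .zero, ?_⟩
      simp [hj']
  · obtain ⟨k, hk⟩ : ∃ k, block (j k) = 1 :=
      by_contra fun h3 => h.2.1 ⟨rfl, fun k hk => h3 ⟨k, hk⟩⟩
    obtain ⟨y, hy⟩ := block_eq_one_iff.1 hk
    refine ⟨fun y' => if y' = y then C r * ∏ k' ∈ Finset.univ.erase k, X (j k') else 0,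
      fun y' => ?_, ?_⟩
    · dsimp only
      split_ifs
      · exact .C_mul_prod_X hr _ _
      · exact .zero
    · rw [C_mul_prod_X_eq r j k, hy]
      simp
  · obtain ⟨k, hk⟩ : ∃ k, block (j k) = 2 :=
      by_contra fun h3 => h.2.2 ⟨rfl, fun k hk => h3 ⟨k, hk⟩⟩
    obtain ⟨y, hy⟩ := block_eq_two_iff.1 hk
    refine ⟨fun y' => if y' = y then C r * ∏ k' ∈ Finset.univ.erase k, X (j k') else 0,
      fun y' => ?_, ?_⟩
    · dsimp only
      split_ifs
      · exact .C_mul_prod_X hr _ _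
      · exact .zero
    · rw [C_mul_prod_X_eq r j k, hy]
      simp

theorem isNormal_tensorPoly {q : ℕ} {i : Idx m n l} {σ : (Fin q → Idx m n l) → 𝓡}
    (hσ : ∀ j, σ j ∈ K) (h : ∀ j, Nonresonant (block i) (fun k => block (j k)) → σ j = 0) :
    IsNormal K i (tensorPoly σ) := by
  rw [tensorPoly]
  refine Finset.sum_induction _ (IsNormal K i) (fun _ _ => .add) (.zero i) fun j _ => ?_
  by_cases hj : Nonresonant (block i) fun k => block (j k)
  · rw [h j hj, map_zero, zero_mul]
    exact .zero i
  · exact isNormal_C_mul_prod_X (hσ j) hj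

/-- Pairs of multinomials whose coefficients are related by a subspace. -/
def CoeffPairsMem {I : Type*} (𝓓 : Submodule ℝ (𝓡 × 𝓡)) (f g : MvPolynomial I 𝓡) : Prop :=
  ∀ d, (coeff d f, coeff d g) ∈ 𝓓

namespace CoeffPairsMem

variable {I : Type*} {𝓓 : Submodule ℝ (𝓡 × 𝓡)}

theorem add {f g f' g' : MvPolynomial I 𝓡} (h : CoeffPairsMem 𝓓 f g) (h' : CoeffPairsMem 𝓓 f' g') :
    CoeffPairsMem 𝓓 (f + f') (g + g') := fun d => by
  simpa using! 𝓓.add_mem (h d) (h' d)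

theorem tensorPoly [Fintype I] {q : ℕ} {ζ θ : (Fin q → I) → 𝓡} (h : ∀ j, (ζ j, θ j) ∈ 𝓓) :
    CoeffPairsMem 𝓓 (tensorPoly ζ) (tensorPoly θ) := fun d => by
  classical
  have h1 : ∀ c : (Fin q → I) → 𝓡, coeff d (RatNF.tensorPoly c)
      = ∑ j, if ∑ k, Finsupp.single (j k) 1 = d then c j else 0 := by
    intro c
    rw [RatNF.tensorPoly, coeff_sum]
    refine Finset.sum_congr rfl fun j _ => ?_
    have : (∏ k, X (j k) : MvPolynomial I 𝓡)
        = monomial (∑ k, Finsupp.single (j k) 1) 1 := by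
      rw [monomial_sum_one]
      rfl
    rw [this, C_mul_monomial, mul_one, coeff_monomial]
  have h2 : (coeff d (RatNF.tensorPoly ζ), coeff d (RatNF.tensorPoly θ))
      = ∑ j, if ∑ k, Finsupp.single (j k) 1 = d then (ζ j, θ j) else 0 := by
    rw [h1, h1, Prod.ext_iff, Prod.fst_sum, Prod.snd_sum]
    constructor <;> refine Finset.sum_congr rfl fun j _ => ?_ <;> split_ifs <;> rfl
  rw [h2]
  refine 𝓓.sum_mem fun j _ => ?_
  split_ifs
  · exact h j
  · exact 𝓓.zero_mem

end CoeffPairsMem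

/-- The formal difference between the field induced by the transformation `ξ`, with time derivative
`η`, and the normal form with nonlinear terms `W`, and the field `R`. -/
def formalDifference (L : Matrix (Idx m n l) (Idx m n l) ℝ)
    (R ξ η W : Idx m n l → MvPolynomial (Idx m n l) 𝓡) (i : Idx m n l) :
    MvPolynomial (Idx m n l) 𝓡 :=
  η i + ∑ a, pderiv a (ξ i) * (linForm L a + W a) - aeval ξ (R i)

/-- Solvability of the homological equation for terms of degree `q`. -/
def HomologicalSolvable (L : Matrix (Idx m n l) (Idx m n l) ℝ) (K : Submodule ℝ 𝓡)
    (𝓓 : Submodule ℝ (𝓡 × 𝓡)) (q : ℕ) : Prop :=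
  ∀ R : Idx m n l → (Fin q → Idx m n l) → 𝓡, ∃ ζ σ : Idx m n l → (Fin q → Idx m n l) → 𝓡,
    (∀ i j, σ i j ∈ K) ∧
    (∀ i j, Nonresonant (block i) (fun k => block (j k)) → σ i j = 0) ∧
    ∀ i j, (ζ i j, ∑ a, L i a • ζ a j - ∑ k, ∑ a, L a (j k) • ζ i (Function.update j k a)
      + R i j - σ i j) ∈ 𝓓

/-- One step of the construction of the normal form. -/
theorem formalDifference_step {L : Matrix (Idx m n l) (Idx m n l) ℝ}
    {R ξ η W : Idx m n l → MvPolynomial (Idx m n l) 𝓡} {q : ℕ} (hq : 2 ≤ q)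
    (hR : ∀ i, R i - linForm L i ∈ idealOfVars (Idx m n l) 𝓡 ^ 2)
    (hξ : ∀ i, ξ i - X i ∈ idealOfVars (Idx m n l) 𝓡 ^ 2)
    (hW : ∀ i, W i ∈ idealOfVars (Idx m n l) 𝓡 ^ 2)
    {c ζ σ : Idx m n l → (Fin q → Idx m n l) → 𝓡} (i : Idx m n l)
    (hc : formalDifference L R ξ η W i - tensorPoly (c i) ∈ idealOfVars (Idx m n l) 𝓡 ^ (q + 1)) :
    formalDifference L R (fun i => ξ i + tensorPoly (ζ i))
      (fun i => η i + tensorPoly fun j => ∑ a, L i a • ζ a j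
        - ∑ k, ∑ a, L a (j k) • ζ i (Function.update j k a) + -c i j - σ i j)
      (fun i => W i + tensorPoly (σ i)) i ∈ idealOfVars (Idx m n l) 𝓡 ^ (q + 1) := by
  set 𝔪 := idealOfVars (Idx m n l) 𝓡 with h𝔪
  have hX : ∀ i, (X i : MvPolynomial (Idx m n l) 𝓡) ∈ 𝔪 := fun i => Ideal.subset_span ⟨i, rfl⟩
  have hle : ∀ {k : ℕ}, 1 ≤ k → 𝔪 ^ k ≤ 𝔪 := fun hk => Ideal.pow_le_self (by omega)
  have hξ1 : ∀ i, ξ i ∈ 𝔪 := fun i => by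
    simpa using Ideal.add_mem _ (hle one_le_two (hξ i)) (hX i)
  have hξ2 : ∀ i, ξ i + tensorPoly (ζ i) ∈ 𝔪 := fun i =>
    Ideal.add_mem _ (hξ1 i) (hle (by omega) (tensorPoly_mem_pow (ζ i)))
  -- the substituted field
  have h1 : aeval (fun i => ξ i + tensorPoly (ζ i)) (R i) - aeval ξ (R i)
      - ∑ a, C (algebraMap ℝ 𝓡 (L i a)) * tensorPoly (ζ a) ∈ 𝔪 ^ (q + 1) := by
    have h2 := aeval_sub_aeval_mem_pow (q := q) hξ1 hξ2
      (fun i => by simpa using tensorPoly_mem_pow (ζ i)) (hR i)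
    have h3 : ∀ ξ : Idx m n l → MvPolynomial (Idx m n l) 𝓡,
        aeval ξ (linForm L i : MvPolynomial (Idx m n l) 𝓡)
        = ∑ a, C (algebraMap ℝ 𝓡 (L i a)) * ξ a := by
      intro ξ
      simp only [linForm, map_sum, map_mul, aeval_X, aeval_C]
      rfl
    have h4 : ∑ a, C (algebraMap ℝ 𝓡 (L i a)) * (ξ a + tensorPoly (ζ a))
        - ∑ a, C (algebraMap ℝ 𝓡 (L i a)) * ξ a
        = ∑ a, C (algebraMap ℝ 𝓡 (L i a)) * tensorPoly (ζ a) := by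
      rw [← Finset.sum_sub_distrib]
      exact Finset.sum_congr rfl fun a _ => by ring
    rw [map_sub, map_sub, h3, h3] at h2
    rw [← h4]
    convert h2 using 1
    ring
  -- the transformation of the corrections of the field
  have h5 : ∑ a, pderiv a (ξ i) * tensorPoly (σ a) - tensorPoly (σ i) ∈ 𝔪 ^ (q + 1) := by
    have h6 : ∑ a, pderiv a (X i : MvPolynomial (Idx m n l) 𝓡) * tensorPoly (σ a)
        = tensorPoly (σ i) := by
      rw [Finset.sum_eq_single i]
      · simp
      · intro b _ hb
        simp [pderiv_X_of_ne hb.symm]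
      · simp
    rw [← h6, ← Finset.sum_sub_distrib]
    refine Ideal.sum_mem _ fun a _ => ?_
    rw [← sub_mul, ← map_sub, pow_succ']
    refine Ideal.mul_mem_mul ?_ (tensorPoly_mem_pow _)
    simpa using pderiv_mem_pow a (k := 1) (hξ i)
  -- the new terms of the transformation meet nonlinear terms
  have h7 : ∑ a, pderiv a (tensorPoly (ζ i)) * (W a + tensorPoly (σ a)) ∈ 𝔪 ^ (q + 1) := by
    refine Ideal.sum_mem _ fun a _ => ?_
    have h8 : pderiv a (tensorPoly (ζ i)) ∈ 𝔪 ^ (q - 1) :=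
      pderiv_mem_pow a (by rw [Nat.sub_add_cancel (by omega)]; exact tensorPoly_mem_pow _)
    have h9 : W a + tensorPoly (σ a) ∈ 𝔪 ^ 2 :=
      Ideal.add_mem _ (hW a) (Ideal.pow_le_pow_right hq (tensorPoly_mem_pow _))
    have := Ideal.mul_mem_mul h8 h9
    rwa [← pow_add, show q - 1 + 2 = q + 1 by omega] at this
  -- The time derivative prescribed by the homological equation, as a multinomial; its terms cancel
  -- the degree `q` contributions isolated above together with the old error.
  have h10 : (tensorPoly fun j => ∑ a, L i a • ζ a j
      - ∑ k, ∑ a, L a (j k) • ζ i (Function.update j k a) + -c i j - σ i j)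
      = ∑ a, C (algebraMap ℝ 𝓡 (L i a)) * tensorPoly (ζ a)
        - ∑ a, pderiv a (tensorPoly (ζ i)) * linForm L a - tensorPoly (c i) - tensorPoly (σ i) := by
    rw [tensorPoly_sub, tensorPoly_add, tensorPoly_sub, tensorPoly_neg, sum_pderiv_tensorPoly,
      tensorPoly_sum, ← sub_eq_add_neg]
    simp only [Algebra.smul_def, tensorPoly_mul]
  have h11 := Ideal.add_mem _ (Ideal.add_mem _ (Ideal.sub_mem _ hc h1) h5) h7
  convert h11 using 1
  simp only [formalDifference, h10, map_add, add_mul, mul_add, Finset.sum_add_distrib]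
  ring

/-- Existence of a transformation to normal form with a formal difference of any order, as long as
the homological equations are solvable. -/
theorem exists_formal_normalForm {L : Matrix (Idx m n l) (Idx m n l) ℝ}
    {𝓓 : Submodule ℝ (𝓡 × 𝓡)} (h𝓓 : (1, 0) ∈ 𝓓)
    {R : Idx m n l → MvPolynomial (Idx m n l) 𝓡}
    (hR : ∀ i, R i - linForm L i ∈ idealOfVars (Idx m n l) 𝓡 ^ 2) {p : ℕ} (hp : 2 ≤ p)
    (hsolve : ∀ q, 2 ≤ q → q < p → HomologicalSolvable L K 𝓓 q) :
    ∃ ξ η W : Idx m n l → MvPolynomial (Idx m n l) 𝓡,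
      (∀ i, CoeffPairsMem 𝓓 (ξ i) (η i)) ∧ (∀ i, IsNormal K i (W i)) ∧
      (∀ i, ξ i - X i ∈ idealOfVars (Idx m n l) 𝓡 ^ 2) ∧
      (∀ i, W i ∈ idealOfVars (Idx m n l) 𝓡 ^ 2) ∧
      ∀ i, formalDifference L R ξ η W i ∈ idealOfVars (Idx m n l) 𝓡 ^ p := by
  induction p, hp using Nat.le_induction with
  | base =>
    refine ⟨X, fun _ => 0, fun _ => 0, fun i d => ?_, fun i => .zero i, fun i => by simp,
      fun i => by simp, fun i => ?_⟩
    · classical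
      rw [coeff_X, coeff_zero]
      split_ifs
      · exact h𝓓
      · exact 𝓓.zero_mem
    · have h1 : ∑ a, pderiv a (X i : MvPolynomial (Idx m n l) 𝓡) * (linForm L a + 0)
          = linForm L i := by
        rw [Finset.sum_eq_single i]
        · simp
        · intro b _ hb
          simp [pderiv_X_of_ne hb.symm]
        · simp
      rw [formalDifference, h1, aeval_X_left, AlgHom.id_apply, zero_add, ← neg_sub]
      exact Ideal.neg_mem_iff _ |>.2 (hR i)
  | succ q hq ih =>
    obtain ⟨ξ, η, W, h1, h2, h3, h4, h5⟩ := ih fun r hr hrq => hsolve r hr (by omega)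
    choose c hc using fun i => exists_tensorPoly_sub_mem (h5 i)
    -- The source is minus the leading part of the error, since the new terms have to cancel it.
    obtain ⟨ζ, σ, hσ, hσ0, hd⟩ := hsolve q hq (by omega) fun i j => -c i j
    refine ⟨_, _, _, fun i => (h1 i).add (CoeffPairsMem.tensorPoly (hd i)),
      fun i => (h2 i).add (isNormal_tensorPoly (hσ i) (hσ0 i)), fun i => ?_, fun i => ?_,
      fun i => formalDifference_step hq hR h3 h4 i (hc i)⟩
    · rw [add_sub_right_comm]
      exact Ideal.add_mem _ (h3 i) (Ideal.pow_le_pow_right hq (tensorPoly_mem_pow _))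
    · exact Ideal.add_mem _ (h4 i) (Ideal.pow_le_pow_right hq (tensorPoly_mem_pow _))

end formal

end RatNF
end

noncomputable section

namespace RatNF

/-! ### Taylor's theorem with a uniform remainder -/

section taylor

variable {E F : Type*} [NormedAddCommGroup E] [NormedSpace ℝ E] [NormedAddCommGroup F]
  [NormedSpace ℝ F]

theorem smul_mem_ball {r : ℝ} {u : E} (hu : u ∈ Metric.ball (0 : E) r) {s : ℝ}
    (hs : s ∈ Icc (0 : ℝ) 1) : s • u ∈ Metric.ball (0 : E) r := by
  rw [mem_ball_zero_iff] at hu ⊢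
  rw [norm_smul, Real.norm_of_nonneg hs.1]
  exact (mul_le_of_le_one_left (norm_nonneg _) hs.2).trans_lt hu

/-- Restricting to a segment through the origin reduces the multivariate Taylor estimate to the
one-variable remainder bound. -/
theorem iteratedDerivWithin_line {f : E → F} {r : ℝ} {p : ℕ}
    (hf : ContDiffOn ℝ p f (Metric.ball 0 r)) {u : E} (hu : u ∈ Metric.ball (0 : E) r) {k : ℕ}
    (hk : k ≤ p) {s : ℝ} (hs : s ∈ Icc (0 : ℝ) 1) :
    iteratedDerivWithin k (fun s : ℝ => f (s • u)) (Icc 0 1) s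
      = iteratedFDeriv ℝ k f (s • u) fun _ => u := by
  induction k generalizing s with
  | zero => simp
  | succ k ih =>
    have hd : DifferentiableAt ℝ (iteratedFDeriv ℝ k f) (s • u) :=
      (hf.contDiffAt (Metric.isOpen_ball.mem_nhds (smul_mem_ball hu hs))
        ).differentiableAt_iteratedFDeriv (by exact_mod_cast hk)
    have hl : HasDerivAt (fun s : ℝ => s • u) u s := by
      simpa using (hasDerivAt_id s).smul_const u
    have h1 := (hd.hasFDerivAt.comp_hasDerivAt s hl).hasDerivWithinAt (s := Icc (0 : ℝ) 1)
    have h2 : HasDerivWithinAt (fun s : ℝ => iteratedFDeriv ℝ k f (s • u) fun _ => u)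
        (iteratedFDeriv ℝ (k + 1) f (s • u) fun _ => u) (Icc 0 1) s := by
      rw [iteratedFDeriv_succ_apply_left]
      exact (ContinuousMultilinearMap.apply ℝ (fun _ : Fin k => E) F
        (fun _ => u)).hasFDerivAt.comp_hasDerivWithinAt s h1
    rw [iteratedDerivWithin_succ]
    rw [derivWithin_congr (fun x hx => ih (by omega) hx) (ih (by omega) hs)]
    exact h2.derivWithin (uniqueDiffOn_Icc zero_lt_one s hs)

/-- The constant depends only on the bound of the derivative of order `p`, so it is uniform in any
parameter for which that bound is. The factorial in the remainder is simply dropped. -/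
theorem norm_sub_taylor_le {f : E → F} {r M : ℝ} {p : ℕ} (hp : 1 ≤ p)
    (hf : ContDiffOn ℝ p f (Metric.ball 0 r))
    (hM : ∀ u ∈ Metric.ball (0 : E) r, ‖iteratedFDeriv ℝ p f u‖ ≤ M) {u : E}
    (hu : u ∈ Metric.ball (0 : E) r) :
    ‖f u - ∑ k ∈ Finset.range p, (k.factorial : ℝ)⁻¹ • iteratedFDeriv ℝ k f 0 fun _ => u‖
      ≤ M * ‖u‖ ^ p := by
  obtain ⟨n, rfl⟩ : ∃ n, p = n + 1 := ⟨p - 1, by omega⟩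
  have hM0 : 0 ≤ M := (norm_nonneg _).trans (hM u hu)
  have hg : ContDiffOn ℝ (n + 1) (fun s : ℝ => f (s • u)) (Icc 0 1) := by
    have h1 : ContDiffOn ℝ (n + 1) (fun s : ℝ => s • u) (Icc 0 1) :=
      (contDiff_id.smul contDiff_const).contDiffOn
    exact ContDiffOn.comp (by exact_mod_cast hf) h1 fun s hs => smul_mem_ball hu hs
  have h := taylor_mean_remainder_bound zero_le_one hg (right_mem_Icc.2 zero_le_one)
    (C := M * ‖u‖ ^ (n + 1)) fun s hs => by
      rw [iteratedDerivWithin_line hf hu le_rfl hs]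
      refine (ContinuousMultilinearMap.le_opNorm _ _).trans ?_
      rw [Finset.prod_const, Finset.card_univ, Fintype.card_fin]
      exact mul_le_mul_of_nonneg_right (hM _ (smul_mem_ball hu hs)) (by positivity)
  rw [taylor_within_apply] at h
  have h2 : ∑ k ∈ Finset.range (n + 1), ((k.factorial : ℝ)⁻¹ * (1 - 0) ^ k) •
      iteratedDerivWithin k (fun s : ℝ => f (s • u)) (Icc 0 1) 0
      = ∑ k ∈ Finset.range (n + 1), (k.factorial : ℝ)⁻¹ • iteratedFDeriv ℝ k f 0 fun _ => u := by
    refine Finset.sum_congr rfl fun k hk => ?_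
    rw [iteratedDerivWithin_line hf hu (Finset.mem_range.1 hk).le (left_mem_Icc.2 zero_le_one)]
    simp
  rw [h2, one_smul] at h
  refine h.trans ?_
  rw [sub_zero, one_pow, mul_one]
  exact div_le_self (by positivity) (by exact_mod_cast Nat.factorial_pos n)

end taylor

/-! ### Coordinates -/

section coordinates

variable {m n l : ℕ}

/-- The state with given coordinates. -/
def ofCoord : (Idx m n l → ℝ) →L[ℝ] State m n l :=
  LinearMap.toContinuousLinearMap
    { toFun := fun w => (fun i => w (.inl i), fun i => w (.inr (.inl i)), fun i => w (.inr (.inr i)))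
      map_add' := fun _ _ => rfl
      map_smul' := fun _ _ => rfl }

/-- The coordinate functionals. -/
def coordL (i : Idx m n l) : State m n l →L[ℝ] ℝ :=
  LinearMap.toContinuousLinearMap
    { toFun := fun U => coord U i
      map_add' := fun U V => by rcases i with i | i | i <;> rfl
      map_smul' := fun r U => by rcases i with i | i | i <;> rfl }

@[simp]
theorem coordL_apply (i : Idx m n l) (U : State m n l) : coordL i U = coord U i := rfl

@[simp]
theorem ofCoord_coord (U : State m n l) : ofCoord (coord U) = U := rfl

@[simp]
theorem coord_ofCoord (w : Idx m n l → ℝ) : coord (ofCoord w) = w := by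
  funext i
  rcases i with i | i | i <;> rfl

theorem coord_sub (U V : State m n l) (i : Idx m n l) :
    coord (U - V) i = coord U i - coord V i := (coordL i).map_sub U V

theorem coord_add (U V : State m n l) (i : Idx m n l) :
    coord (U + V) i = coord U i + coord V i := (coordL i).map_add U V

theorem abs_coord_le (U : State m n l) (i : Idx m n l) : |coord U i| ≤ ‖U‖ := by
  rcases i with i | i | i
  · exact (norm_le_pi_norm U.1 i).trans (norm_fst_le U)
  · exact (norm_le_pi_norm U.2.1 i).trans ((norm_fst_le U.2).trans (norm_snd_le U))
  · exact (norm_le_pi_norm U.2.2 i).trans ((norm_snd_le U.2).trans (norm_snd_le U))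

theorem eq_sum_coord (U : State m n l) :
    U = ∑ i, coord U i • ofCoord (Pi.single i (1 : ℝ)) := by
  conv_lhs => rw [← ofCoord_coord U, pi_eq_sum_univ' (coord U)]
  rw [map_sum]
  refine Finset.sum_congr rfl fun i _ => ?_
  rw [map_smul]

/-- With `gauge_le`, this makes the gauge equivalent to a power of the sup norm, so all estimates
can be made with `‖U‖ ^ p`. -/
theorem norm_pow_le_gauge (p : ℕ) (U : State m n l) : ‖U‖ ^ p ≤ gauge p U := by
  have h1 : ‖U‖ = max ‖U.1‖ (max ‖U.2.1‖ ‖U.2.2‖) := rfl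
  have h2 : 0 ≤ ‖U.1‖ ^ p := by positivity
  have h3 : 0 ≤ ‖U.2.1‖ ^ p := by positivity
  have h4 : 0 ≤ ‖U.2.2‖ ^ p := by positivity
  rw [gauge, h1]
  rcases max_choice ‖U.1‖ (max ‖U.2.1‖ ‖U.2.2‖) with h | h <;> rw [h]
  · linarith
  · rcases max_choice ‖U.2.1‖ ‖U.2.2‖ with h | h <;> rw [h] <;> linarith

theorem gauge_le (p : ℕ) (U : State m n l) : gauge p U ≤ 3 * ‖U‖ ^ p := by
  have h1 : ‖U.1‖ ^ p ≤ ‖U‖ ^ p := by gcongr; exact norm_fst_le U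
  have h2 : ‖U.2.1‖ ^ p ≤ ‖U‖ ^ p := by
    gcongr
    exact (norm_fst_le U.2).trans (norm_snd_le U)
  have h3 : ‖U.2.2‖ ^ p ≤ ‖U‖ ^ p := by
    gcongr
    exact (norm_snd_le U.2).trans (norm_snd_le U)
  rw [gauge]
  linarith

/-- States near the origin and times in `J`. -/
def nearOrigin (J : Set ℝ) : Filter (State m n l × ℝ) := 𝓝 0 ×ˢ 𝓟 J

/-- The principal filter on `J` forces one constant and one neighbourhood for all times, so
asymptotic calculus along `nearOrigin J` yields uniform order statements. -/
theorem isOrc_of_isBigO {F : Type*} [NormedAddCommGroup F] {J : Set ℝ} {p : ℕ}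
    {φ : ℝ → State m n l → F}
    (h : (fun q : State m n l × ℝ => φ q.2 q.1) =O[nearOrigin J] fun q => ‖q.1‖ ^ p) :
    IsOrc J p φ := by
  obtain ⟨M, hM0, hM⟩ := h.exists_nonneg
  rw [IsBigOWith, nearOrigin, eventually_prod_principal_iff] at hM
  obtain ⟨δ, hδ, hM⟩ := Metric.eventually_nhds_iff.1 hM
  refine ⟨M, δ, hδ, fun t ht U hU => (hM (by simpa using hU) t ht).trans ?_⟩
  rw [Real.norm_of_nonneg (by positivity)]
  exact mul_le_mul_of_nonneg_left (norm_pow_le_gauge p U) hM0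

theorem isBigO_of_coord {J : Set ℝ} {p : ℕ} {φ : State m n l × ℝ → State m n l}
    (h : ∀ i, (fun q => coord (φ q) i) =O[nearOrigin J] fun q : State m n l × ℝ => ‖q.1‖ ^ p) :
    φ =O[nearOrigin J] fun q => ‖q.1‖ ^ p := by
  have h1 : φ = fun q => ofCoord (coord (φ q)) := rfl
  rw [h1]
  exact (ofCoord.isBigO_comp _ _).trans (isBigO_pi.2 h)

theorem tendsto_fst_nearOrigin (J : Set ℝ) :
    Tendsto Prod.fst (nearOrigin J : Filter (State m n l × ℝ)) (𝓝 0) := tendsto_fst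

theorem isBigO_norm_pow {J : Set ℝ} {j k : ℕ} (h : j ≤ k) :
    (fun q : State m n l × ℝ => ‖q.1‖ ^ k) =O[nearOrigin J] fun q => ‖q.1‖ ^ j := by
  refine IsBigO.of_bound 1 ?_
  have h1 : ∀ᶠ q : State m n l × ℝ in nearOrigin J, ‖q.1‖ < 1 := by
    refine (tendsto_fst_nearOrigin J).eventually (p := fun U : State m n l => ‖U‖ < 1) ?_
    filter_upwards [Metric.ball_mem_nhds (0 : State m n l) one_pos] with U hU
    simpa using hU
  filter_upwards [h1] with q hq
  rw [one_mul, Real.norm_of_nonneg (by positivity), Real.norm_of_nonneg (by positivity)]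
  exact pow_le_pow_of_le_one (norm_nonneg _) hq.le h

end coordinates

end RatNF
end

noncomputable section

namespace RatNF

open MvPolynomial

/-- Multiplication by a truncated geometric series does not change the linear part. -/
theorem geom_sum_mul_sub_mem {I 𝓡 : Type*} [CommRing 𝓡] {p : ℕ} (hp : 1 ≤ p)
    {D ℓ F : MvPolynomial I 𝓡} (hD : D ∈ idealOfVars I 𝓡) (hℓ : ℓ ∈ idealOfVars I 𝓡)
    (hF : F ∈ idealOfVars I 𝓡 ^ 2) :
    (∑ r ∈ Finset.range p, (-D) ^ r) * (ℓ + F) - ℓ ∈ idealOfVars I 𝓡 ^ 2 := by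
  have h1 : ∑ r ∈ Finset.range p, (-D) ^ r - 1 ∈ idealOfVars I 𝓡 := by
    obtain ⟨k, rfl⟩ : ∃ k, p = k + 1 := ⟨p - 1, by omega⟩
    rw [Finset.sum_range_succ', pow_zero, add_sub_cancel_right]
    refine Ideal.sum_mem _ fun r _ => ?_
    rw [pow_succ]
    exact Ideal.mul_mem_left _ _ ((Ideal.neg_mem_iff _).2 hD)
  have h2 : (∑ r ∈ Finset.range p, (-D) ^ r) * (ℓ + F) - ℓ
      = (∑ r ∈ Finset.range p, (-D) ^ r - 1) * ℓ + (∑ r ∈ Finset.range p, (-D) ^ r) * F := by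
    ring
  rw [h2]
  refine Ideal.add_mem _ ?_ (Ideal.mul_mem_left _ _ hF)
  rw [pow_two]
  exact Ideal.mul_mem_mul h1 hℓ

/-! ### Evaluation of multinomials -/

namespace CoeffClass

variable {T : Set ℝ} {ν : ℝ} (𝒞 : CoeffClass T ν)

/-- The multinomial with time dependent coefficients given by a multinomial over a class of
coefficient functions. -/
def toTPoly {I : Type} (f : MvPolynomial I 𝒞.realL) : TPoly I := map 𝒞.realL.val.toRingHom f

/-- Evaluation at an instant and at a point. -/
def ev {I : Type} (t : ℝ) (v : I → ℝ) : MvPolynomial I 𝒞.realL →+* ℝ :=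
  eval₂Hom ((Pi.evalRingHom (fun _ : ℝ => ℝ) t).comp 𝒞.realL.val.toRingHom) v

/-- The pairs of a coefficient function and its time derivative. -/
def timeDeriv : Submodule ℝ (𝒞.realL × 𝒞.realL) where
  carrier := {x | ∀ t ∈ T, HasDerivWithinAt (x.1 : ℝ → ℝ) ((x.2 : ℝ → ℝ) t) T t}
  zero_mem' := fun t _ => hasDerivWithinAt_const t T (0 : ℝ)
  add_mem' := fun ha hb t ht => (ha t ht).add (hb t ht)
  smul_mem' := fun r _ ha t ht => (ha t ht).const_mul r

section evaluation

variable {I : Type}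

theorem coeff_toTPoly (f : MvPolynomial I 𝒞.realL) (d : I →₀ ℕ) :
    (𝒞.toTPoly f).coeff d = ((coeff d f : 𝒞.realL) : ℝ → ℝ) := coeff_map _ _ _

theorem val_toTPoly (f : MvPolynomial I 𝒞.realL) (t : ℝ) (v : I → ℝ) :
    (𝒞.toTPoly f).val t v = 𝒞.ev t v f := eval₂_map _ _ _ _

@[simp]
theorem ev_C (t : ℝ) (v : I → ℝ) (r : 𝒞.realL) : 𝒞.ev t v (C r) = (r : ℝ → ℝ) t := by
  simp [ev]

@[simp]
theorem ev_X (t : ℝ) (v : I → ℝ) (i : I) : 𝒞.ev t v (X i) = v i := by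
  simp [ev]

theorem ev_rename {J : Type} (g : J → I) (t : ℝ) (v : I → ℝ) (f : MvPolynomial J 𝒞.realL) :
    𝒞.ev t v (rename g f) = 𝒞.ev t (v ∘ g) f := eval₂_rename _ _ _ _

theorem ev_aeval (t : ℝ) (v : I → ℝ) (ξ : I → MvPolynomial I 𝒞.realL) (f : MvPolynomial I 𝒞.realL) :
    𝒞.ev t v (aeval ξ f) = 𝒞.ev t (fun i => 𝒞.ev t v (ξ i)) f := by
  induction f using MvPolynomial.induction_on with
  | C r => simp [MvPolynomial.algebraMap_eq]
  | add f g hf hg => simp only [map_add, hf, hg]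
  | mul_X f i hf => simp only [map_mul, aeval_X, ev_X, hf]

theorem ev_eq_sum [Fintype I] (t : ℝ) (v : I → ℝ) (f : MvPolynomial I 𝒞.realL) :
    𝒞.ev t v f = ∑ d ∈ f.support, ((coeff d f : 𝒞.realL) : ℝ → ℝ) t * ∏ i, v i ^ d i :=
  eval₂_eq' _ _ _

theorem hasDerivWithinAt_ev [Fintype I] {f g : MvPolynomial I 𝒞.realL}
    (h : CoeffPairsMem 𝒞.timeDeriv f g) (v : I → ℝ) {t : ℝ} (ht : t ∈ T) :
    HasDerivWithinAt (fun s => 𝒞.ev s v f) (𝒞.ev t v g) T t := by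
  classical
  have h1 : ∀ s : ℝ, ∀ e : MvPolynomial I 𝒞.realL, e.support ⊆ f.support ∪ g.support →
      𝒞.ev s v e = ∑ d ∈ f.support ∪ g.support, ((coeff d e : 𝒞.realL) : ℝ → ℝ) s * ∏ i, v i ^ d i := by
    intro s e he
    rw [ev_eq_sum]
    refine Finset.sum_subset he fun d _ hd => ?_
    rw [notMem_support_iff.1 hd]
    simp
  simp only [h1 _ f Finset.subset_union_left, h1 _ g Finset.subset_union_right]
  exact HasDerivWithinAt.fun_sum fun d _ => (h d t ht).mul_const _

end evaluation

variable {m n l : ℕ}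

theorem hasFDerivAt_ev (t : ℝ) (U : State m n l) (f : MvPolynomial (Idx m n l) 𝒞.realL) :
    HasFDerivAt (fun U => 𝒞.ev t (coord U) f)
      (∑ a, 𝒞.ev t (coord U) (pderiv a f) • (coordL a : State m n l →L[ℝ] ℝ)) U := by
  induction f using MvPolynomial.induction_on with
  | C r => simpa using hasFDerivAt_const ((r : ℝ → ℝ) t) U
  | add f g hf hg =>
    simp only [map_add, add_smul, Finset.sum_add_distrib]
    exact hf.add hg
  | mul_X f i hf =>
    simp only [map_mul, ev_X]
    refine (hf.mul (coordL i).hasFDerivAt).congr_fderiv ?_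
    rw [Finset.smul_sum]
    simp only [Derivation.leibniz, smul_eq_mul, map_add, map_mul, ev_X, add_smul,
      Finset.sum_add_distrib, coordL_apply]
    congr 1
    · rw [Finset.sum_eq_single i]
      · simp
      · intro b _ hb
        simp [pderiv_X_of_ne hb.symm]
      · simp
    · exact Finset.sum_congr rfl fun a _ => by rw [smul_smul]

/-- The passage from formal to analytic order: every monomial has degree at least `k`, there are
finitely many of them, and the coefficients are bounded on `J`. -/
theorem isBigO_ev {J : Set ℝ} (hJ : ∀ f : 𝒞.realL, ∃ M, ∀ t ∈ J, |(f : ℝ → ℝ) t| ≤ M) {k : ℕ}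
    {f : MvPolynomial (Idx m n l) 𝒞.realL} (hf : f ∈ idealOfVars (Idx m n l) 𝒞.realL ^ k) :
    (fun q : State m n l × ℝ => 𝒞.ev q.2 (coord q.1) f) =O[nearOrigin J] fun q => ‖q.1‖ ^ k := by
  simp only [ev_eq_sum]
  refine IsBigO.fun_sum fun d hd => ?_
  have hk : k ≤ d.degree := (mem_pow_idealOfVars_iff k f).1 hf d hd
  refine IsBigO.trans ?_ (isBigO_norm_pow hk)
  obtain ⟨M, hM⟩ := hJ (coeff d f)
  refine IsBigO.of_bound M ?_
  rw [nearOrigin, eventually_prod_principal_iff]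
  refine Eventually.of_forall fun U t ht => ?_
  rw [norm_mul, Real.norm_eq_abs, Real.norm_of_nonneg (by positivity : 0 ≤ ‖U‖ ^ d.degree)]
  refine mul_le_mul (hM t ht) ?_ (norm_nonneg _) ((abs_nonneg _).trans (hM t ht))
  rw [norm_prod, Finsupp.degree_eq_sum, ← Finset.prod_pow_eq_pow_sum]
  refine Finset.prod_le_prod (fun _ _ => norm_nonneg _) fun i _ => ?_
  rw [norm_pow]
  exact pow_le_pow_left₀ (norm_nonneg _) (abs_coord_le U i) _

end CoeffClass

/-! ### The given system as a multinomial -/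

section system

variable {m n l : ℕ}

/-- The functionals that select the numerators. -/
def num (i : Idx m n l) : (State m n l × (ℝ × ℝ × ℝ)) →L[ℝ] ℝ :=
  (coordL i).comp (ContinuousLinearMap.fst ℝ _ _)

/-- The functionals that select the denominators. -/
def den (i : Idx m n l) : (State m n l × (ℝ × ℝ × ℝ)) →L[ℝ] ℝ :=
  (Sum.elim (fun _ => ContinuousLinearMap.fst ℝ _ _)
    (Sum.elim (fun _ => (ContinuousLinearMap.fst ℝ _ _).comp (ContinuousLinearMap.snd ℝ _ _))
      (fun _ => (ContinuousLinearMap.snd ℝ _ _).comp (ContinuousLinearMap.snd ℝ _ _))) i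
    : (ℝ × ℝ × ℝ) →L[ℝ] ℝ).comp (ContinuousLinearMap.snd ℝ _ _)

theorem coord_ratRHS (A : Matrix (Fin m) (Fin m) ℝ) (B : Matrix (Fin n) (Fin n) ℝ)
    (C : Matrix (Fin l) (Fin l) ℝ) (N : ℝ → Nonlin m n l) (t : ℝ) (u : State m n l)
    (i : Idx m n l) : coord (ratRHS A B C N t u) i = (1 + den i ((N t).all u))⁻¹ *
      (∑ j, linMat A B C i j * coord u j + num i ((N t).all u)) := by
  rcases i with i | i | i <;>
  simp [ratRHS, coord, den, num, Nonlin.all, linMat, Matrix.mulVec, dotProduct, coordL,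
    mul_add]

namespace CoeffClass

variable {T : Set ℝ} {ν : ℝ} (𝒞 : CoeffClass T ν) (N : ℝ → Nonlin m n l)

/-- The Taylor coefficients of a component of the nonlinear functions belong to the class of
coefficient functions. -/
def ContainsTaylor (p : ℕ) : Prop :=
  ∀ k < p, ∀ (Λ : (State m n l × (ℝ × ℝ × ℝ)) →L[ℝ] ℝ) (v : Fin k → State m n l),
    (fun t => Λ (iteratedFDeriv ℝ k (N t).all 0 v)) ∈ 𝒞.realL

open scoped Classical in
/-- A coefficient of the Taylor polynomial. -/
def taylorCoeff (Λ : (State m n l × (ℝ × ℝ × ℝ)) →L[ℝ] ℝ) (k : ℕ) (j : Fin k → Idx m n l) :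
    𝒞.realL :=
  -- The fallback value is harmless: under `ContainsTaylor` with order `p` the membership holds for
  -- every `k < p`, and these are the only orders in the Taylor polynomials used.
  if h : (fun t => Λ (iteratedFDeriv ℝ k (N t).all 0 fun a =>
      ofCoord (Pi.single (j a) (1 : ℝ)))) ∈ 𝒞.realL
  then (k.factorial : ℝ)⁻¹ • ⟨_, h⟩ else 0

/-- The terms of the Taylor polynomial with orders in `[a, b)`. -/
def taylorPoly (Λ : (State m n l × (ℝ × ℝ × ℝ)) →L[ℝ] ℝ) (a b : ℕ) :
    MvPolynomial (Idx m n l) 𝒞.realL :=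
  ∑ k ∈ Finset.Ico a b, tensorPoly (𝒞.taylorCoeff N Λ k)

theorem taylorPoly_mem (Λ : (State m n l × (ℝ × ℝ × ℝ)) →L[ℝ] ℝ) (a b : ℕ) :
    𝒞.taylorPoly N Λ a b ∈ idealOfVars (Idx m n l) 𝒞.realL ^ a :=
  Ideal.sum_mem _ fun _ hk =>
    Ideal.pow_le_pow_right (Finset.mem_Ico.1 hk).1 (tensorPoly_mem_pow _)

variable {N} in
theorem ev_taylorPoly {p : ℕ} (hN : 𝒞.ContainsTaylor N p)
    (Λ : (State m n l × (ℝ × ℝ × ℝ)) →L[ℝ] ℝ) (a : ℕ) (t : ℝ) (u : State m n l) :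
    𝒞.ev t (coord u) (𝒞.taylorPoly N Λ a p)
      = ∑ k ∈ Finset.Ico a p,
        (k.factorial : ℝ)⁻¹ * Λ (iteratedFDeriv ℝ k (N t).all 0 fun _ => u) := by
  rw [taylorPoly, map_sum]
  refine Finset.sum_congr rfl fun k hk => ?_
  have h1 : (iteratedFDeriv ℝ k (N t).all 0 fun _ => u) = ∑ j : Fin k → Idx m n l,
      (∏ a, coord u (j a)) • iteratedFDeriv ℝ k (N t).all 0 fun a =>
        ofCoord (Pi.single (j a) (1 : ℝ)) := by
    conv_lhs => rw [eq_sum_coord u]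
    rw [ContinuousMultilinearMap.map_sum]
    refine Finset.sum_congr rfl fun j _ => ?_
    rw [ContinuousMultilinearMap.map_smul_univ]
  rw [h1, tensorPoly, map_sum, map_sum, Finset.mul_sum]
  refine Finset.sum_congr rfl fun j _ => ?_
  rw [map_mul, map_prod, ev_C, map_smul, taylorCoeff,
    dif_pos (hN k (Finset.mem_Ico.1 hk).2 Λ _)]
  simp only [ev_X, smul_eq_mul]
  change (k.factorial : ℝ)⁻¹ * _ * _ = _
  ring

/-- The components of the given system, as multinomials with an error of order `p`. -/
def systemPoly (L : Matrix (Idx m n l) (Idx m n l) ℝ) (p : ℕ) (i : Idx m n l) :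
    MvPolynomial (Idx m n l) 𝒞.realL :=
  (∑ r ∈ Finset.range p, (-𝒞.taylorPoly N (den i) 1 p) ^ r) *
    (linForm L i + 𝒞.taylorPoly N (num i) 2 p)

theorem linForm_mem (L : Matrix (Idx m n l) (Idx m n l) ℝ) (i : Idx m n l) :
    (linForm L i : MvPolynomial (Idx m n l) 𝒞.realL) ∈ idealOfVars (Idx m n l) 𝒞.realL :=
  Ideal.sum_mem _ fun a _ => Ideal.mul_mem_left _ _ (Ideal.subset_span ⟨a, rfl⟩)

theorem systemPoly_sub_mem (L : Matrix (Idx m n l) (Idx m n l) ℝ) {p : ℕ} (hp : 1 ≤ p)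
    (i : Idx m n l) : 𝒞.systemPoly N L p i - linForm L i ∈ idealOfVars (Idx m n l) 𝒞.realL ^ 2 :=
  geom_sum_mul_sub_mem hp (by simpa using 𝒞.taylorPoly_mem N (den i) 1 p) (𝒞.linForm_mem L i)
    (𝒞.taylorPoly_mem N (num i) 2 p)

end CoeffClass

/-- Near the origin, the derivatives of order `p` are bounded uniformly for times in `J`. -/
def BoundedDeriv (N : ℝ → Nonlin m n l) (J : Set ℝ) (p : ℕ) : Prop :=
  ∃ M r : ℝ, 0 < r ∧ ∀ t ∈ J, ContDiffOn ℝ p (N t).all (Metric.ball 0 r) ∧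
    ∀ u ∈ Metric.ball (0 : State m n l) r, ‖iteratedFDeriv ℝ p (N t).all u‖ ≤ M

theorem BoundedDeriv.isBigO_sub_taylor {N : ℝ → Nonlin m n l} {J : Set ℝ} {p : ℕ} (hp : 1 ≤ p)
    (h : BoundedDeriv N J p) (Λ : (State m n l × (ℝ × ℝ × ℝ)) →L[ℝ] ℝ) :
    (fun q : State m n l × ℝ => Λ ((N q.2).all q.1) - ∑ k ∈ Finset.range p,
      (k.factorial : ℝ)⁻¹ * Λ (iteratedFDeriv ℝ k (N q.2).all 0 fun _ => q.1))
      =O[nearOrigin J] fun q => ‖q.1‖ ^ p := by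
  obtain ⟨M, r, hr, hJ⟩ := h
  have h1 : (fun q : State m n l × ℝ => (N q.2).all q.1 - ∑ k ∈ Finset.range p,
      (k.factorial : ℝ)⁻¹ • iteratedFDeriv ℝ k (N q.2).all 0 fun _ => q.1)
      =O[nearOrigin J] fun q => ‖q.1‖ ^ p := by
    refine IsBigO.of_bound M ?_
    rw [nearOrigin, eventually_prod_principal_iff]
    filter_upwards [Metric.ball_mem_nhds (0 : State m n l) hr] with u hu t ht
    rw [Real.norm_of_nonneg (by positivity)]
    exact norm_sub_taylor_le hp (hJ t ht).1 (hJ t ht).2 hu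
  refine ((Λ.isBigO_comp _ _).trans h1).congr_left fun q => ?_
  simp only [map_sub, map_sum, map_smul, smul_eq_mul]

end system

/-! ### Uniform error of the multinomial replacing the rational field -/

section system

variable {m n l : ℕ}

/-- The orders of vanishing at the origin, for times in `J`. -/
def LowOrderVanish (N : ℝ → Nonlin m n l) (J : Set ℝ) : Prop :=
  ∀ t ∈ J, ∀ (i : Idx m n l) (u : State m n l),
    (∀ k < 2, num i (iteratedFDeriv ℝ k (N t).all 0 fun _ => u) = 0) ∧
    den i (iteratedFDeriv ℝ 0 (N t).all 0 fun _ => u) = 0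

theorem eventually_mem_nearOrigin (J : Set ℝ) :
    ∀ᶠ q : State m n l × ℝ in nearOrigin J, q.2 ∈ J := by
  rw [nearOrigin, eventually_prod_principal_iff]
  exact Eventually.of_forall fun _ _ h => h

namespace CoeffClass

variable {T : Set ℝ} {ν : ℝ} (𝒞 : CoeffClass T ν)

/-- The terms of order less than `a` vanish for times in `J`, so starting the polynomial at order
`a` loses nothing there and builds the order of vanishing into the formal object. -/
theorem isBigO_sub_ev_taylorPoly {N : ℝ → Nonlin m n l} {J : Set ℝ} {p a : ℕ} (hp : 1 ≤ p)
    (hap : a ≤ p) (hN : 𝒞.ContainsTaylor N p) (hb : BoundedDeriv N J p)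
    (Λ : (State m n l × (ℝ × ℝ × ℝ)) →L[ℝ] ℝ)
    (hΛ : ∀ t ∈ J, ∀ u : State m n l, ∀ k < a,
      Λ (iteratedFDeriv ℝ k (N t).all 0 fun _ => u) = 0) :
    (fun q : State m n l × ℝ => Λ ((N q.2).all q.1)
      - 𝒞.ev q.2 (coord q.1) (𝒞.taylorPoly N Λ a p)) =O[nearOrigin J] fun q => ‖q.1‖ ^ p := by
  refine (hb.isBigO_sub_taylor hp Λ).congr' ?_ EventuallyEq.rfl
  filter_upwards [eventually_mem_nearOrigin J] with q hq
  rw [𝒞.ev_taylorPoly hN, ← Finset.sum_range_add_sum_Ico _ hap,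
    Finset.sum_eq_zero fun k hk => ?_, zero_add]
  rw [hΛ q.2 hq q.1 k (Finset.mem_range.1 hk), mul_zero]

/-- Numerator and denominator are replaced by Taylor polynomials with errors of order `p`. The
reciprocal is compared with a truncated geometric series, and since all factors stay bounded near
the origin, the errors multiply out to order `p`. -/
theorem isBigO_systemPoly_sub {N : ℝ → Nonlin m n l} {A : Matrix (Fin m) (Fin m) ℝ}
    {B : Matrix (Fin n) (Fin n) ℝ} {C : Matrix (Fin l) (Fin l) ℝ} {J : Set ℝ} {p : ℕ} (hp : 2 ≤ p)
    (hJ : ∀ f : 𝒞.realL, ∃ M, ∀ t ∈ J, |(f : ℝ → ℝ) t| ≤ M)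
    (hN : 𝒞.ContainsTaylor N p) (hb : BoundedDeriv N J p) (h0 : LowOrderVanish N J)
    (i : Idx m n l) :
    (fun q : State m n l × ℝ => 𝒞.ev q.2 (coord q.1) (𝒞.systemPoly N (linMat A B C) p i)
      - coord (ratRHS A B C N q.2 q.1) i) =O[nearOrigin J] fun q => ‖q.1‖ ^ p := by
  set D := 𝒞.taylorPoly N (den i) 1 p with hD
  set F := 𝒞.taylorPoly N (num i) 2 p with hF
  have hDm : D ∈ idealOfVars (Idx m n l) 𝒞.realL ^ 1 := 𝒞.taylorPoly_mem N (den i) 1 p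
  have hden : (fun q : State m n l × ℝ => den i ((N q.2).all q.1) - 𝒞.ev q.2 (coord q.1) D)
      =O[nearOrigin J] fun q => ‖q.1‖ ^ p :=
    𝒞.isBigO_sub_ev_taylorPoly (by omega) (by omega) hN hb _ fun t ht u k hk => by
      obtain rfl : k = 0 := by omega
      exact (h0 t ht i u).2
  have hnum : (fun q : State m n l × ℝ => num i ((N q.2).all q.1) - 𝒞.ev q.2 (coord q.1) F)
      =O[nearOrigin J] fun q => ‖q.1‖ ^ p :=
    𝒞.isBigO_sub_ev_taylorPoly (by omega) hp hN hb _ fun t ht u k hk => (h0 t ht i u).1 k hk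
  have hDO := 𝒞.isBigO_ev hJ hDm
  have hσ : (fun q : State m n l × ℝ => den i ((N q.2).all q.1)) =O[nearOrigin J]
      fun q => ‖q.1‖ ^ 1 := by
    refine ((hden.trans (isBigO_norm_pow (by omega))).add hDO).congr_left fun q => ?_
    ring
  have hσ0 : Tendsto (fun q : State m n l × ℝ => 1 + den i ((N q.2).all q.1)) (nearOrigin J)
      (𝓝 1) := by
    have h1 : Tendsto (fun q : State m n l × ℝ => ‖q.1‖ ^ 1) (nearOrigin J) (𝓝 0) := by
      simpa using (tendsto_fst_nearOrigin (m := m) (n := n) (l := l) J).norm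
    simpa using (hσ.trans_tendsto h1).const_add 1
  have hw : (fun q : State m n l × ℝ => (1 + den i ((N q.2).all q.1))⁻¹) =O[nearOrigin J]
      fun _ => (1 : ℝ) := (hσ0.inv₀ one_ne_zero).isBigO_one ℝ
  have hone : ∀ f : MvPolynomial (Idx m n l) 𝒞.realL,
      (fun q : State m n l × ℝ => 𝒞.ev q.2 (coord q.1) f) =O[nearOrigin J] fun _ => (1 : ℝ) :=
    fun f => by
      simpa using 𝒞.isBigO_ev hJ (k := 0) (f := f) (by simp)
  set Q := ∑ r ∈ Finset.range p, (-D) ^ r with hQ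
  have hgeom : (1 + D) * Q = 1 - (-D) ^ p := by
    have := mul_neg_geom_sum (-D) p
    rwa [sub_neg_eq_add] at this
  have hQw : (fun q : State m n l × ℝ => 𝒞.ev q.2 (coord q.1) Q
      - (1 + den i ((N q.2).all q.1))⁻¹) =O[nearOrigin J] fun q => ‖q.1‖ ^ p := by
    -- With `δ` the true denominator term, `(1 + D) Q = 1 - (-D) ^ p` gives `Q - (1 + δ)⁻¹ = (1 +
    -- δ)⁻¹ ((δ - D) Q - (-D) ^ p)`. Both summands have order `p`, the second because `D` vanishes
    -- at the origin.
    have h1 : (fun q : State m n l × ℝ => (1 + den i ((N q.2).all q.1))⁻¹ *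
        ((den i ((N q.2).all q.1) - 𝒞.ev q.2 (coord q.1) D) * 𝒞.ev q.2 (coord q.1) Q
          - (-𝒞.ev q.2 (coord q.1) D) ^ p)) =O[nearOrigin J] fun q => (1 : ℝ) * ‖q.1‖ ^ p := by
      refine hw.mul (IsBigO.sub ?_ ?_)
      · simpa using hden.mul (hone Q)
      · simpa using hDO.neg_left.pow p
    simp only [one_mul] at h1
    refine h1.congr' ?_ EventuallyEq.rfl
    filter_upwards [hσ0.eventually_ne one_ne_zero] with q hq
    have h2 := congrArg (𝒞.ev q.2 (coord q.1)) hgeom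
    simp only [map_mul, map_add, map_sub, map_pow, map_neg, map_one] at h2
    field_simp
    linear_combination -h2
  have hmain : (fun q : State m n l × ℝ =>
      (𝒞.ev q.2 (coord q.1) Q - (1 + den i ((N q.2).all q.1))⁻¹) *
        𝒞.ev q.2 (coord q.1) (linForm (linMat A B C) i + F)
      - (1 + den i ((N q.2).all q.1))⁻¹ *
        (num i ((N q.2).all q.1) - 𝒞.ev q.2 (coord q.1) F)) =O[nearOrigin J]
      fun q => ‖q.1‖ ^ p := by
    refine IsBigO.sub ?_ ?_
    · simpa only [mul_one] using hQw.mul (hone (linForm (linMat A B C) i + F))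
    · simpa using hw.mul hnum
  refine hmain.congr_left fun q => ?_
  have hlin : 𝒞.ev q.2 (coord q.1) (linForm (linMat A B C) i)
      = ∑ j, linMat A B C i j * coord q.1 j := by
    rw [linForm, map_sum]
    refine Finset.sum_congr rfl fun j _ => ?_
    rw [map_mul, ev_C, ev_X]
    rfl
  rw [coord_ratRHS, systemPoly, map_mul, ← hQ, ← hF, map_add, hlin]
  ring

end CoeffClass

theorem isBigO_pow_two_of_gauge {F : Type*} [NormedAddCommGroup F] {f : State m n l → F} {k : ℕ}
    (hf : f =O[𝓝 0] (gauge k : State m n l → ℝ)) :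
    f =O[𝓝 0] fun u : State m n l => ‖u - 0‖ ^ k := by
  refine hf.trans (IsBigO.of_bound 3 (Eventually.of_forall fun u => ?_))
  have h1 : 0 ≤ gauge k u := by unfold gauge; positivity
  rw [Real.norm_of_nonneg h1, Real.norm_of_nonneg (by positivity), sub_zero]
  exact gauge_le k u

/-- A differentiable function that is `O(‖u‖ ^ 2)` has zero value and, by uniqueness of the
derivative, zero differential at the origin. Being `O(‖u‖)` forces the value to vanish. -/
theorem GivenSystem.lowOrderVanish {A : Matrix (Fin m) (Fin m) ℝ} {B : Matrix (Fin n) (Fin n) ℝ}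
    {C : Matrix (Fin l) (Fin l) ℝ} {N : ℝ → Nonlin m n l} {T : Set ℝ} {d : Set (State m n l)}
    {α β : ℝ} {P : ℕ} (h : GivenSystem A B C N T d α β P) : LowOrderVanish N T := by
  intro t ht i u
  have hnum : (fun u => num i ((N t).all u)) =O[𝓝 0] fun u : State m n l => ‖u - 0‖ ^ 2 := by
    rcases i with i | i | i
    · exact (isBigO_pi.1 (isBigO_refl (N t).f _) i |>.trans
        (isBigO_pow_two_of_gauge (h.f_order t ht)) :)
    · exact (isBigO_pi.1 (isBigO_refl (N t).g _) i |>.trans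
        (isBigO_pow_two_of_gauge (h.g_order t ht)) :)
    · exact (isBigO_pi.1 (isBigO_refl (N t).h _) i |>.trans
        (isBigO_pow_two_of_gauge (h.h_order t ht)) :)
  have hden : (fun u => den i ((N t).all u)) =O[𝓝 0] fun u : State m n l => ‖u - 0‖ ^ 1 := by
    rcases i with i | i | i
    · exact isBigO_pow_two_of_gauge (h.fs_order t ht)
    · exact isBigO_pow_two_of_gauge (h.gs_order t ht)
    · exact isBigO_pow_two_of_gauge (h.hs_order t ht)
  have hzero : ∀ {f : State m n l → ℝ} {k : ℕ}, k ≠ 0 →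
      f =O[𝓝 0] (fun u : State m n l => ‖u - 0‖ ^ k) → f 0 = 0 := by
    intro f k hk hf
    obtain ⟨c, hc⟩ := hf.bound
    have := hc.self_of_nhds
    simpa [hk] using this
  have hd : HasFDerivAt (N t).all (fderiv ℝ (N t).all 0) 0 :=
    (((h.contDiff t ht).contDiffAt (h.isOpen.mem_nhds h.zero_mem)).differentiableAt (by
      have := h.two_le
      exact_mod_cast (by omega : P ≠ 0))).hasFDerivAt
  refine ⟨fun k hk => ?_, ?_⟩
  · interval_cases k
    · rw [iteratedFDeriv_zero_apply]
      exact hzero two_ne_zero hnum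
    · rw [iteratedFDeriv_one_apply]
      have h1 := (num i).hasFDerivAt.comp (0 : State m n l) hd
      have h2 := h1.unique (hnum.hasFDerivAt one_lt_two)
      exact congrArg (fun L : State m n l →L[ℝ] ℝ => L u) h2
  · rw [iteratedFDeriv_zero_apply]
    exact hzero one_ne_zero hden

end system

/-! ### From formal multinomials to the transformation and the normal form system -/

section assembly

variable {m n l : ℕ}

namespace CoeffClass

variable {T : Set ℝ} {ν : ℝ} (𝒞 : CoeffClass T ν)

/-- The coordinate transformation with given components. -/
def toTransform (ξ : Idx m n l → MvPolynomial (Idx m n l) 𝒞.realL) : CoordTransform m n l where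
  x i := 𝒞.toTPoly (ξ (.inl i))
  y i := 𝒞.toTPoly (ξ (.inr (.inl i)))
  z i := 𝒞.toTPoly (ξ (.inr (.inr i)))

theorem map_toTransform (ξ : Idx m n l → MvPolynomial (Idx m n l) 𝒞.realL) (t : ℝ)
    (U : State m n l) :
    (𝒞.toTransform ξ).map t U = ofCoord fun i => 𝒞.ev t (coord U) (ξ i) := by
  simp only [CoordTransform.map, toTransform, val_toTPoly]
  rfl

theorem coeffsSatisfy_toTransform {ξ : Idx m n l → MvPolynomial (Idx m n l) 𝒞.realL}
    {R : (ℝ → ℝ) → Prop} (h : ∀ i d, R ((coeff d (ξ i) : 𝒞.realL) : ℝ → ℝ)) :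
    (𝒞.toTransform ξ).CoeffsSatisfy R := by
  refine ⟨fun i d => ?_, fun i d => ?_, fun i d => ?_⟩ <;>
  simp only [toTransform, coeff_toTPoly] <;> exact h _ d

theorem hasDerivWithinAt_map {ξ η : Idx m n l → MvPolynomial (Idx m n l) 𝒞.realL}
    (h : ∀ i, CoeffPairsMem 𝒞.timeDeriv (ξ i) (η i)) (U : State m n l) {t : ℝ} (ht : t ∈ T) :
    HasDerivWithinAt (fun s => (𝒞.toTransform ξ).map s U)
      (ofCoord fun i => 𝒞.ev t (coord U) (η i)) T t := by
  simp only [map_toTransform]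
  exact ofCoord.hasFDerivAt.comp_hasDerivWithinAt t
    (hasDerivWithinAt_pi.2 fun i => 𝒞.hasDerivWithinAt_ev (h i) (coord U) ht)

theorem coord_fderiv_map (ξ : Idx m n l → MvPolynomial (Idx m n l) 𝒞.realL) (t : ℝ)
    (U V : State m n l) (i : Idx m n l) :
    coord (fderiv ℝ ((𝒞.toTransform ξ).map t) U V) i
      = ∑ a, 𝒞.ev t (coord U) (pderiv a (ξ i)) * coord V a := by
  have h1 : HasFDerivAt ((𝒞.toTransform ξ).map t) (ofCoord.comp (ContinuousLinearMap.pi fun i =>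
      ∑ a, 𝒞.ev t (coord U) (pderiv a (ξ i)) • (coordL a : State m n l →L[ℝ] ℝ))) U := by
    have h2 : (𝒞.toTransform ξ).map t = fun U => ofCoord fun i => 𝒞.ev t (coord U) (ξ i) :=
      funext fun U => 𝒞.map_toTransform ξ t U
    rw [h2]
    exact ofCoord.hasFDerivAt.comp U (hasFDerivAt_pi.2 fun i => 𝒞.hasFDerivAt_ev t U (ξ i))
  rw [h1.fderiv]
  simp [-Fintype.sum_sum_type]

/-- A normal form system has prescribed nonlinear terms. -/
def HasNonlinearTerms (S : NormalForm m n l)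
    (W : Idx m n l → MvPolynomial (Idx m n l) 𝒞.realL) : Prop :=
  ∀ t U, (∀ i, S.F t U i = 𝒞.ev t (coord U) (W (.inl i))) ∧
    (∀ i, (S.matG t U).mulVec U.2.1 i = 𝒞.ev t (coord U) (W (.inr (.inl i)))) ∧
    ∀ i, (S.matH t U).mulVec U.2.2 i = 𝒞.ev t (coord U) (W (.inr (.inr i)))

/-- The property `R` is quantified after `S`, so that continuity, boundedness and absence of linear
memory can all be read off for one and the same system. -/
theorem exists_normalForm {W : Idx m n l → MvPolynomial (Idx m n l) 𝒞.realL}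
    (hW : ∀ i, IsNormal 𝒞.realK i (W i)) :
    ∃ S : NormalForm m n l, 𝒞.HasNonlinearTerms S W ∧
      ∀ R : (ℝ → ℝ) → Prop, (∀ f ∈ 𝒞.realK, R (f : ℝ → ℝ)) → S.CoeffsSatisfy R := by
  have hx : ∀ i : Fin m, ∃ (Fc : MvPolynomial (Fin m) 𝒞.realL)
      (FT : Fin n → Fin l → MvPolynomial (Idx m n l) 𝒞.realL),
      CoeffsMem 𝒞.realK Fc ∧ (∀ j k, CoeffsMem 𝒞.realK (FT j k)) ∧ W (.inl i)
        = rename .inl Fc + ∑ j, ∑ k, FT j k * X (.inr (.inl j)) * X (.inr (.inr k)) :=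
    fun i => hW (.inl i)
  have hy : ∀ i : Fin n, ∃ G : Fin n → MvPolynomial (Idx m n l) 𝒞.realL,
      (∀ j, CoeffsMem 𝒞.realK (G j)) ∧ W (.inr (.inl i)) = ∑ j, G j * X (.inr (.inl j)) :=
    fun i => hW (.inr (.inl i))
  have hz : ∀ i : Fin l, ∃ H : Fin l → MvPolynomial (Idx m n l) 𝒞.realL,
      (∀ k, CoeffsMem 𝒞.realK (H k)) ∧ W (.inr (.inr i)) = ∑ k, H k * X (.inr (.inr k)) :=
    fun i => hW (.inr (.inr i))
  choose Fc FT hFc hFT hx using hx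
  choose G hG hy using hy
  choose H hH hz using hz
  refine ⟨⟨fun i => 𝒞.toTPoly (Fc i), fun i j k => 𝒞.toTPoly (FT i j k),
    fun i j => 𝒞.toTPoly (G i j), fun i j => 𝒞.toTPoly (H i j)⟩, fun t U =>
    ⟨fun i => ?_, fun i => ?_, fun i => ?_⟩, fun R hR =>
    ⟨fun i s => ?_, fun i j k s => ?_, fun i j s => ?_, fun i j s => ?_⟩⟩
  · rw [hx, map_add, ev_rename]
    simp only [NormalForm.F, val_toTPoly, map_sum, map_mul, ev_X]
    rfl
  · rw [hy]
    simp only [NormalForm.matG, Matrix.mulVec, dotProduct, Matrix.of_apply, val_toTPoly, map_sum,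
      map_mul, ev_X]
    rfl
  · rw [hz]
    simp only [NormalForm.matH, Matrix.mulVec, dotProduct, Matrix.of_apply, val_toTPoly, map_sum,
      map_mul, ev_X]
    rfl
  · simpa only [coeff_toTPoly] using hR _ (hFc i s)
  · simpa only [coeff_toTPoly] using hR _ (hFT i j k s)
  · simpa only [coeff_toTPoly] using hR _ (hG i j s)
  · simpa only [coeff_toTPoly] using hR _ (hH i j s)

variable {A : Matrix (Fin m) (Fin m) ℝ} {B : Matrix (Fin n) (Fin n) ℝ}
  {C : Matrix (Fin l) (Fin l) ℝ}

theorem ev_linForm (L : Matrix (Idx m n l) (Idx m n l) ℝ) (i : Idx m n l) (t : ℝ)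
    (v : Idx m n l → ℝ) : 𝒞.ev t v (linForm L i) = ∑ j, L i j * v j := by
  rw [linForm, map_sum]
  refine Finset.sum_congr rfl fun j _ => ?_
  rw [map_mul, ev_C, ev_X]
  rfl

theorem HasNonlinearTerms.coord_rhs {S : NormalForm m n l}
    {W : Idx m n l → MvPolynomial (Idx m n l) 𝒞.realL} (h : 𝒞.HasNonlinearTerms S W) (t : ℝ)
    (U : State m n l) (a : Idx m n l) :
    coord (S.rhs A B C t U) a = 𝒞.ev t (coord U) (linForm (linMat A B C) a + W a) := by
  obtain ⟨h1, h2, h3⟩ := h t U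
  rw [map_add, ev_linForm]
  rcases a with a | a | a
  · rw [← h1]
    simp [NormalForm.rhs, coord, linMat, Matrix.mulVec, dotProduct]
  · rw [← h2]
    simp [NormalForm.rhs, coord, linMat, Matrix.mulVec, dotProduct, add_mul,
      Finset.sum_add_distrib]
  · rw [← h3]
    simp [NormalForm.rhs, coord, linMat, Matrix.mulVec, dotProduct, add_mul,
      Finset.sum_add_distrib]

/-- The multinomial field `R` is added and subtracted at the transformed point. Unique
differentiability of `T` identifies `derivWithin` with the formal time derivative `η`. -/
theorem coord_difference {N : ℝ → Nonlin m n l} {S : NormalForm m n l}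
    {R ξ η W : Idx m n l → MvPolynomial (Idx m n l) 𝒞.realL} (hT : UniqueDiffOn ℝ T)
    (hξ : ∀ i, CoeffPairsMem 𝒞.timeDeriv (ξ i) (η i)) (hS : 𝒞.HasNonlinearTerms S W) {t : ℝ}
    (ht : t ∈ T) (U : State m n l) (i : Idx m n l) :
    coord (difference A B C N T (𝒞.toTransform ξ) S t U) i
      = 𝒞.ev t (coord U) (formalDifference (linMat A B C) R ξ η W i)
        + (𝒞.ev t (coord ((𝒞.toTransform ξ).map t U)) (R i)
          - coord (ratRHS A B C N t ((𝒞.toTransform ξ).map t U)) i) := by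
  rw [difference, coord_sub, coord_add, (𝒞.hasDerivWithinAt_map hξ U ht).derivWithin (hT t ht),
    coord_ofCoord, coord_fderiv_map, formalDifference, map_sub, map_add, map_sum, ev_aeval,
    map_toTransform, coord_ofCoord]
  simp only [hS.coord_rhs, map_mul]
  ring

/-- The formal difference is of order `p` by its ideal membership. The error of the multinomial
field is of order `p` in the transformed point `u`, and the near identity estimate `u = O(‖U‖)`
turns this into order `p` in `U`. -/
theorem orderClaims {N : ℝ → Nonlin m n l} {S : NormalForm m n l} {p : ℕ} (hp : 2 ≤ p)
    {ξ η W : Idx m n l → MvPolynomial (Idx m n l) 𝒞.realL} (hT : UniqueDiffOn ℝ T)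
    (hξ : ∀ i, CoeffPairsMem 𝒞.timeDeriv (ξ i) (η i)) (hS : 𝒞.HasNonlinearTerms S W)
    (hξ2 : ∀ i, ξ i - X i ∈ idealOfVars (Idx m n l) 𝒞.realL ^ 2)
    (hW2 : ∀ i, W i ∈ idealOfVars (Idx m n l) 𝒞.realL ^ 2)
    (hE : ∀ i, formalDifference (linMat A B C) (𝒞.systemPoly N (linMat A B C) p) ξ η W i
      ∈ idealOfVars (Idx m n l) 𝒞.realL ^ p)
    {J : Set ℝ} (hJT : J ⊆ T) (hJ : ∀ f : 𝒞.realL, ∃ M, ∀ t ∈ J, |(f : ℝ → ℝ) t| ≤ M)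
    (hN : 𝒞.ContainsTaylor N p) (hb : BoundedDeriv N J p) (h0 : LowOrderVanish N J) :
    OrderClaims A B C N T p (𝒞.toTransform ξ) S J := by
  have hξO : (fun q : State m n l × ℝ => (𝒞.toTransform ξ).map q.2 q.1 - q.1)
      =O[nearOrigin J] fun q => ‖q.1‖ ^ 2 := by
    refine isBigO_of_coord fun i => (𝒞.isBigO_ev hJ (hξ2 i)).congr_left fun q => ?_
    rw [coord_sub, map_toTransform, coord_ofCoord, map_sub, ev_X]
  have hmap : (fun q : State m n l × ℝ => (𝒞.toTransform ξ).map q.2 q.1)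
      =O[nearOrigin J] fun q => ‖q.1‖ := by
    have h1 : (fun q : State m n l × ℝ => q.1) =O[nearOrigin J] fun q => ‖q.1‖ :=
      (isBigO_refl _ _).norm_right
    have h2 := isBigO_norm_pow (m := m) (n := n) (l := l) (J := J) one_le_two
    simp only [pow_one] at h2
    refine ((hξO.trans h2).add h1).congr_left fun q => ?_
    abel
  have htend : Tendsto (fun q : State m n l × ℝ => ((𝒞.toTransform ξ).map q.2 q.1, q.2))
      (nearOrigin J) (nearOrigin J) := by
    have h1 : Tendsto (fun q : State m n l × ℝ => ‖q.1‖) (nearOrigin J) (𝓝 0) := by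
      simpa using (tendsto_fst_nearOrigin (m := m) (n := n) (l := l) J).norm
    exact (hmap.trans_tendsto h1).prodMk tendsto_snd
  refine ⟨isOrc_of_isBigO hξO, isOrc_of_isBigO ?_, isOrc_of_isBigO ?_, isOrc_of_isBigO ?_,
    isOrc_of_isBigO (isBigO_of_coord fun i => ?_)⟩
  · exact isBigO_pi.2 fun i => (𝒞.isBigO_ev hJ (hW2 (.inl i))).congr_left fun q =>
      ((hS q.2 q.1).1 i).symm
  · exact isBigO_pi.2 fun i => (𝒞.isBigO_ev hJ (hW2 (.inr (.inl i)))).congr_left fun q =>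
      ((hS q.2 q.1).2.1 i).symm
  · exact isBigO_pi.2 fun i => (𝒞.isBigO_ev hJ (hW2 (.inr (.inr i)))).congr_left fun q =>
      ((hS q.2 q.1).2.2 i).symm
  · have h1 := (𝒞.isBigO_systemPoly_sub (A := A) (B := B) (C := C) hp hJ hN hb h0 i).comp_tendsto
      htend
    have h2 : (fun q : State m n l × ℝ => ‖(𝒞.toTransform ξ).map q.2 q.1‖ ^ p)
        =O[nearOrigin J] fun q => ‖q.1‖ ^ p := hmap.norm_left.pow p
    refine ((𝒞.isBigO_ev hJ (hE i)).add (h1.trans h2)).congr' ?_ EventuallyEq.rfl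
    filter_upwards [eventually_mem_nearOrigin J] with q hq
    exact (𝒞.coord_difference hT hξ hS (hJT hq) q.1 i).symm

theorem contDiffOn_of_timeDeriv (hT : UniqueDiffOn ℝ T) {f g : 𝒞.realL}
    (h : (f, g) ∈ 𝒞.timeDeriv) : ContDiffOn ℝ 1 (f : ℝ → ℝ) T := by
  rw [contDiffOn_one_iff_derivWithin hT]
  exact ⟨fun t ht => (h t ht).differentiableWithinAt,
    (𝒞.continuousOn_realL g).congr fun t ht => (h t ht).derivWithin (hT t ht)⟩

/-- The normal form over a class of coefficient functions. -/
theorem exists_transform_normalForm {N : ℝ → Nonlin m n l} {d : Set (State m n l)} {α β : ℝ}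
    {P : ℕ} (hT : UniqueDiffOn ℝ T) (hsys : GivenSystem A B C N T d α β P)
    (hν : ν < β - ((P : ℝ) - 1) * α) {p : ℕ} (hp : 2 ≤ p) (hpP : p ≤ P)
    (hN : 𝒞.ContainsTaylor N p) :
    ∃ (ξ : CoordTransform m n l) (S : NormalForm m n l),
      ξ.CoeffsSatisfy (fun c => ContDiffOn ℝ 1 c T ∧ c ∈ 𝒞.realL) ∧
      (∀ R : (ℝ → ℝ) → Prop, (∀ f ∈ 𝒞.realK, R (f : ℝ → ℝ)) → S.CoeffsSatisfy R) ∧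
      ∀ J ⊆ T, (∀ f : 𝒞.realL, ∃ M, ∀ t ∈ J, |(f : ℝ → ℝ) t| ≤ M) → BoundedDeriv N J p →
        OrderClaims A B C N T p ξ S J := by
  have hsolve : ∀ q, 2 ≤ q → q < p →
      HomologicalSolvable (linMat A B C) 𝒞.realK 𝒞.timeDeriv q := by
    intro q _ hqp R
    refine 𝒞.solve_homological hsys.center hsys.stable hsys.unstable hsys.alpha_nonneg
      hsys.beta_pos (hν.trans_le ?_) R
    -- Only degrees `q < p ≤ P` are treated, so the upper bound `β - (P - 1) * α` on the threshold
    -- suffices for each homological equation.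
    have h1 : (q : ℝ) ≤ (P : ℝ) - 1 := by
      have : (q : ℝ) + 1 ≤ P := by exact_mod_cast (by omega : q + 1 ≤ P)
      linarith
    have := mul_le_mul_of_nonneg_right h1 hsys.alpha_nonneg
    linarith
  obtain ⟨ξ, η, W, h1, h2, h3, h4, h5⟩ := exists_formal_normalForm
    (L := linMat A B C) (K := 𝒞.realK) (𝓓 := 𝒞.timeDeriv)
    (fun t _ => hasDerivWithinAt_const t T (1 : ℝ))
    (fun i => 𝒞.systemPoly_sub_mem N (linMat A B C) (by omega : 1 ≤ p) i) hp hsolve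
  obtain ⟨S, hS, hSR⟩ := 𝒞.exists_normalForm h2
  refine ⟨𝒞.toTransform ξ, S, 𝒞.coeffsSatisfy_toTransform fun i d =>
    ⟨𝒞.contDiffOn_of_timeDeriv hT (h1 i d), (coeff d (ξ i)).2⟩, hSR, fun J hJT hJ hb =>
    𝒞.orderClaims hp hT h1 hS h3 h4 h5 hJT hJ hN hb fun t ht => hsys.lowOrderVanish t (hJT ht)⟩

end CoeffClass

end assembly

end RatNF
end

noncomputable section

namespace RatNF

/-! ### Bounds and Taylor coefficients of the given system -/

section given

variable {m n l : ℕ} {A : Matrix (Fin m) (Fin m) ℝ} {B : Matrix (Fin n) (Fin n) ℝ}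
  {C : Matrix (Fin l) (Fin l) ℝ} {N : ℝ → Nonlin m n l} {T : Set ℝ} {d : Set (State m n l)}
  {α β : ℝ} {P : ℕ}

theorem zero_mem_nonautTerms (N : ℝ → Nonlin m n l) (N₀ : Nonlin m n l) {p : ℕ} (hp : 0 < p) :
    (fun _ => (0 : ℝ)) ∈ nonautTerms N N₀ p :=
  ⟨0, hp, fun _ => 0, 0, by simp⟩

namespace GivenSystem

theorem exists_closedBall_subset (h : GivenSystem A B C N T d α β P) :
    ∃ r > 0, Metric.closedBall (0 : State m n l) r ⊆ d :=
  Metric.nhds_basis_closedBall.mem_iff.1 (h.isOpen.mem_nhds h.zero_mem)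

/-- Joint continuity in time and state bounds the derivative on the compact product of `K` with a
closed ball; the ball is compact because the state space has finite dimension. -/
theorem boundedDeriv_of_isCompact (h : GivenSystem A B C N T d α β P) {p : ℕ} (hpP : p ≤ P)
    {K : Set ℝ} (hKT : K ⊆ T) (hK : IsCompact K) : BoundedDeriv N K p := by
  obtain ⟨r, hr, hrd⟩ := h.exists_closedBall_subset
  obtain ⟨M, hM⟩ := (hK.prod (isCompact_closedBall (0 : State m n l) r)).exists_bound_of_continuousOn
    ((h.continuous p hpP).mono (prod_mono hKT hrd))
  refine ⟨M, r, hr, fun t ht => ⟨?_, fun u hu => hM (t, u) ⟨ht, Metric.ball_subset_closedBall hu⟩⟩⟩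
  exact ((h.contDiff t (hKT ht)).of_le (by exact_mod_cast hpP)).mono
    (Metric.ball_subset_closedBall.trans hrd)

theorem boundedDeriv_of_uniformlyBounded (h : GivenSystem A B C N T d α β P) {p : ℕ} (hpP : p ≤ P)
    (hU : UniformlyBounded N T P) : BoundedDeriv N T p := by
  obtain ⟨r, hr, hrd⟩ := h.exists_closedBall_subset
  obtain ⟨M, r', hr', hM⟩ := hU
  refine ⟨M, min r r', lt_min hr hr', fun t ht => ⟨?_, fun u hu => hM t ht u ?_ p hpP⟩⟩
  · exact ((h.contDiff t ht).of_le (by exact_mod_cast hpP)).mono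
      ((Metric.ball_subset_ball (min_le_left _ _)).trans (Metric.ball_subset_closedBall.trans hrd))
  · rw [mem_ball_zero_iff] at hu
    exact hu.trans_le (min_le_right _ _)

theorem continuousOn_taylor (h : GivenSystem A B C N T d α β P) {k : ℕ} (hk : k ≤ P)
    (Λ : (State m n l × (ℝ × ℝ × ℝ)) →L[ℝ] ℝ) (v : Fin k → State m n l) :
    ContinuousOn (fun t => Λ (iteratedFDeriv ℝ k (N t).all 0 v)) T := by
  have h1 : ContinuousOn (fun t : ℝ => iteratedFDeriv ℝ k (N t).all (0 : State m n l)) T :=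
    (h.continuous k hk).comp (f := fun t : ℝ => (t, (0 : State m n l))) (by fun_prop)
      fun t ht => ⟨ht, h.zero_mem⟩
  exact Λ.continuous.comp_continuousOn
    ((ContinuousMultilinearMap.apply ℝ (fun _ : Fin k => State m n l) _ v).continuous.comp_continuousOn
      h1)

theorem iteratedFDeriv_sub (h : GivenSystem A B C N T d α β P) {N₀ : Nonlin m n l}
    (hN₀ : ContDiffOn ℝ P N₀.all d) {k : ℕ} (hk : k ≤ P) {t : ℝ} (ht : t ∈ T) :
    iteratedFDeriv ℝ k (fun u => (N t).all u - N₀.all u) 0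
      = iteratedFDeriv ℝ k (N t).all 0 - iteratedFDeriv ℝ k N₀.all 0 := by
  have hd := h.isOpen.mem_nhds h.zero_mem
  exact iteratedFDeriv_sub_apply
    (((h.contDiff t ht).contDiffAt hd).of_le (by exact_mod_cast hk))
    ((hN₀.contDiffAt hd).of_le (by exact_mod_cast hk))

theorem continuousOn_nonautTerms (h : GivenSystem A B C N T d α β P) {N₀ : Nonlin m n l}
    (hN₀ : ContDiffOn ℝ P N₀.all d) {p : ℕ} (hpP : p ≤ P) {a : ℝ → ℝ}
    (ha : a ∈ nonautTerms N N₀ p) : ContinuousOn a T := by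
  obtain ⟨k, hk, v, Λ, rfl⟩ := ha
  refine ((h.continuousOn_taylor (hk.le.trans hpP) Λ v).sub
    (continuousOn_const (c := Λ (iteratedFDeriv ℝ k N₀.all 0 v)))).congr fun t ht => ?_
  rw [h.iteratedFDeriv_sub hN₀ (hk.le.trans hpP) ht]
  simp

theorem bounded_nonautTerms (h : GivenSystem A B C N T d α β P) {N₀ : Nonlin m n l}
    (hN₀ : ContDiffOn ℝ P N₀.all d) {p : ℕ} (hpP : p ≤ P) (hU : UniformlyBounded N T P)
    {a : ℝ → ℝ} (ha : a ∈ nonautTerms N N₀ p) : ∃ M, ∀ t ∈ T, |a t| ≤ M := by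
  obtain ⟨k, hk, v, Λ, rfl⟩ := ha
  obtain ⟨M, r, hr, hM⟩ := hU
  refine ⟨‖Λ‖ * ((M + ‖iteratedFDeriv ℝ k N₀.all 0‖) * ∏ i, ‖v i‖), fun t ht => ?_⟩
  refine (Λ.le_opNorm _).trans (mul_le_mul_of_nonneg_left ?_ (norm_nonneg _))
  refine (ContinuousMultilinearMap.le_opNorm _ _).trans
    (mul_le_mul_of_nonneg_right ?_ (Finset.prod_nonneg fun _ _ => norm_nonneg _))
  rw [h.iteratedFDeriv_sub hN₀ (hk.le.trans hpP) ht]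
  exact (norm_sub_le _ _).trans
    (add_le_add_left (hM t ht 0 (by simpa using hr) k (hk.le.trans hpP)) _)

theorem containsTaylor_ofContinuous (h : GivenSystem A B C N T d α β P) (ν : ℝ)
    (hT : T.OrdConnected) (hT' : T.Nonempty) {p : ℕ} (hpP : p ≤ P) :
    (CoeffClass.ofContinuous ν hT hT').ContainsTaylor N p := fun _ hk Λ v =>
  Complex.continuous_ofReal.comp_continuousOn (h.continuousOn_taylor (hk.le.trans hpP) Λ v)

/-- A Taylor coefficient of the given functions is a constant, from the autonomous part, plus one
non-autonomous term; no convolution and no quadratic part occurs yet. -/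
theorem containsTaylor_ofMemory (h : GivenSystem A B C N T d α β P) {N₀ : Nonlin m n l}
    (hN₀ : ContDiffOn ℝ P N₀.all d) {p : ℕ} (hpP : p ≤ P) (hT : T.OrdConnected) {ν : ℝ}
    (hν : 0 ≤ ν) (h𝒮 : ∀ a ∈ nonautTerms N N₀ p, BddContOn T fun t => (a t : ℂ))
    (h0 : (fun _ => (0 : ℝ)) ∈ nonautTerms N N₀ p) :
    (CoeffClass.ofMemory hT hν h𝒮 h0).ContainsTaylor N p := by
  intro k hk Λ v
  refine ⟨(Λ (iteratedFDeriv ℝ k N₀.all 0 v) : ℂ), _, 0, .term ⟨k, hk, v, Λ, rfl⟩, .zero h0,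
    fun t ht => ?_⟩
  rw [h.iteratedFDeriv_sub hN₀ (hk.le.trans hpP) ht]
  simp

end GivenSystem

end given

theorem CoeffClass.exists_bound_of_isCompact {T : Set ℝ} {ν : ℝ} (𝒞 : CoeffClass T ν) {K : Set ℝ}
    (hKT : K ⊆ T) (hK : IsCompact K) (f : 𝒞.realL) : ∃ M, ∀ t ∈ K, |(f : ℝ → ℝ) t| ≤ M :=
  hK.exists_bound_of_continuousOn ((𝒞.continuousOn_realL f).mono hKT)

end RatNF
end

/-! ### The main theorem, split by boundedness of the non-autonomous terms -/

theorem mainTheorem11 {m n l : ℕ}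
    (A : Matrix (Fin m) (Fin m) ℝ) (B : Matrix (Fin n) (Fin n) ℝ) (C : Matrix (Fin l) (Fin l) ℝ)
    (N : ℝ → RatNF.Nonlin m n l) (T : Set ℝ) (d : Set (RatNF.State m n l)) (α β : ℝ) (P : ℕ)
    (hT : T.OrdConnected) (hT' : T.Nontrivial)
    (hsys : RatNF.GivenSystem A B C N T d α β P)
    (ν : ℝ) (hν : (P : ℝ) * α ≤ ν) (hν' : ν < β - ((P : ℝ) - 1) * α)
    (N₀ : RatNF.Nonlin m n l) (hN₀ : ContDiffOn ℝ P N₀.all d)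
    (p : ℕ) (hp : 2 ≤ p) (hpP : p ≤ P) :
    ∃ (ξ : RatNF.CoordTransform m n l) (S : RatNF.NormalForm m n l),
      ξ.CoeffsSatisfy (fun c => ContDiffOn ℝ 1 c T) ∧
      S.CoeffsSatisfy (fun c => ContinuousOn c T) ∧
      (∀ K ⊆ T, IsCompact K → RatNF.OrderClaims A B C N T p ξ S K) ∧
      S.CoeffsSatisfy (RatNF.NoLinearMemory T ν (RatNF.nonautTerms N N₀ p)) ∧
      (RatNF.UniformlyBounded N T P →
        ξ.CoeffsSatisfy (fun c => ∃ M, ∀ t ∈ T, |c t| ≤ M) ∧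
        S.CoeffsSatisfy (fun c => ∃ M, ∀ t ∈ T, |c t| ≤ M) ∧
        RatNF.OrderClaims A B C N T p ξ S T) := by
  have hT₁ : UniqueDiffOn ℝ T :=
    uniqueDiffOn_convex hT.convex (hT.convex.nontrivial_iff_nonempty_interior.1 hT')
  have hν0 : 0 ≤ ν := (mul_nonneg (Nat.cast_nonneg P) hsys.alpha_nonneg).trans hν
  have h0 := RatNF.zero_mem_nonautTerms N N₀ (by omega : 0 < p)
  by_cases hbdd : ∀ a ∈ RatNF.nonautTerms N N₀ p, ∃ M, ∀ t ∈ T, |a t| ≤ M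
  · -- bounded terms: memory and anticipation integrals converge
    have h𝒮 : ∀ a ∈ RatNF.nonautTerms N N₀ p, RatNF.BddContOn T fun t => (a t : ℂ) := by
      intro a ha
      obtain ⟨M, hM⟩ := hbdd a ha
      exact ⟨Complex.continuous_ofReal.comp_continuousOn
        (hsys.continuousOn_nonautTerms hN₀ hpP ha), M, fun t ht => by
          simpa using hM t ht⟩
    let 𝒞 := RatNF.CoeffClass.ofMemory hT hν0 h𝒮 h0
    have hbd : ∀ f : 𝒞.realL, ∃ M, ∀ t ∈ T, |(f : ℝ → ℝ) t| ≤ M := by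
      intro f
      obtain ⟨-, M, hM⟩ := RatNF.BddContOn.of_mem_ofMemory hT hν0 h𝒮 h0 f.2
      exact ⟨M, fun t ht => by simpa using hM t ht⟩
    obtain ⟨ξ, S, hξ, hS, hO⟩ := 𝒞.exists_transform_normalForm hT₁ hsys hν' hp hpP
      (hsys.containsTaylor_ofMemory hN₀ hpP hT hν0 h𝒮 h0)
    refine ⟨ξ, S, ⟨fun i s => (hξ.1 i s).1, fun i s => (hξ.2.1 i s).1, fun i s => (hξ.2.2 i s).1⟩,
      hS _ fun f _ => 𝒞.continuousOn_realL f, fun K hKT hK => hO K hKT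
        (𝒞.exists_bound_of_isCompact hKT hK) (hsys.boundedDeriv_of_isCompact hpP hKT hK),
      hS _ fun f hf => RatNF.noLinearMemory_of_mem h0 hf, fun hU =>
      ⟨⟨fun i s => hbd ⟨_, (hξ.1 i s).2⟩, fun i s => hbd ⟨_, (hξ.2.1 i s).2⟩,
        fun i s => hbd ⟨_, (hξ.2.2 i s).2⟩⟩, hS _ fun f _ => hbd f,
        hO T subset_rfl hbd (hsys.boundedDeriv_of_uniformlyBounded hpP hU)⟩⟩
  · -- unbounded terms: these integrals may diverge, but initial value problems remove all terms
    let 𝒞 := RatNF.CoeffClass.ofContinuous ν hT hT'.nonempty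
    obtain ⟨ξ, S, hξ, hS, hO⟩ := 𝒞.exists_transform_normalForm hT₁ hsys hν' hp hpP
      (hsys.containsTaylor_ofContinuous ν hT hT'.nonempty hpP)
    refine ⟨ξ, S, ⟨fun i s => (hξ.1 i s).1, fun i s => (hξ.2.1 i s).1, fun i s => (hξ.2.2 i s).1⟩,
      hS _ fun f _ => 𝒞.continuousOn_realL f, fun K hKT hK => hO K hKT
        (𝒞.exists_bound_of_isCompact hKT hK) (hsys.boundedDeriv_of_isCompact hpP hKT hK),
      hS _ fun f hf => ?_, fun hU => absurd (fun a ha =>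
        hsys.bounded_nonautTerms hN₀ hpP hU ha) hbdd⟩
    -- Corrections lie in `⊥`, so every coefficient of this normal form is zero and decomposes
    -- trivially.
    have hf0 : ∀ t, ((f : ℝ → ℝ) t : ℂ) = 0 := fun t => congrFun ((Submodule.mem_bot ℂ).1 hf) t
    exact ⟨0, Submodule.zero_mem _, 0, .zero h0, fun t _ => by simp [hf0 t]⟩
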